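/- **Setting.** Let $(\mathcal M,\mathfrak A,\mu)$ be a $\sigma$-finite measure space with countably generated $\sigma$-algebra, $\mathfrak h:=L^2(\mathcal M,\mu)$ (complex), and let $\mathscr F=\mathbb C\oplus\bigoplus_{n\ge1}\mathscr F^{(n)}$ be the bosonic Fock space over $\mathfrak h$, where $\mathscr F^{(n)}$ is the space of permutation symmetric elements of $L^2(\mathcal M^n,\mu^n)$. For measurable $\varkappa:\mathcal M\to\mathbb R$, $\mathrm d\Gamma(\varkappa)$ is the maximal operator in $\mathscr F$ multiplying $\psi^{(n)}(k_1,\dots,k_n)$ by $\sum_{\ell=1}^n\varkappa(k_\ell)$. For $f\in\mathfrak h$, let $a^\dagger(f)$ and $a(f)$ be the creation and annihilation operators on their maximal domains, $$(a^\dagger(f)\psi)^{(n)}(k_1,\dots,k_n)=n^{-1/2}\sum_{\ell=1}^nf(k_\ell)\psi^{(n-1)}(\dots,k_{\ell-1},k_{\ell+1},\dots),\quad(a^\dagger(f)\psi)^{(0)}=0,$$ $$(a(f)\psi)^{(n)}(k_1,\dots,k_n)=(n+1)^{1/2}\int_{\mathcal M}\overline{f(k)}\,\psi^{(n+1)}(k_1,\dots,k_n,k)\,\mathrm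 d\mu(k),$$ and let $\varphi(f)$ be the self-adjoint field operator, i.e. the closure of $a^\dagger(f)+a(f)$. For $h\in\mathfrak h$ let $\zeta(h)\in\mathscr F$ be the exponential vector with components $\zeta(h)^{(n)}=(n!)^{-1/2}i^nh^{\otimes n}$, and for $\mathfrak v\subset\mathfrak h$ let $\mathscr C[\mathfrak v]:=\mathrm{span}_{\mathbb C}\{\zeta(h):h\in\mathfrak v\}$. Let $\nu,S,L\in\mathbb N$ and let $\sigma_1,\dots,\sigma_S$ be hermitian $L\times L$ matrices with $\|\sigma_j\|\le1$. Let $\omega:\mathcal M\to\mathbb R$ and $\boldsymbol m=(m_1,\dots,m_\nu):\mathcal M\to\mathbb R^\nu$ be measurable with $\omega>0$ $\mu$-a.e., and set $$\mathfrak d:=\{f\in\mathfrak h:(\omega+\tfrac12\boldsymbol m^2)f\in\mathfrak h\},\qquad\mathfrak k:=L^2\big(\mathcal M,[\omega^{-1}+(\omega+\tfrac12\boldsymbol m^2)^2]\mu\big).$$ For $\boldsymbol x\in\mathbb R^\nu$ let $\boldsymbol G_{\boldsymbol x}\in\mathfrak h^\nu$ and $\boldsymbol F_{\boldsymbol x}\in\mathfrak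 h^S$ be such that $\boldsymbol x\mapsto\boldsymbol G_{\boldsymbol x}$ is in $C^2(\mathbb R^\nu,\mathfrak h^\nu)$, $\boldsymbol x\mapsto\boldsymbol F_{\boldsymbol x}\in\mathfrak h^S$ is globally Lipschitz continuous, and the components of $\boldsymbol G_{\boldsymbol x}$, $\partial_{x_\ell}\boldsymbol G_{\boldsymbol x}$, $\boldsymbol F_{\boldsymbol x}$ and $i\boldsymbol m\cdot\boldsymbol G_{\boldsymbol x}$ belong to $\mathfrak k$ and are bounded and continuous $\mathfrak k$-valued functions of $\boldsymbol x$. Let $C:\mathfrak h\to\mathfrak h$ be an anti-linear isometry with $C^2=1$ that commutes with multiplication by $e^{-t\omega+i\boldsymbol m\cdot\boldsymbol x}$ for all $t\ge0$, $\boldsymbol x\in\mathbb R^\nu$, and satisfies $CG_{\ell,\boldsymbol x}=G_{\ell,\boldsymbol x}$, $CF_{j,\boldsymbol x}=F_{j,\boldsymbol x}$ for all $\ell,j,\boldsymbol x$. Put $q_{\boldsymbol x}:=\sum_\ell\partial_{x_\ell}G_{\ell,\boldsymbol x}$ and $\mathfrak d_C:=\{f\in\mathfrak d:Cf=f\}$.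 Let $M:=\frac12\sum_\ell\mathrm d\Gamma(m_\ell)^2+\mathrm d\Gamma(\omega)$ and $\widehat{\mathcal D}:=\mathbb C^L\otimes\mathcal D(M)\subset\mathbb C^L\otimes\mathscr F$ (algebraic tensor product). For $\boldsymbol\xi,\boldsymbol x\in\mathbb R^\nu$ and $a\ge1$, define $$M_a(\boldsymbol\xi):=1\otimes\big(\tfrac12(\boldsymbol\xi-\mathrm d\Gamma(\boldsymbol m))^2+a\,\mathrm d\Gamma(\omega)\big),\qquad\widehat H^0(\boldsymbol\xi,\boldsymbol x):=1\otimes\widehat H^0_{\rm sc}(\boldsymbol\xi,\boldsymbol x)-\sum_{j=1}^S\sigma_j\otimes\varphi(F_{j,\boldsymbol x})\ \text{ on }\widehat{\mathcal D},$$ where, on $\mathcal D(M)$, $$\widehat H^0_{\rm sc}(\boldsymbol\xi,\boldsymbol x):=\tfrac12(\boldsymbol\xi-\mathrm d\Gamma(\boldsymbol m))^2-\varphi(\boldsymbol G_{\boldsymbol x})\cdot(\boldsymbol\xi-\mathrm d\Gamma(\boldsymbol m))+\tfrac12\varphi(\boldsymbol G_{\boldsymbol x})^2-\tfrac i2\varphi(q_{\boldsymbol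 x})-\tfrac i2\varphi(i\boldsymbol m\cdot\boldsymbol G_{\boldsymbol x})+\mathrm d\Gamma(\omega).$$ Here squares and dot products of tuples of operators are sums over the components, and sums and products of operators have their natural domains. **Proposition.** Let $\boldsymbol\xi,\boldsymbol x\in\mathbb R^\nu$. Every $M_a(\boldsymbol\eta)$ with $a\ge1$, $\boldsymbol\eta\in\mathbb R^\nu$, has domain $\widehat{\mathcal D}$, and $\widehat H^0(\boldsymbol\xi,\boldsymbol x)$ is well-defined and closed on $\widehat{\mathcal D}$. For every $\varepsilon>0$ there exist $a\ge1$ and a constant $c(\varepsilon)$ such that $$\big\|\big(\widehat H^0(\boldsymbol\xi,\boldsymbol x)-M_1(\boldsymbol\xi)\big)\psi\big\|\le\varepsilon\|M_a(\boldsymbol\xi)\psi\|+c(\varepsilon)\|\psi\|,\quad\psi\in\widehat{\mathcal D},$$ and there is a constant $c$ such that $$\|\widehat H^0(\boldsymbol\xi,\boldsymbol x)\psi\|\le c\,(\|M_1(\boldsymbol\xi)\psi\|+\|\psi\|),\quad\psi\in\widehat{\mathcal D}.$$ The subspace $\mathbb C^L\otimes\mathscr C[\mathfrak d_C]$ is a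 core of $M_1(\boldsymbol 0)$ and of $\widehat H^0(\boldsymbol\xi,\boldsymbol x)$ and, more generally, every core of $M_1(\boldsymbol 0)$ is a core of $\widehat H^0(\boldsymbol\xi,\boldsymbol x)$. If $q_{\boldsymbol x}=0$, then $\widehat H^0(\boldsymbol\xi,\boldsymbol x)$ is self-adjoint on $\widehat{\mathcal D}$. -/

import Mathlib

open MeasureTheory Complex

noncomputable section

namespace FiberHam

/-! ### Partially defined linear operators -/

section Operators

variable {H : Type*} [AddCommGroup H] [Module ℂ H]

/-- The composition `g f` of unbounded operators on its natural domain
`{x ∈ dom f | f x ∈ dom g}`. -/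
def opComp (g f : H →ₗ.[ℂ] H) : H →ₗ.[ℂ] H :=
  g.comp (f.domRestrict ((g.domain.comap f.toFun).map f.domain.subtype)) (by
    intro x
    obtain ⟨y, hy, hxy⟩ := x.2.1
    rw [LinearPMap.domRestrict_apply (x := x) (y := y) hxy.symm]
    exact hy)

/-- Multiplication by a scalar, defined everywhere. -/
def opScalar (c : ℂ) : H →ₗ.[ℂ] H := (c • LinearMap.id : H →ₗ[ℂ] H).toPMap ⊤

/-- The formal scalar product `A · B = ∑ₗ Aₗ Bₗ` of two tuples of operators. -/
def opDot {n : ℕ} (A B : Fin n → H →ₗ.[ℂ] H) : H →ₗ.[ℂ] H := ∑ l, opComp (A l) (B l)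

end Operators

/-! ### The bosonic Fock space over `L²(M, μ)` -/

section Fock

variable {M : Type*} [MeasurableSpace M] (μ : Measure M) [SigmaFinite μ]

/-- The one-boson space. -/
abbrev OneBoson : Type _ := Lp ℂ 2 μ

/-- The `n`-fold product measure. -/
abbrev prodMeas (n : ℕ) : Measure (Fin n → M) := Measure.pi (fun _ : Fin n => μ)

theorem measurePreserving_perm (n : ℕ) (π : Equiv.Perm (Fin n)) :
    MeasurePreserving (fun k : Fin n → M => fun i => k (π i)) (prodMeas μ n) (prodMeas μ n) :=
  (measurePreserving_piCongrLeft (fun _ : Fin n => μ) π).symm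

/-- The `n`-boson space: all `ψ ∈ L²(Mⁿ, μⁿ)` with
`ψ(k₁, …, kₙ) = ψ(k_{π(1)}, …, k_{π(n)})`, `μⁿ`-a.e., for every permutation `π`.
(For `n = 0`, `M⁰` is a point of mass one, so that this space is a copy of `ℂ`.) -/
def SymL2 (n : ℕ) : Submodule ℂ (Lp ℂ 2 (prodMeas μ n)) :=
  ⨅ π : Equiv.Perm (Fin n), LinearMap.eqLocus
    (Lp.compMeasurePreservingₗ ℂ (E := ℂ) (p := 2) _ (measurePreserving_perm μ n π)) LinearMap.id

theorem mem_symL2_iff (n : ℕ) (ψ : Lp ℂ 2 (prodMeas μ n)) :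
    ψ ∈ SymL2 μ n ↔ ∀ π : Equiv.Perm (Fin n),
      ∀ᵐ k ∂(prodMeas μ n), ψ k = ψ (fun i => k (π i)) := by
  simp only [SymL2, Submodule.mem_iInf, LinearMap.mem_eqLocus]
  refine forall_congr' fun π => ?_
  have h := Lp.coeFn_compMeasurePreserving ψ (measurePreserving_perm μ n π)
  constructor
  · intro e
    have e' : Lp.compMeasurePreserving _ (measurePreserving_perm μ n π) ψ = ψ := e
    rw [e'] at h
    exact h
  · intro e
    refine Lp.ext ?_
    refine Filter.EventuallyEq.trans h ?_
    filter_upwards [e] with k hk using hk.symm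

theorem isClosed_symL2 (n : ℕ) : IsClosed (SymL2 μ n : Set (Lp ℂ 2 (prodMeas μ n))) := by
  simp only [SymL2, Submodule.coe_iInf]
  refine isClosed_iInter fun π => ?_
  exact isClosed_eq
    (Lp.isometry_compMeasurePreserving (E := ℂ) (p := 2)
      (measurePreserving_perm μ n π)).continuous continuous_id

instance instCompleteSpaceSymL2 (n : ℕ) : CompleteSpace (SymL2 μ n) :=
  (isClosed_symL2 μ n).completeSpace_coe

/-- The bosonic Fock space, the Hilbert sum of the `n`-boson spaces. -/
abbrev Fock : Type _ := lp (fun n : ℕ => SymL2 μ n) 2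

variable {μ}

/-- (A representative of) the `n`-boson component of a Fock space vector. -/
def Fock.wave (ψ : Fock μ) (n : ℕ) : (Fin n → M) → ℂ := ((ψ n : SymL2 μ n) : Lp ℂ 2 (prodMeas μ n))

theorem wave_add (ψ η : Fock μ) (n : ℕ) :
    Fock.wave (ψ + η) n =ᵐ[prodMeas μ n] fun k => ψ.wave n k + η.wave n k :=
  Lp.coeFn_add _ _

theorem wave_smul (c : ℂ) (ψ : Fock μ) (n : ℕ) :
    Fock.wave (c • ψ) n =ᵐ[prodMeas μ n] fun k => c * ψ.wave n k :=
  Lp.coeFn_smul _ _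

theorem wave_zero (n : ℕ) : Fock.wave (0 : Fock μ) n =ᵐ[prodMeas μ n] fun _ => 0 :=
  Lp.coeFn_zero _ _ _

theorem memLp_wave (ψ : Fock μ) (n : ℕ) : MemLp (ψ.wave n) 2 (prodMeas μ n) := Lp.memLp _

theorem quasi_removeNth (n : ℕ) (l : Fin (n + 1)) :
    Measure.QuasiMeasurePreserving (fun k : Fin (n + 1) → M => l.removeNth k)
      (prodMeas μ (n + 1)) (prodMeas μ n) :=
  Measure.quasiMeasurePreserving_snd.comp
    (measurePreserving_piFinSuccAbove (fun _ : Fin (n + 1) => μ) l).quasiMeasurePreserving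

theorem measurePreserving_snoc (n : ℕ) :
    MeasurePreserving (fun p : M × (Fin n → M) => (Fin.snoc p.2 p.1 : Fin (n + 1) → M))
      (μ.prod (prodMeas μ n)) (prodMeas μ (n + 1)) := by
  have h := (measurePreserving_piFinSuccAbove (fun _ : Fin (n + 1) => μ) (Fin.last n)).symm
  convert h using 1
  funext p
  simp [MeasurableEquiv.piFinSuccAbove, Fin.insertNthEquiv]

theorem ae_snoc {n : ℕ} {p : (Fin (n + 1) → M) → Prop} (h : ∀ᵐ k ∂(prodMeas μ (n + 1)), p k) :
    ∀ᵐ k ∂(prodMeas μ n), ∀ᵐ k' ∂μ, p (Fin.snoc k k') := by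
  have h1 := (measurePreserving_snoc (μ := μ) n).quasiMeasurePreserving.ae h
  have h2 := (Measure.measurePreserving_swap (μ := prodMeas μ n) (ν := μ)).quasiMeasurePreserving.ae h1
  exact Measure.ae_ae_of_ae_prod h2

theorem integrable_snoc (f : OneBoson μ) (ψ : Fock μ) (n : ℕ) :
    ∀ᵐ k ∂(prodMeas μ n),
      Integrable (fun k' => (starRingEnd ℂ) (f k') * ψ.wave (n + 1) (Fin.snoc k k')) μ := by
  have hs := (memLp_wave ψ (n + 1)).comp_measurePreserving (measurePreserving_snoc (μ := μ) n)
  have hs' := hs.comp_measurePreserving (Measure.measurePreserving_swap (μ := prodMeas μ n) (ν := μ))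
  have h1 := ((memLp_two_iff_integrable_sq_norm hs'.1).1 hs').prod_right_ae
  have h2 := hs'.1.prodMk_left
  filter_upwards [h1, h2] with k hk1 hk2
  have hm := (memLp_two_iff_integrable_sq_norm hk2).2 hk1
  exact (Lp.memLp f).star.integrable_mul hm

/-- The maximal operator `dΓ(κ)`, multiplication of the `n`-boson component by
`κ(k₁) + ⋯ + κ(kₙ)`, as a graph. -/
def dGammaGraph (κ : M → ℝ) : Submodule ℂ (Fock μ × Fock μ) where
  carrier := {p | ∀ n, p.2.wave n =ᵐ[prodMeas μ n] fun k => ((∑ i, κ (k i) : ℝ) : ℂ) * p.1.wave n k}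
  zero_mem' n := by
    filter_upwards [wave_zero (μ := μ) n] with k hk
    simp [hk]
  add_mem' {a b} ha hb n := by
    filter_upwards [ha n, hb n, wave_add a.1 b.1 n, wave_add a.2 b.2 n] with k h1 h2 h3 h4
    simp only [Prod.fst_add, Prod.snd_add, h1, h2, h3, h4]
    ring
  smul_mem' c a ha n := by
    filter_upwards [ha n, wave_smul c a.1 n, wave_smul c a.2 n] with k h1 h2 h3
    simp only [Prod.smul_fst, Prod.smul_snd, h1, h2, h3]
    ring

/-- The differential second quantization of the multiplication operator `κ`. -/
def dGamma (μ : Measure M) [SigmaFinite μ] (κ : M → ℝ) : Fock μ →ₗ.[ℂ] Fock μ := (dGammaGraph κ).toLinearPMap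

/-- The graph of the creation operator `a†(f)` on its maximal domain. -/
def creationGraph (f : OneBoson μ) : Submodule ℂ (Fock μ × Fock μ) where
  carrier := {p | p.2.wave 0 =ᵐ[prodMeas μ 0] 0 ∧ ∀ n,
    p.2.wave (n + 1) =ᵐ[prodMeas μ (n + 1)] fun k =>
      ((Real.sqrt (n + 1))⁻¹ : ℂ) * ∑ l, f (k l) * p.1.wave n (l.removeNth k)}
  zero_mem' := by
    refine ⟨wave_zero 0, fun n => ?_⟩
    have h : ∀ᵐ k ∂(prodMeas μ (n + 1)), ∀ l : Fin (n + 1),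
        Fock.wave (0 : Fock μ) n (l.removeNth k) = 0 :=
      ae_all_iff.2 fun l => (quasi_removeNth n l).ae (wave_zero n)
    filter_upwards [wave_zero (μ := μ) (n + 1), h] with k hk h
    simp [hk, h]
  add_mem' {a b} ha hb := by
    refine ⟨?_, fun n => ?_⟩
    · filter_upwards [ha.1, hb.1, wave_add a.2 b.2 0] with k h1 h2 h3
      simp [h1, h2, h3]
    have h : ∀ᵐ k ∂(prodMeas μ (n + 1)), ∀ l : Fin (n + 1),
        Fock.wave (a.1 + b.1) n (l.removeNth k) =
          a.1.wave n (l.removeNth k) + b.1.wave n (l.removeNth k) :=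
      ae_all_iff.2 fun l => (quasi_removeNth n l).ae (wave_add a.1 b.1 n)
    filter_upwards [ha.2 n, hb.2 n, wave_add a.2 b.2 (n + 1), h] with k h1 h2 h3 h4
    simp only [Prod.fst_add, Prod.snd_add, h1, h2, h3, h4, mul_add, Finset.sum_add_distrib]
  smul_mem' c a ha := by
    refine ⟨?_, fun n => ?_⟩
    · filter_upwards [ha.1, wave_smul c a.2 0] with k h1 h2
      simp [h1, h2]
    have h : ∀ᵐ k ∂(prodMeas μ (n + 1)), ∀ l : Fin (n + 1),
        Fock.wave (c • a.1) n (l.removeNth k) = c * a.1.wave n (l.removeNth k) :=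
      ae_all_iff.2 fun l => (quasi_removeNth n l).ae (wave_smul c a.1 n)
    filter_upwards [ha.2 n, wave_smul c a.2 (n + 1), h] with k h1 h2 h3
    simp only [Prod.smul_fst, Prod.smul_snd, h1, h2, h3, Finset.mul_sum]
    refine Finset.sum_congr rfl fun l _ => ?_
    ring

/-- The creation operator `a†(f)`. -/
def creation (f : OneBoson μ) : Fock μ →ₗ.[ℂ] Fock μ := (creationGraph f).toLinearPMap

/-- The graph of the annihilation operator `a(f)` on its maximal domain. -/
def annihilationGraph (f : OneBoson μ) : Submodule ℂ (Fock μ × Fock μ) where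
  carrier := {p | ∀ n, p.2.wave n =ᵐ[prodMeas μ n] fun k =>
    (Real.sqrt (n + 1) : ℂ) * ∫ k', (starRingEnd ℂ) (f k') * p.1.wave (n + 1) (Fin.snoc k k') ∂μ}
  zero_mem' n := by
    filter_upwards [wave_zero (μ := μ) n, ae_snoc (wave_zero (μ := μ) (n + 1))] with k h1 h2
    have : ∫ k', (starRingEnd ℂ) (f k') * Fock.wave (0 : Fock μ) (n + 1) (Fin.snoc k k') ∂μ
        = ∫ _, (0 : ℂ) ∂μ := integral_congr_ae (by
      filter_upwards [h2] with k' h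
      simp [h])
    simp only [Prod.fst_zero, Prod.snd_zero, h1, this]
    simp
  add_mem' {a b} ha hb n := by
    filter_upwards [ha n, hb n, wave_add a.2 b.2 n, ae_snoc (wave_add a.1 b.1 (n + 1)),
      integrable_snoc f a.1 n, integrable_snoc f b.1 n] with k h1 h2 h3 h4 h5 h6
    have : ∫ k', (starRingEnd ℂ) (f k') * Fock.wave (a.1 + b.1) (n + 1) (Fin.snoc k k') ∂μ
        = ∫ k', ((starRingEnd ℂ) (f k') * a.1.wave (n + 1) (Fin.snoc k k') +
          (starRingEnd ℂ) (f k') * b.1.wave (n + 1) (Fin.snoc k k')) ∂μ := integral_congr_ae (by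
      filter_upwards [h4] with k' h
      simp only [h, mul_add])
    simp only [Prod.fst_add, Prod.snd_add, h1, h2, h3, this, integral_add h5 h6, mul_add]
  smul_mem' c a ha n := by
    filter_upwards [ha n, wave_smul c a.2 n, ae_snoc (wave_smul c a.1 (n + 1))] with k h1 h2 h3
    have : ∫ k', (starRingEnd ℂ) (f k') * Fock.wave (c • a.1) (n + 1) (Fin.snoc k k') ∂μ
        = ∫ k', c * ((starRingEnd ℂ) (f k') * a.1.wave (n + 1) (Fin.snoc k k')) ∂μ :=
      integral_congr_ae (by
      filter_upwards [h3] with k' h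
      simp only [h]
      ring)
    simp only [Prod.smul_fst, Prod.smul_snd, h1, h2, this, integral_const_mul]
    ring

/-- The annihilation operator `a(f)`. -/
def annihilation (f : OneBoson μ) : Fock μ →ₗ.[ℂ] Fock μ := (annihilationGraph f).toLinearPMap

/-- The (self-adjoint) field operator `φ(f)`, the closure of `a†(f) + a(f)`. -/
def field (f : OneBoson μ) : Fock μ →ₗ.[ℂ] Fock μ := (creation f + annihilation f).closure

/-! ### Exponential vectors -/

theorem memLp_tensorPow (h : OneBoson μ) (n : ℕ) :
    MemLp (fun k : Fin n → M => ∏ i, h (k i)) 2 (prodMeas μ n) := by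
  have hm : AEStronglyMeasurable (fun k : Fin n → M => ∏ i, h (k i)) (prodMeas μ n) := by
    refine Finset.aestronglyMeasurable_fun_prod _ fun i _ => ?_
    exact (Lp.aestronglyMeasurable h).comp_quasiMeasurePreserving
      (Measure.quasiMeasurePreserving_eval (fun _ : Fin n => μ) i)
  refine (memLp_two_iff_integrable_sq_norm hm).2 ?_
  have := Integrable.fintype_prod (ι := Fin n) (𝕜 := ℝ) (f := fun _ k => ‖h k‖ ^ 2)
    (μ := fun _ => μ) (fun _ => (memLp_two_iff_integrable_sq_norm (Lp.aestronglyMeasurable h)).1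
      (Lp.memLp h))
  simpa only [norm_prod, Finset.prod_pow] using this

/-- The tensor power `h^{⊗n}`, `(k₁, …, kₙ) ↦ h(k₁) ⋯ h(kₙ)`. -/
def tensorPow (h : OneBoson μ) (n : ℕ) : SymL2 μ n :=
  ⟨(memLp_tensorPow h n).toLp _, by
    rw [mem_symL2_iff]
    intro π
    have h1 := (memLp_tensorPow h n).coeFn_toLp
    have h2 := (measurePreserving_perm μ n π).quasiMeasurePreserving.ae h1
    filter_upwards [h1, h2] with k h1 h2
    rw [h1, h2]
    exact (Equiv.prod_comp π fun i => h (k i)).symm⟩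

theorem norm_tensorPow_sq (h : OneBoson μ) (n : ℕ) :
    ‖tensorPow h n‖ ^ 2 = (‖h‖ ^ 2) ^ n := by
  have key : ∀ {X : Type _} [MeasurableSpace X] {ρ : Measure X} (g : Lp ℂ 2 ρ),
      ‖g‖ ^ 2 = ∫ x, ‖g x‖ ^ 2 ∂ρ := by
    intro X _ ρ g
    rw [← inner_self_eq_norm_sq (𝕜 := ℂ) g, L2.inner_def, ← integral_re (L2.integrable_inner g g)]
    simp only [inner_self_eq_norm_sq]
  have h0 : ‖tensorPow h n‖ = ‖(memLp_tensorPow h n).toLp _‖ := rfl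
  rw [h0, key, key h]
  have h1 : ∫ k, ‖((memLp_tensorPow h n).toLp _ : Lp ℂ 2 (prodMeas μ n)) k‖ ^ 2 ∂(prodMeas μ n)
      = ∫ k : Fin n → M, ∏ i, ‖h (k i)‖ ^ 2 ∂(prodMeas μ n) := integral_congr_ae (by
    filter_upwards [(memLp_tensorPow h n).coeFn_toLp] with k hk
    simp only [hk, norm_prod, Finset.prod_pow])
  rw [h1, integral_fintype_prod_eq_pow (fun k => ‖h k‖ ^ 2)]
  simp

/-- The exponential vector `ζ(h)`, with `n`-boson component `(n!)^{-1/2} iⁿ h^{⊗n}`. -/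
def expVec (h : OneBoson μ) : Fock μ :=
  ⟨fun n => (((Real.sqrt (n.factorial))⁻¹ : ℂ) * I ^ n) • tensorPow h n, by
    refine memℓp_gen ?_
    have : ∀ n : ℕ, ‖(((Real.sqrt (n.factorial))⁻¹ : ℂ) * I ^ n) • tensorPow h n‖ ^
        (2 : ENNReal).toReal = (‖h‖ ^ 2) ^ n / n.factorial := by
      intro n
      have h2 : (2 : ENNReal).toReal = ((2 : ℕ) : ℝ) := by norm_num
      rw [h2, Real.rpow_natCast, norm_smul, mul_pow, norm_tensorPow_sq]
      simp only [norm_mul, norm_inv, norm_pow, norm_I, one_pow, mul_one, norm_real,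
        Real.norm_eq_abs, inv_pow, sq_abs]
      rw [Real.sq_sqrt (by positivity)]
      field_simp
    simp_rw [this]
    exact Real.summable_pow_div_factorial _⟩

/-- The complex linear hull of the exponential vectors `ζ(h)`, `h ∈ v`. -/
def expSpan (v : Set (OneBoson μ)) : Submodule ℂ (Fock μ) := Submodule.span ℂ (expVec '' v)

end Fock

/-! ### Generalized fiber Hamiltonians -/

section Model

variable {M : Type*} [MeasurableSpace M] {μ : Measure M} [SigmaFinite μ] {ν S L : ℕ}

/-- The fiber Hilbert space `ℂ^L ⊗ 𝓕`, realized as the `L`-fold Hilbert sum of Fock space. -/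
abbrev FiberSpace (μ : Measure M) [SigmaFinite μ] (L : ℕ) : Type _ :=
  PiLp 2 (fun _ : Fin L => Fock μ)

/-- The algebraic tensor product `ℂ^L ⊗ D`. -/
def tensorDomain (L : ℕ) (D : Submodule ℂ (Fock μ)) : Submodule ℂ (FiberSpace μ L) where
  carrier := {Ψ | ∀ i, Ψ i ∈ D}
  zero_mem' _ := D.zero_mem
  add_mem' ha hb i := D.add_mem (ha i) (hb i)
  smul_mem' c _ ha i := D.smul_mem c (ha i)

/-- The operator `A ⊗ T` on `ℂ^L ⊗ dom T`. -/
def tensorOp (A : Matrix (Fin L) (Fin L) ℂ) (T : Fock μ →ₗ.[ℂ] Fock μ) :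
    FiberSpace μ L →ₗ.[ℂ] FiberSpace μ L where
  domain := tensorDomain L T.domain
  toFun :=
    { toFun := fun Ψ => WithLp.toLp 2 fun i => ∑ j, A i j • T ⟨Ψ.1 j, Ψ.2 j⟩
      map_add' := fun Ψ Φ => by
        ext1 i
        have h : ∀ j, T ⟨(Ψ + Φ).1 j, (Ψ + Φ).2 j⟩ = T ⟨Ψ.1 j, Ψ.2 j⟩ + T ⟨Φ.1 j, Φ.2 j⟩ :=
          fun j => T.map_add ⟨Ψ.1 j, Ψ.2 j⟩ ⟨Φ.1 j, Φ.2 j⟩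
        simp only [PiLp.add_apply, h, smul_add, Finset.sum_add_distrib]
      map_smul' := fun c Ψ => by
        ext1 i
        have h : ∀ j, T ⟨(c • Ψ).1 j, (c • Ψ).2 j⟩ = c • T ⟨Ψ.1 j, Ψ.2 j⟩ :=
          fun j => T.map_smul c ⟨Ψ.1 j, Ψ.2 j⟩
        simp only [PiLp.smul_apply, h, RingHom.id_apply, Finset.smul_sum]
        exact Finset.sum_congr rfl fun j _ => smul_comm _ _ _ }

/-- `M = ½ ∑ₗ dΓ(mₗ)² + dΓ(ω)`. -/
def opM (μ : Measure M) [SigmaFinite μ] (ω : M → ℝ) (m : Fin ν → M → ℝ) : Fock μ →ₗ.[ℂ] Fock μ :=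
  (1 / 2 : ℂ) • opDot (fun l => dGamma μ (m l)) (fun l => dGamma μ (m l)) + dGamma μ ω

/-- The domain `D̂ = ℂ^L ⊗ dom M`. -/
def domHat (μ : Measure M) [SigmaFinite μ] (L : ℕ) (ω : M → ℝ) (m : Fin ν → M → ℝ) :
    Submodule ℂ (FiberSpace μ L) :=
  tensorDomain L (opM μ ω m).domain

/-- The `l`-th component of `ξ - dΓ(m)`. -/
def kin (μ : Measure M) [SigmaFinite μ] (m : Fin ν → M → ℝ) (ξ : EuclideanSpace ℝ (Fin ν))
    (l : Fin ν) : Fock μ →ₗ.[ℂ] Fock μ :=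
  opScalar (ξ l : ℂ) - dGamma μ (m l)

/-- `M_a(ξ) = 1 ⊗ (½ (ξ - dΓ(m))² + a dΓ(ω))`. -/
def opMa (μ : Measure M) [SigmaFinite μ] (L : ℕ) (ω : M → ℝ) (m : Fin ν → M → ℝ) (a : ℝ)
    (ξ : EuclideanSpace ℝ (Fin ν)) : FiberSpace μ L →ₗ.[ℂ] FiberSpace μ L :=
  tensorOp 1 ((1 / 2 : ℂ) • opDot (kin μ m ξ) (kin μ m ξ) + (a : ℂ) • dGamma μ ω)

open Classical in
/-- The element of `L²(M, μ)` given by a square-integrable function (zero otherwise). -/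
def toL2 (μ : Measure M) (f : M → ℂ) : OneBoson μ :=
  if h : MemLp f 2 μ then h.toLp f else 0

/-- The function `i m · G`, for a vector `G` of one-boson wave functions. -/
def imDot (m : Fin ν → M → ℝ) (g : Fin ν → OneBoson μ) : M → ℂ :=
  fun k => I * ∑ l, (m l k : ℂ) * g l k

/-- The partial derivative `∂_{x_j} G_{l,x}`, taken in `L²(M, μ)`. -/
def partialG (G : EuclideanSpace ℝ (Fin ν) → Fin ν → OneBoson μ) (j l : Fin ν)
    (x : EuclideanSpace ℝ (Fin ν)) : OneBoson μ :=
  fderiv ℝ (fun y => G y l) x (EuclideanSpace.single j 1)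

/-- `q_x = div_x G_x`. -/
def divG (G : EuclideanSpace ℝ (Fin ν) → Fin ν → OneBoson μ) (x : EuclideanSpace ℝ (Fin ν)) :
    OneBoson μ :=
  ∑ l, partialG G l l x

/-- The scalar generalized fiber Hamiltonian, defined on `dom M` by
`½ (ξ - dΓ(m))² - φ(G_x) · (ξ - dΓ(m)) + ½ φ(G_x)² - (i/2) φ(q_x) - (i/2) φ(i m · G_x)
  + dΓ(ω) + V(x)`. -/
def scalarHam (ω : M → ℝ) (m : Fin ν → M → ℝ)
    (G : EuclideanSpace ℝ (Fin ν) → Fin ν → OneBoson μ) (V : EuclideanSpace ℝ (Fin ν) → ℝ)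
    (ξ x : EuclideanSpace ℝ (Fin ν)) : Fock μ →ₗ.[ℂ] Fock μ :=
  ((1 / 2 : ℂ) • opDot (kin μ m ξ) (kin μ m ξ)
    - opDot (fun l => field (G x l)) (kin μ m ξ)
    + (1 / 2 : ℂ) • opDot (fun l => field (G x l)) (fun l => field (G x l))
    - (I / 2) • field (divG G x)
    - (I / 2) • field (toL2 μ (imDot m (G x)))
    + dGamma μ ω + opScalar (V x : ℂ)).domRestrict (opM μ ω m).domain

/-- The generalized fiber Hamiltonian `Ĥ^V(ξ,x) = 1 ⊗ Ĥ_sc^V(ξ,x) - σ · φ(F_x)` on `D̂`. -/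
def fiberHam (ω : M → ℝ) (m : Fin ν → M → ℝ)
    (G : EuclideanSpace ℝ (Fin ν) → Fin ν → OneBoson μ)
    (F : EuclideanSpace ℝ (Fin ν) → Fin S → OneBoson μ)
    (σ : Fin S → Matrix (Fin L) (Fin L) ℂ) (V : EuclideanSpace ℝ (Fin ν) → ℝ)
    (ξ x : EuclideanSpace ℝ (Fin ν)) : FiberSpace μ L →ₗ.[ℂ] FiberSpace μ L :=
  (tensorOp 1 (scalarHam ω m G V ξ x) - ∑ j, tensorOp (σ j) (field (F x j))).domRestrict
    (domHat μ L ω m)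

/-! ### The standing hypothesis on the coefficients -/

/-- The function `ω + ½ m²`. -/
def totalSymbol (ω : M → ℝ) (m : Fin ν → M → ℝ) (k : M) : ℝ := ω k + 1 / 2 * ∑ l, m l k ^ 2

/-- The measure `[ω⁻¹ + (ω + ½ m²)²] μ`, whose `L²`-space is `𝔨`. -/
def kMeasure (μ : Measure M) (ω : M → ℝ) (m : Fin ν → M → ℝ) : Measure M :=
  μ.withDensity fun k => ENNReal.ofReal ((ω k)⁻¹ + totalSymbol ω m k ^ 2)

/-- The functions `f x`, `x ∈ ℝ^ν`, belong to `𝔨`, and `x ↦ f x ∈ 𝔨` is continuous and bounded. -/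
def ContBddInK (μ : Measure M) (ω : M → ℝ) (m : Fin ν → M → ℝ)
    (f : EuclideanSpace ℝ (Fin ν) → M → ℂ) : Prop :=
  ∃ g : BoundedContinuousFunction (EuclideanSpace ℝ (Fin ν)) (Lp ℂ 2 (kMeasure μ ω m)),
    ∀ x, g x =ᵐ[μ] f x

/-- The standing hypothesis on `ω`, `m`, `G`, `F` and the conjugation `C`. -/
structure Hyp (μ : Measure M) (ω : M → ℝ) (m : Fin ν → M → ℝ)
    (G : EuclideanSpace ℝ (Fin ν) → Fin ν → OneBoson μ)
    (F : EuclideanSpace ℝ (Fin ν) → Fin S → OneBoson μ)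
    (C : OneBoson μ →ₛₗᵢ[starRingEnd ℂ] OneBoson μ) : Prop where
  measurable_omega : Measurable ω
  measurable_m : ∀ l, Measurable (m l)
  omega_pos : ∀ᵐ k ∂μ, 0 < ω k
  contDiff_G : ∀ l, ContDiff ℝ 2 fun x => G x l
  lipschitz_F : ∃ K, ∀ j, LipschitzWith K fun x => F x j
  k_G : ∀ l, ContBddInK μ ω m fun x => G x l
  k_partialG : ∀ j l, ContBddInK μ ω m fun x => partialG G j l x
  k_F : ∀ j, ContBddInK μ ω m fun x => F x j
  k_imG : ContBddInK μ ω m fun x => imDot m (G x)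
  C_invol : ∀ f, C (C f) = f
  -- `C` commutes with multiplication by `exp(-tω + i m · x)`
  C_comm : ∀ (t : ℝ) (x : EuclideanSpace ℝ (Fin ν)), 0 ≤ t → ∀ f g : OneBoson μ,
    (g =ᵐ[μ] fun k => exp (-(t * ω k : ℝ) + I * (∑ l, m l k * x l : ℝ)) * f k) →
    (C g =ᵐ[μ] fun k => exp (-(t * ω k : ℝ) + I * (∑ l, m l k * x l : ℝ)) * C f k)
  C_G : ∀ x l, C (G x l) = G x l
  C_F : ∀ x j, C (F x j) = F x j

/-- `𝔡_C`: the elements of `𝔡 = dom(ω + ½ m²)` that are real with respect to `C`. -/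
def dC (ω : M → ℝ) (m : Fin ν → M → ℝ) (C : OneBoson μ →ₛₗᵢ[starRingEnd ℂ] OneBoson μ) :
    Set (OneBoson μ) :=
  {f | MemLp (fun k => (totalSymbol ω m k : ℂ) * f k) 2 μ ∧ C f = f}

end Model

end FiberHam

end

/-! Write `Ω` for `dΓ(ω)` and `H = M_1(ξ) + W`. On each `n`-particle sector the unperturbed
operators multiply by explicit symbols, so all comparisons between them are pointwise inequalities,
integrated through the weighted norms `wsq`.

Relative bound. Cauchy–Schwarz with the splitting `ω^{-1/2} · ω^{1/2}` shows that `a(f)` and `a†(f)`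
lose half a power of `1 + Ω`, with constant `∫ |f|² (1 + ω)^{p+1} / ω` (`wsq_creation_le`,
`wsq_annihilation_le`); this is finite for `p ≤ 1` when `f ∈ 𝔨`. Every term of `W` is then
controlled by the weight `(1 + Ω)|ξ - m|² + (1 + Ω)²`. The square of the symbol `½|ξ - m|² + aΩ`
contains `a|ξ - m|²Ω` and `a²Ω²`, so a large `a` lets `ε²` times this square dominate the weight up
to a constant (`PosSymbols.intWeight_le`). Smallness is thus relative to `M_a(ξ)`, not to `M_1(ξ)`,
and Kato–Rellich alone does not suffice.

A priori bound on `Ω`. The term `-(i/2) φ(i m · G)` is exactly the commutator needed to complete the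
square: `H = ½ ∑ v_l² + Ω +` terms linear in the field, where `v_l = ξ_l - dΓ(m_l) - φ(G_l)`
(`IsCpt.hKin_eq`). Since `[v_l, Ω]` is the ladder operator `a†(ωG_l) - a(ωG_l)`, pairing `½ ∑ v_l²
ψ` with `(1 + Ω)ψ` gives a nonnegative quantity up to small errors. Hence `‖(1 + Ω)ψ‖` is bounded by
the graph norm of `H + (b - 1)Ω`, uniformly in `b ≥ 1` (`FormFactors.norm_dGammaFiber_le`). These
algebraic identities are proved on vectors of bounded particle number and bounded symbols, and the
resulting inequalities pass to the whole domain by cut-offs.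

Consequences. As `M_a = M_1 + (a - 1)Ω`, the two bounds make the graph norms of `H` and `M_1`
equivalent, which gives closedness and the transfer of cores. If `q_x = 0` then `H` is symmetric.
Kato–Rellich makes `M_a + W ± iκ` surjective for large `κ`, and lowering the coefficient of `Ω` from
`a` to `1` preserves surjectivity by the method of continuity, whose estimate is the uniform a
priori bound.

Exponential vectors. Because `M + 1 ≥ 1`, graph density of `𝒞[𝔡_C]` follows once `φ ⊥ (M + 1)ζ(h)`
for all `h ∈ 𝔡_C` forces `φ = 0`. Replacing `h` by `th` and comparing powers of `t` isolates the
pairings with `h^{⊗n}`; polarization gives products `h_1 ⊗ ⋯ ⊗ h_n`, and complex linearity extends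
them from `𝔡_C` to `𝔡`, since `C` preserves `𝔡`. Indicators of boxes then show that `φ = 0`
(`PosSymbols.eq_zero_of_pairing`). -/

noncomputable section

namespace FiberHam

/-! ### Total evaluation of partially defined operators -/

section Ev

variable {E F : Type*} [AddCommGroup E] [Module ℂ E] [AddCommGroup F] [Module ℂ F]

open Classical in
/-- Evaluation of a partially defined operator, extended by zero off its domain. -/
def ev (T : E →ₗ.[ℂ] F) (x : E) : F := if h : x ∈ T.domain then T ⟨x, h⟩ else 0

theorem ev_of_mem (T : E →ₗ.[ℂ] F) {x : E} (h : x ∈ T.domain) : ev T x = T ⟨x, h⟩ := by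
  simp [ev, h]

theorem mem_graph_ev (T : E →ₗ.[ℂ] F) {x : E} (h : x ∈ T.domain) : (x, ev T x) ∈ T.graph := by
  rw [ev_of_mem T h]
  exact T.mem_graph ⟨x, h⟩

theorem ev_eq_of_mem_graph {T : E →ₗ.[ℂ] F} {x : E} {y : F} (h : (x, y) ∈ T.graph) :
    ev T x = y :=
  T.mem_graph_snd_inj (mem_graph_ev T (T.mem_domain_of_mem_graph h)) h rfl

theorem ev_eq_of_le {S T : E →ₗ.[ℂ] F} (h : S ≤ T) {x : E} (hx : x ∈ S.domain) :
    ev T x = ev S x :=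
  ev_eq_of_mem_graph (LinearPMap.le_graph_of_le h (mem_graph_ev S hx))

theorem ev_map_add (T : E →ₗ.[ℂ] F) {x y : E} (hx : x ∈ T.domain) (hy : y ∈ T.domain) :
    ev T (x + y) = ev T x + ev T y :=
  ev_eq_of_mem_graph (T.graph.add_mem (mem_graph_ev T hx) (mem_graph_ev T hy))

theorem ev_map_sub (T : E →ₗ.[ℂ] F) {x y : E} (hx : x ∈ T.domain) (hy : y ∈ T.domain) :
    ev T (x - y) = ev T x - ev T y :=
  ev_eq_of_mem_graph (T.graph.sub_mem (mem_graph_ev T hx) (mem_graph_ev T hy))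

theorem ev_map_smul (T : E →ₗ.[ℂ] F) (c : ℂ) {x : E} (hx : x ∈ T.domain) :
    ev T (c • x) = c • ev T x :=
  ev_eq_of_mem_graph (T.graph.smul_mem c (mem_graph_ev T hx))

theorem ev_add (S T : E →ₗ.[ℂ] F) {x : E} (hS : x ∈ S.domain) (hT : x ∈ T.domain) :
    ev (S + T) x = ev S x + ev T x := by
  rw [ev_of_mem (S + T) (x := x) ⟨hS, hT⟩, ev_of_mem S hS, ev_of_mem T hT]
  rfl

theorem ev_sub (S T : E →ₗ.[ℂ] F) {x : E} (hS : x ∈ S.domain) (hT : x ∈ T.domain) :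
    ev (S - T) x = ev S x - ev T x := by
  rw [ev_of_mem (S - T) (x := x) ⟨hS, hT⟩, ev_of_mem S hS, ev_of_mem T hT]
  rfl

theorem ev_smul (c : ℂ) (T : E →ₗ.[ℂ] F) {x : E} (hT : x ∈ T.domain) :
    ev (c • T) x = c • ev T x := by
  rw [ev_of_mem (c • T) (x := x) hT, ev_of_mem T hT]
  rfl

theorem mem_domain_sum {ι : Type*} (s : Finset ι) (T : ι → E →ₗ.[ℂ] F) {x : E} :
    x ∈ (∑ i ∈ s, T i).domain ↔ ∀ i ∈ s, x ∈ (T i).domain := by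
  classical
  induction s using Finset.induction_on with
  | empty => simp
  | insert a s ha ih =>
    rw [Finset.sum_insert ha, LinearPMap.add_domain, Submodule.mem_inf, ih]
    simp

theorem ev_sum {ι : Type*} (s : Finset ι) (T : ι → E →ₗ.[ℂ] F) {x : E}
    (h : ∀ i ∈ s, x ∈ (T i).domain) : ev (∑ i ∈ s, T i) x = ∑ i ∈ s, ev (T i) x := by
  classical
  induction s using Finset.induction_on with
  | empty =>
    rw [Finset.sum_empty, Finset.sum_empty, ev_of_mem _ (x := x) (by simp)]
    rfl
  | insert a s ha ih =>
    rw [Finset.sum_insert ha, Finset.sum_insert ha,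
      ev_add _ _ (h a (Finset.mem_insert_self a s))
        ((mem_domain_sum s T).2 fun i hi => h i (Finset.mem_insert_of_mem hi)),
      ih fun i hi => h i (Finset.mem_insert_of_mem hi)]

theorem ev_domRestrict (T : E →ₗ.[ℂ] F) {D : Submodule ℂ E} {x : E} (hD : x ∈ D)
    (hT : x ∈ T.domain) : ev (T.domRestrict D) x = ev T x :=
  (ev_eq_of_le LinearPMap.domRestrict_le (S := T.domRestrict D) (x := x) ⟨hD, hT⟩).symm

theorem mem_domain_opComp {g f : E →ₗ.[ℂ] E} {x : E} :
    x ∈ (opComp g f).domain ↔ x ∈ f.domain ∧ ev f x ∈ g.domain := by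
  constructor
  · rintro ⟨⟨y, hy, hyx⟩, hx⟩
    refine ⟨hx, ?_⟩
    have : y = ⟨x, hx⟩ := Subtype.ext hyx
    subst this
    rw [ev_of_mem f hx]
    exact hy
  · rintro ⟨hx, hg⟩
    rw [ev_of_mem f hx] at hg
    exact ⟨⟨⟨x, hx⟩, hg, rfl⟩, hx⟩

theorem ev_opComp {g f : E →ₗ.[ℂ] E} {x : E} (hx : x ∈ f.domain) (hg : ev f x ∈ g.domain) :
    ev (opComp g f) x = ev g (ev f x) := by
  have h := mem_domain_opComp.2 ⟨hx, hg⟩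
  rw [ev_of_mem _ h, ev_of_mem g hg]
  have h' : x ∈ (f.domRestrict ((g.domain.comap f.toFun).map f.domain.subtype)).domain := h
  change g ⟨(f.domRestrict ((g.domain.comap f.toFun).map f.domain.subtype)) ⟨x, h'⟩, _⟩ = _
  congr 1
  apply Subtype.ext
  exact (LinearPMap.domRestrict_apply (x := ⟨x, h'⟩) (y := ⟨x, hx⟩) rfl).trans
    (ev_of_mem f hx).symm

theorem mem_domain_opDot {n : ℕ} {A B : Fin n → E →ₗ.[ℂ] E} {x : E} :
    x ∈ (opDot A B).domain ↔ ∀ l, x ∈ (B l).domain ∧ ev (B l) x ∈ (A l).domain := by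
  simp only [opDot, mem_domain_sum, mem_domain_opComp, Finset.mem_univ, true_imp_iff]

theorem ev_opDot {n : ℕ} {A B : Fin n → E →ₗ.[ℂ] E} {x : E}
    (h : ∀ l, x ∈ (B l).domain ∧ ev (B l) x ∈ (A l).domain) :
    ev (opDot A B) x = ∑ l, ev (A l) (ev (B l) x) := by
  rw [opDot, ev_sum _ _ fun i _ => mem_domain_opComp.2 (h i)]
  exact Finset.sum_congr rfl fun l _ => ev_opComp (h l).1 (h l).2

theorem mem_domain_opScalar (c : ℂ) (x : E) : x ∈ (opScalar c : E →ₗ.[ℂ] E).domain :=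
  Submodule.mem_top

theorem ev_opScalar (c : ℂ) (x : E) : ev (opScalar c : E →ₗ.[ℂ] E) x = c • x := by
  rw [ev_of_mem _ (mem_domain_opScalar c x)]
  rfl

end Ev

/-! ### Closedness, cores and self-adjointness -/

section Abstract

variable {E : Type*} [NormedAddCommGroup E] [InnerProductSpace ℂ E]

open Filter Topology

/-- Along a sequence converging in the graph of `B`, the second bound makes the images under `A`
Cauchy. The limit lies in the graph of `A`, and the first bound carries the convergence back to `B`.
-/
theorem isClosed_of_graphNorm_equiv [CompleteSpace E] {A B : E →ₗ.[ℂ] E} (hd : A.domain = B.domain)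
    (hA : A.IsClosed) {c : ℝ} (h1 : ∀ x ∈ A.domain, ‖ev B x‖ ≤ c * (‖ev A x‖ + ‖x‖))
    (h2 : ∀ x ∈ A.domain, ‖ev A x‖ ≤ c * (‖ev B x‖ + ‖x‖)) : B.IsClosed := by
  refine IsSeqClosed.isClosed fun s p hs hp => ?_
  have hB : ∀ n, (s n).1 ∈ B.domain := fun n => B.mem_domain_of_mem_graph (hs n)
  have hA' : ∀ n, (s n).1 ∈ A.domain := fun n => hd ▸ hB n
  have hsB : ∀ n, ev B (s n).1 = (s n).2 := fun n => ev_eq_of_mem_graph (hs n)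
  have hp1 : Tendsto (fun n => (s n).1) atTop (𝓝 p.1) := (continuous_fst.tendsto p).comp hp
  have hp2 : Tendsto (fun n => (s n).2) atTop (𝓝 p.2) := (continuous_snd.tendsto p).comp hp
  have hdist : ∀ x ∈ A.domain, ∀ y ∈ A.domain,
      dist (ev A x) (ev A y) ≤ c * (dist (ev B x) (ev B y) + dist x y) := by
    intro x hx y hy
    rw [dist_eq_norm, dist_eq_norm, dist_eq_norm, ← ev_map_sub A hx hy,
      ← ev_map_sub B (hd ▸ hx) (hd ▸ hy)]
    exact h2 _ (A.domain.sub_mem hx hy)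
  have hdist' : ∀ x ∈ A.domain, ∀ y ∈ A.domain,
      dist (ev B x) (ev B y) ≤ c * (dist (ev A x) (ev A y) + dist x y) := by
    intro x hx y hy
    rw [dist_eq_norm, dist_eq_norm, dist_eq_norm, ← ev_map_sub A hx hy,
      ← ev_map_sub B (hd ▸ hx) (hd ▸ hy)]
    exact h1 _ (A.domain.sub_mem hx hy)
  have hc : CauchySeq fun n => ev A (s n).1 := by
    have c1 : Tendsto (fun q : ℕ × ℕ => dist (s q.1).1 (s q.2).1) atTop (𝓝 0) :=
      cauchySeq_iff_tendsto_dist_atTop_0.1 hp1.cauchySeq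
    have c2 : Tendsto (fun q : ℕ × ℕ => dist (s q.1).2 (s q.2).2) atTop (𝓝 0) :=
      cauchySeq_iff_tendsto_dist_atTop_0.1 hp2.cauchySeq
    rw [cauchySeq_iff_tendsto_dist_atTop_0]
    have c3 := (c2.add c1).const_mul c
    rw [add_zero, mul_zero] at c3
    refine squeeze_zero (fun _ => dist_nonneg) (fun q => ?_) c3
    rw [← hsB, ← hsB]
    exact hdist _ (hA' _) _ (hA' _)
  obtain ⟨z, hz⟩ := cauchySeq_tendsto_of_complete hc
  have hgA : (p.1, z) ∈ A.graph := by
    have : Tendsto (fun n => ((s n).1, ev A (s n).1)) atTop (𝓝 (p.1, z)) := hp1.prodMk_nhds hz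
    exact IsClosed.mem_of_tendsto hA this (Eventually.of_forall fun n => mem_graph_ev A (hA' n))
  have hpA : p.1 ∈ A.domain := A.mem_domain_of_mem_graph hgA
  have hzA : ev A p.1 = z := ev_eq_of_mem_graph hgA
  have hpB : p.1 ∈ B.domain := hd ▸ hpA
  have hlim : Tendsto (fun n => (s n).2) atTop (𝓝 (ev B p.1)) := by
    rw [tendsto_iff_dist_tendsto_zero]
    have c1 := tendsto_iff_dist_tendsto_zero.1 hz
    have c2 := tendsto_iff_dist_tendsto_zero.1 hp1
    have c3 := (c1.add c2).const_mul c
    rw [add_zero, mul_zero] at c3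
    refine squeeze_zero (fun _ => dist_nonneg) (fun n => ?_) c3
    rw [← hsB, ← hzA]
    exact hdist' _ (hA' _) _ hpA
  have : p = (p.1, ev B p.1) := Prod.ext rfl (tendsto_nhds_unique hp2 hlim)
  rw [this]
  exact mem_graph_ev B hpB

/-- Since `A` is closed, the closure of the restricted graph stays inside the graph of `A`; the core
property is therefore density in the graph norm, the form in which it is both transferred and
verified. -/
theorem hasCore_iff {A : E →ₗ.[ℂ] E} (hA : A.IsClosed) {S : Submodule ℂ E} (hS : S ≤ A.domain) :
    A.HasCore S ↔
      ∀ x ∈ A.domain, ∀ ε > 0, ∃ y ∈ S, ‖x - y‖ < ε ∧ ‖ev A (x - y)‖ < ε := by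
  have hcl : (A.domRestrict S).IsClosable := hA.isClosable.leIsClosable LinearPMap.domRestrict_le
  have hle : (A.domRestrict S).graph.topologicalClosure ≤ A.graph :=
    Submodule.topologicalClosure_minimal _ (LinearPMap.le_graph_of_le LinearPMap.domRestrict_le) hA
  have hgr : ∀ y ∈ S, (y, ev A y) ∈ (A.domRestrict S).graph := fun y hy => by
    have := mem_graph_ev (A.domRestrict S) (x := y) ⟨hy, hS hy⟩
    rwa [ev_domRestrict A hy (hS hy)] at this
  constructor
  · intro h x hx ε hε
    have hm : (x, ev A x) ∈ (A.domRestrict S).graph.topologicalClosure := by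
      rw [hcl.graph_closure_eq_closure_graph, h.closure_eq]
      exact mem_graph_ev A hx
    obtain ⟨p, hp, hd⟩ := Metric.mem_closure_iff.1 hm ε hε
    have hpd := (A.domRestrict S).mem_domain_of_mem_graph hp
    have hp2 : p.2 = ev A p.1 := by
      rw [← ev_domRestrict A hpd.1 hpd.2]
      exact (ev_eq_of_mem_graph hp).symm
    refine ⟨p.1, hpd.1, ?_, ?_⟩
    · rw [← dist_eq_norm]
      exact lt_of_le_of_lt (le_max_left _ _) hd
    · rw [ev_map_sub A hx hpd.2, ← hp2, ← dist_eq_norm]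
      exact lt_of_le_of_lt (le_max_right _ _) hd
  · intro h
    refine ⟨hS, LinearPMap.eq_of_eq_graph ?_⟩
    rw [← hcl.graph_closure_eq_closure_graph]
    refine le_antisymm hle fun p hp => ?_
    have hpd := A.mem_domain_of_mem_graph hp
    have hp2 : ev A p.1 = p.2 := ev_eq_of_mem_graph hp
    refine Metric.mem_closure_iff.2 fun ε hε => ?_
    obtain ⟨y, hy, h1, h2⟩ := h p.1 hpd ε hε
    refine ⟨(y, ev A y), hgr y hy, ?_⟩
    rw [Prod.dist_eq]
    refine max_lt ?_ ?_
    · rwa [dist_eq_norm]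
    · rwa [dist_eq_norm, ← hp2, ← ev_map_sub A hpd (hS hy)]

/-- A one-sided bound is enough: approximants that are good for `A` are also good for `B`. -/
theorem hasCore_of_graphNorm_le {A B : E →ₗ.[ℂ] E} (hd : A.domain = B.domain)
    (hA : A.IsClosed) (hB : B.IsClosed) {c : ℝ}
    (h1 : ∀ x ∈ A.domain, ‖ev B x‖ ≤ c * (‖ev A x‖ + ‖x‖)) {S : Submodule ℂ E}
    (h : A.HasCore S) : B.HasCore S := by
  have hS := h.le_domain
  rw [hasCore_iff hA hS] at h
  rw [hasCore_iff hB (hd ▸ hS)]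
  intro x hx ε hε
  have hc : 0 < 2 * |c| + 1 := by positivity
  -- With `δ = ε / (2|c| + 1)` both `δ ≤ ε` and `2|c|δ < ε` hold.
  obtain ⟨y, hy, h2, h3⟩ := h x (hd ▸ hx) (ε / (2 * |c| + 1)) (by positivity)
  have hε' : ε / (2 * |c| + 1) ≤ ε := div_le_self hε.le (by linarith [abs_nonneg c])
  refine ⟨y, hy, h2.trans_le hε', ?_⟩
  refine (h1 _ (A.domain.sub_mem (hd ▸ hx) (hS hy))).trans_lt ?_
  have hle : c * (‖ev A (x - y)‖ + ‖x - y‖) ≤ |c| * (2 * (ε / (2 * |c| + 1))) := by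
    refine mul_le_mul (le_abs_self c) (by linarith) (by positivity) (abs_nonneg c)
  refine hle.trans_lt ?_
  rw [← mul_div_assoc, ← mul_div_assoc, div_lt_iff₀ hc]
  nlinarith [abs_nonneg c]

/-- Surjectivity is stable under small relative perturbations. -/
theorem surjective_add_of_small [CompleteSpace E] {D : Submodule ℂ E} (T B : D →ₗ[ℂ] E)
    (hT : Function.Surjective T) {θ : ℝ} (hθ : θ < 1) (hB : ∀ x, ‖B x‖ ≤ θ * ‖T x‖)
    (hinj : ∀ x, T x = 0 → x = 0) : Function.Surjective (T + B) := by
  let e : D ≃ₗ[ℂ] E := LinearEquiv.ofBijective T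
    ⟨(injective_iff_map_eq_zero T).2 hinj, hT⟩
  have he : ∀ y, T (e.symm y) = y := fun y => e.apply_symm_apply y
  -- `K = B T⁻¹` has norm at most `θ < 1`, and `T + B = (1 + K) T`; the inverse of `1 + K` comes
  -- from the Neumann series.
  let K : E →L[ℂ] E := LinearMap.mkContinuous (B ∘ₗ e.symm.toLinearMap) θ fun y => by
    refine (hB (e.symm y)).trans_eq ?_
    rw [he]
  have hK : ∀ y, K y = B (e.symm y) := fun y => rfl
  rcases subsingleton_or_nontrivial E with hs | hn
  · exact fun y => ⟨0, Subsingleton.elim _ _⟩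
  have hθ0 : 0 ≤ θ := by
    obtain ⟨y, hy⟩ := exists_ne (0 : E)
    have := (norm_nonneg _).trans (hB (e.symm y))
    rw [he] at this
    exact nonneg_of_mul_nonneg_left this (norm_pos_iff.2 hy)
  have hn : ‖-K‖ < 1 := by
    rw [norm_neg]
    exact (LinearMap.mkContinuous_norm_le _ hθ0 _).trans_lt hθ
  intro y
  obtain ⟨u, hu⟩ := isUnit_one_sub_of_norm_lt_one hn
  refine ⟨e.symm ((↑u⁻¹ : E →L[ℂ] E) y), ?_⟩
  have h1 : ((1 - -K) * (↑u⁻¹ : E →L[ℂ] E)) y = y := by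
    rw [← hu, Units.mul_inv]
    rfl
  rw [LinearMap.add_apply, he, ← hK]
  simpa using h1

/-- The method of continuity along an affine path of operators. -/
theorem surjective_add_of_path [CompleteSpace E] {D : Submodule ℂ E} (T B : D →ₗ[ℂ] E)
    (hT : Function.Surjective T) {C : ℝ}
    (hB : ∀ s : ℝ, 0 ≤ s → s ≤ 1 → ∀ x, ‖B x‖ ≤ C * ‖T x + (s : ℂ) • B x‖)
    (hinj : ∀ s : ℝ, 0 ≤ s → s ≤ 1 → ∀ x, T x + (s : ℂ) • B x = 0 → x = 0) :
    Function.Surjective (T + B) := by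
  -- With `N > 2|C|` the increment `B / N` is bounded by half of the operator reached so far, so
  -- each of the `N` steps is a small perturbation.
  obtain ⟨N, hN⟩ := exists_nat_gt (2 * |C|)
  have hN0 : (0 : ℝ) < N := lt_of_le_of_lt (by positivity) hN
  have key : ∀ j : ℕ, j ≤ N → Function.Surjective (T + (((j : ℝ) / N : ℝ) : ℂ) • B) := by
    intro j
    induction j with
    | zero => intro _; simpa using hT
    | succ j ih =>
      intro hj
      have hj' : (j : ℝ) ≤ N := by exact_mod_cast (Nat.le_succ j).trans hj
      have h0 : 0 ≤ (j : ℝ) / N := by positivity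
      have h1 : (j : ℝ) / N ≤ 1 := (div_le_one hN0).2 hj'
      have hs : T + ((((j + 1 : ℕ) : ℝ) / N : ℝ) : ℂ) • B =
          (T + (((j : ℝ) / N : ℝ) : ℂ) • B) + (((1 : ℝ) / N : ℝ) : ℂ) • B := by
        rw [add_assoc, ← add_smul, ← ofReal_add]
        congr 4
        push_cast
        ring
      rw [hs]
      refine surjective_add_of_small _ _ (ih ((Nat.le_succ j).trans hj)) (θ := 1 / 2) (by norm_num)
        (fun x => ?_) (fun x hx => hinj _ h0 h1 x hx)
      rw [LinearMap.smul_apply, norm_smul, norm_real, Real.norm_of_nonneg (by positivity)]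
      have h2 := hB _ h0 h1 x
      have h3 : ‖B x‖ ≤ |C| * ‖T x + (((j : ℝ) / N : ℝ) : ℂ) • B x‖ :=
        h2.trans (mul_le_mul_of_nonneg_right (le_abs_self C) (norm_nonneg _))
      rw [LinearMap.add_apply, LinearMap.smul_apply, one_div_mul_eq_div, div_le_iff₀ hN0]
      nlinarith [norm_nonneg (T x + (((j : ℝ) / N : ℝ) : ℂ) • B x)]
  have := key N le_rfl
  rw [div_self hN0.ne'] at this
  simpa using this

/-- A symmetric operator `A` with `ran (A ± iκ)` the whole space is self-adjoint. -/
theorem isSelfAdjoint_of_surjective [CompleteSpace E] {A : E →ₗ.[ℂ] E}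
    (hd : Dense (A.domain : Set E))
    (hsymm : ∀ x ∈ A.domain, ∀ y ∈ A.domain, inner ℂ (ev A x) y = inner ℂ x (ev A y))
    {κ : ℝ} (hp : ∀ y, ∃ x ∈ A.domain, ev A x + (κ * I : ℂ) • x = y)
    (hm : ∀ y, ∃ x ∈ A.domain, ev A x - (κ * I : ℂ) • x = y) : IsSelfAdjoint A := by
  rw [LinearPMap.isSelfAdjoint_def]
  have hfa : A.IsFormalAdjoint A := fun x y => by
    have := hsymm x x.2 y y.2
    rwa [ev_of_mem A x.2, ev_of_mem A y.2] at this
  have hle : A ≤ A.adjoint := hfa.le_adjoint hd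
  refine (LinearPMap.eq_of_le_of_domain_eq hle (le_antisymm hle.1 fun y hy => ?_)).symm
  -- The choice `(A - iκ)x = (A* - iκ)y` makes `y - x` orthogonal to the range of `A + iκ`, which is
  -- everything; hence `y = x`.
  obtain ⟨x, hx, hxy⟩ := hm (A.adjoint ⟨y, hy⟩ - (κ * I : ℂ) • y)
  have horth : ∀ z ∈ A.domain, inner ℂ (y - x) (ev A z + (κ * I : ℂ) • z) = 0 := by
    intro z hz
    have h1 : inner ℂ (A.adjoint ⟨y, hy⟩) z = inner ℂ y (ev A z) := by
      rw [ev_of_mem A hz]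
      exact A.adjoint_isFormalAdjoint hd ⟨y, hy⟩ ⟨z, hz⟩
    have h2 := hsymm x hx z hz
    have h3 := congrArg (fun v => inner ℂ v z) hxy
    simp only [inner_sub_left, inner_smul_left, h1, h2] at h3
    simp only [inner_sub_left, inner_add_right, inner_smul_right]
    have h4 : (starRingEnd ℂ) (κ * I : ℂ) = -(κ * I : ℂ) := by simp
    rw [h4] at h3
    linear_combination -h3
  obtain ⟨z, hz, hzy⟩ := hp (y - x)
  have h0 := horth z hz
  rw [hzy, inner_self_eq_zero, sub_eq_zero] at h0
  rw [h0]
  exact hx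

end Abstract

end FiberHam

end
noncomputable section

namespace FiberHam

/-! ### Wave functions and weighted norms -/

section Waves

variable {M : Type*} [MeasurableSpace M] {μ : Measure M} [SigmaFinite μ]

open scoped ENNReal

theorem enorm_sq_eq_ofReal (z : ℂ) : ‖z‖ₑ ^ 2 = ENNReal.ofReal (‖z‖ ^ 2) := by
  rw [← ofReal_norm, ENNReal.ofReal_pow (norm_nonneg _)]

theorem ofReal_norm_sq_Lp {X : Type*} [MeasurableSpace X] {ρ : Measure X} (g : Lp ℂ 2 ρ) :
    ENNReal.ofReal (‖g‖ ^ 2) = ∫⁻ x, ENNReal.ofReal (‖g x‖ ^ 2) ∂ρ := by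
  have h1 : ‖g‖ ^ 2 = ∫ x, ‖g x‖ ^ 2 ∂ρ := by
    rw [← inner_self_eq_norm_sq (𝕜 := ℂ) g, L2.inner_def, ← integral_re (L2.integrable_inner g g)]
    simp only [inner_self_eq_norm_sq]
  rw [h1, ofReal_integral_eq_lintegral_ofReal]
  · exact (memLp_two_iff_integrable_sq_norm (Lp.aestronglyMeasurable g)).1 (Lp.memLp g)
  · exact Filter.Eventually.of_forall fun x => sq_nonneg _

theorem memLp_two_of_lintegral {X : Type*} [MeasurableSpace X] {ρ : Measure X} {g : X → ℂ}
    (hg : AEStronglyMeasurable g ρ) (h : ∫⁻ x, ENNReal.ofReal (‖g x‖ ^ 2) ∂ρ ≠ ⊤) :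
    MemLp g 2 ρ := by
  rw [memLp_two_iff_integrable_sq_norm hg]
  refine ⟨(hg.norm.pow 2), ?_⟩
  rw [hasFiniteIntegral_iff_ofReal (Filter.Eventually.of_forall fun x => sq_nonneg _)]
  exact lt_top_iff_ne_top.2 h

/-- The weighted square norm `∑ₙ ∫ wₙ |ψₙ|²`. -/
def wsq (w : ∀ n, (Fin n → M) → ℝ) (ψ : Fock μ) : ℝ≥0∞ :=
  ∑' n, ∫⁻ k, ENNReal.ofReal (w n k * ‖ψ.wave n k‖ ^ 2) ∂prodMeas μ n

theorem ofReal_norm_sq (ψ : Fock μ) : ENNReal.ofReal (‖ψ‖ ^ 2) = wsq (fun _ _ => 1) ψ := by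
  have h2 : (2 : ℝ≥0∞).toReal = ((2 : ℕ) : ℝ) := by norm_num
  have h := lp.hasSum_norm (p := 2) (by norm_num) ψ
  simp only [h2, Real.rpow_natCast] at h
  rw [← h.tsum_eq, ENNReal.ofReal_tsum_of_nonneg (fun n => sq_nonneg _) h.summable]
  refine tsum_congr fun n => ?_
  simp only [one_mul]
  exact ofReal_norm_sq_Lp ((ψ n : SymL2 μ n) : Lp ℂ 2 (prodMeas μ n))

theorem wave_ext {ψ η : Fock μ} (h : ∀ n, ψ.wave n =ᵐ[prodMeas μ n] η.wave n) : ψ = η := by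
  apply lp.ext
  funext n
  exact Subtype.ext (Lp.ext (h n))

theorem wave_symm (ψ : Fock μ) (n : ℕ) (π : Equiv.Perm (Fin n)) :
    ∀ᵐ k ∂(prodMeas μ n), ψ.wave n k = ψ.wave n (fun i => k (π i)) :=
  (mem_symL2_iff μ n _).1 (ψ n).2 π

theorem wave_aesm (ψ : Fock μ) (n : ℕ) : AEStronglyMeasurable (ψ.wave n) (prodMeas μ n) :=
  (memLp_wave ψ n).1

theorem wave_sub (ψ η : Fock μ) (n : ℕ) :
    Fock.wave (ψ - η) n =ᵐ[prodMeas μ n] fun k => ψ.wave n k - η.wave n k :=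
  Lp.coeFn_sub _ _

/-- Symmetric, jointly square-summable families of functions define Fock space vectors. -/
theorem exists_fock {g : ∀ n, (Fin n → M) → ℂ}
    (hg : ∀ n, AEStronglyMeasurable (g n) (prodMeas μ n))
    (hsymm : ∀ n (π : Equiv.Perm (Fin n)), ∀ᵐ k ∂(prodMeas μ n), g n k = g n (fun i => k (π i)))
    (hfin : ∑' n, ∫⁻ k, ENNReal.ofReal (‖g n k‖ ^ 2) ∂prodMeas μ n ≠ ⊤) :
    ∃ η : Fock μ, ∀ n, η.wave n =ᵐ[prodMeas μ n] g n := by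
  have hL : ∀ n, MemLp (g n) 2 (prodMeas μ n) := fun n =>
    memLp_two_of_lintegral (hg n) (ENNReal.ne_top_of_tsum_ne_top hfin n)
  let c : ∀ n, SymL2 μ n := fun n => ⟨(hL n).toLp _, by
    rw [mem_symL2_iff]
    intro π
    have h1 := (hL n).coeFn_toLp
    have h2 := (measurePreserving_perm μ n π).quasiMeasurePreserving.ae h1
    filter_upwards [h1, h2, hsymm n π] with k h1 h2 h3
    rw [h1, h2, h3]⟩
  have hnorm : ∀ n, ENNReal.ofReal (‖c n‖ ^ 2) =
      ∫⁻ k, ENNReal.ofReal (‖g n k‖ ^ 2) ∂prodMeas μ n := by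
    intro n
    have : ‖c n‖ = ‖(hL n).toLp _‖ := rfl
    rw [this, ofReal_norm_sq_Lp]
    refine lintegral_congr_ae ?_
    filter_upwards [(hL n).coeFn_toLp] with k hk
    rw [hk]
  have hmem : Memℓp c 2 := by
    refine memℓp_gen ?_
    have h2 : (2 : ℝ≥0∞).toReal = ((2 : ℕ) : ℝ) := by norm_num
    simp only [h2, Real.rpow_natCast]
    simp_rw [← hnorm] at hfin
    have := ENNReal.summable_toReal hfin
    simpa only [ENNReal.toReal_ofReal (sq_nonneg _)] using this
  exact ⟨⟨c, hmem⟩, fun n => (hL n).coeFn_toLp⟩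

theorem wsq_mono {w w' : ∀ n, (Fin n → M) → ℝ} (ψ : Fock μ) (h : ∀ n k, w n k ≤ w' n k) :
    wsq w ψ ≤ wsq w' ψ :=
  ENNReal.tsum_le_tsum fun n => lintegral_mono fun k =>
    ENNReal.ofReal_le_ofReal (mul_le_mul_of_nonneg_right (h n k) (sq_nonneg _))

theorem wsq_const_mul (w : ∀ n, (Fin n → M) → ℝ) (ψ : Fock μ) {c : ℝ} (hc : 0 ≤ c) :
    wsq (fun n k => c * w n k) ψ = ENNReal.ofReal c * wsq w ψ := by
  rw [wsq, wsq, ← ENNReal.tsum_mul_left]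
  refine tsum_congr fun n => ?_
  rw [← lintegral_const_mul' _ _ ENNReal.ofReal_ne_top]
  refine lintegral_congr fun k => ?_
  rw [mul_assoc, ENNReal.ofReal_mul hc]

theorem wsq_add {w w' : ∀ n, (Fin n → M) → ℝ} (ψ : Fock μ) (hm : ∀ n, Measurable (w n))
    (h : ∀ n k, 0 ≤ w n k) (h' : ∀ n k, 0 ≤ w' n k) :
    wsq (fun n k => w n k + w' n k) ψ = wsq w ψ + wsq w' ψ := by
  rw [wsq, wsq, wsq, ← ENNReal.tsum_add]
  refine tsum_congr fun n => ?_
  rw [← lintegral_add_left']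
  · refine lintegral_congr fun k => ?_
    rw [add_mul, ENNReal.ofReal_add (mul_nonneg (h n k) (sq_nonneg _))
      (mul_nonneg (h' n k) (sq_nonneg _))]
  · exact ((hm n).aemeasurable.mul ((wave_aesm ψ n).norm.aemeasurable.pow_const 2)).ennreal_ofReal

/-- The weighted norms of a product of a function with a vector. -/
theorem wsq_of_wave_eq {ψ η : Fock μ} {g : ∀ n, (Fin n → M) → ℂ}
    (h : ∀ n, η.wave n =ᵐ[prodMeas μ n] fun k => g n k * ψ.wave n k)
    (w : ∀ n, (Fin n → M) → ℝ) : wsq w η = wsq (fun n k => w n k * ‖g n k‖ ^ 2) ψ := by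
  refine tsum_congr fun n => lintegral_congr_ae ?_
  filter_upwards [h n] with k hk
  rw [hk, norm_mul, mul_pow, mul_assoc]

/-- Multiplication by a symmetric function. -/
theorem exists_mul {ψ : Fock μ} {g : ∀ n, (Fin n → M) → ℂ} (hg : ∀ n, Measurable (g n))
    (hsymm : ∀ n (π : Equiv.Perm (Fin n)) k, g n k = g n (fun i => k (π i)))
    (hfin : wsq (fun n k => ‖g n k‖ ^ 2) ψ ≠ ⊤) :
    ∃ η : Fock μ, ∀ n, η.wave n =ᵐ[prodMeas μ n] fun k => g n k * ψ.wave n k := by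
  refine exists_fock (fun n => (hg n).aestronglyMeasurable.mul (wave_aesm ψ n))
    (fun n π => ?_) ?_
  · filter_upwards [wave_symm ψ n π] with k hk
    rw [← hsymm, hk]
  · simpa only [norm_mul, mul_pow, wsq] using hfin

theorem hasSum_inner_wave (φ ψ : Fock μ) :
    HasSum (fun n => ∫ k, (starRingEnd ℂ) (φ.wave n k) * ψ.wave n k ∂prodMeas μ n)
      (inner ℂ φ ψ) := by
  have h := lp.hasSum_inner (𝕜 := ℂ) φ ψ
  have e : (fun n => ∫ k, (starRingEnd ℂ) (φ.wave n k) * ψ.wave n k ∂prodMeas μ n) =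
      fun n => inner ℂ (φ n) (ψ n) := by
    funext n
    rw [Submodule.coe_inner, L2.inner_def]
    refine integral_congr_ae (Filter.Eventually.of_forall fun k => ?_)
    simp only [RCLike.inner_apply]
    rw [mul_comm]
    rfl
  rw [e]
  exact h

theorem inner_congr_wave {φ ψ φ' ψ' : Fock μ}
    (h : ∀ n, ∀ᵐ k ∂prodMeas μ n, (starRingEnd ℂ) (φ.wave n k) * ψ.wave n k =
      (starRingEnd ℂ) (φ'.wave n k) * ψ'.wave n k) : inner ℂ φ ψ = inner ℂ φ' ψ' := by
  refine (hasSum_inner_wave φ ψ).unique ?_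
  convert hasSum_inner_wave φ' ψ' using 2 with n
  exact integral_congr_ae (h n)

theorem re_inner_nonneg_of_wave {φ ψ : Fock μ} {w : ∀ n, (Fin n → M) → ℝ}
    (h : ∀ n, ψ.wave n =ᵐ[prodMeas μ n] fun k => (w n k : ℂ) * φ.wave n k)
    (hw : ∀ n k, 0 ≤ w n k) : 0 ≤ (inner ℂ φ ψ).re := by
  have hs := (hasSum_inner_wave φ ψ).mapL reCLM
  refine hs.nonneg fun n => ?_
  have : ∫ k, (starRingEnd ℂ) (φ.wave n k) * ψ.wave n k ∂prodMeas μ n =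
      ((∫ k, w n k * ‖φ.wave n k‖ ^ 2 ∂prodMeas μ n : ℝ) : ℂ) := by
    refine Eq.trans (integral_congr_ae ?_) integral_complex_ofReal
    filter_upwards [h n] with k hk
    rw [hk, mul_left_comm, conj_mul']
    push_cast
    ring
  rw [this]
  simp only [reCLM_apply, ofReal_re]
  exact integral_nonneg fun k => mul_nonneg (hw n k) (sq_nonneg _)

/-! ### Graphs of the basic operators -/

/-- `Submodule.toLinearPMap` has the prescribed relation as its graph when that relation is
single-valued: the point to check is that `(0, b)` in the relation forces `b = 0`. The same applies
to the two ladder operators below. -/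
theorem mem_graph_dGamma {κ : M → ℝ} {ψ η : Fock μ} :
    (ψ, η) ∈ (dGamma μ κ).graph ↔
      ∀ n, η.wave n =ᵐ[prodMeas μ n] fun k => ((∑ i, κ (k i) : ℝ) : ℂ) * ψ.wave n k := by
  rw [dGamma, Submodule.toLinearPMap_graph_eq]
  · rfl
  · rintro ⟨a, b⟩ h (rfl : a = 0)
    refine wave_ext fun n => ?_
    filter_upwards [h n, wave_zero (μ := μ) n] with k h1 h2
    simp only [h1, h2, mul_zero]

theorem mem_graph_creation {f : OneBoson μ} {ψ η : Fock μ} :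
    (ψ, η) ∈ (creation f).graph ↔ η.wave 0 =ᵐ[prodMeas μ 0] 0 ∧ ∀ n,
      η.wave (n + 1) =ᵐ[prodMeas μ (n + 1)] fun k =>
        ((Real.sqrt (n + 1))⁻¹ : ℂ) * ∑ l, f (k l) * ψ.wave n (l.removeNth k) := by
  rw [creation, Submodule.toLinearPMap_graph_eq]
  · rfl
  · rintro ⟨a, b⟩ h (rfl : a = 0)
    refine wave_ext fun n => ?_
    cases n with
    | zero => exact h.1.trans (wave_zero (μ := μ) 0).symm
    | succ n =>
      have h3 : ∀ᵐ k ∂(prodMeas μ (n + 1)), ∀ l : Fin (n + 1),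
          Fock.wave (0 : Fock μ) n (l.removeNth k) = 0 :=
        ae_all_iff.2 fun l => (quasi_removeNth n l).ae (wave_zero n)
      filter_upwards [h.2 n, wave_zero (μ := μ) (n + 1), h3] with k h1 h2 h3
      simp only [h1, h2, h3, mul_zero, Finset.sum_const_zero]

theorem mem_graph_annihilation {f : OneBoson μ} {ψ η : Fock μ} :
    (ψ, η) ∈ (annihilation f).graph ↔ ∀ n, η.wave n =ᵐ[prodMeas μ n] fun k =>
      (Real.sqrt (n + 1) : ℂ) *
        ∫ k', (starRingEnd ℂ) (f k') * ψ.wave (n + 1) (Fin.snoc k k') ∂μ := by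
  rw [annihilation, Submodule.toLinearPMap_graph_eq]
  · rfl
  · rintro ⟨a, b⟩ h (rfl : a = 0)
    refine wave_ext fun n => ?_
    filter_upwards [h n, wave_zero (μ := μ) n, ae_snoc (wave_zero (μ := μ) (n + 1))] with k h1 h2 h3
    have : ∫ k', (starRingEnd ℂ) (f k') * Fock.wave (0 : Fock μ) (n + 1) (Fin.snoc k k') ∂μ
        = ∫ _, (0 : ℂ) ∂μ := integral_congr_ae (by
      filter_upwards [h3] with k' h
      simp [h])
    simp only [h1, h2, this]
    simp

end Waves

/-! ### Integration over configuration space -/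

section Config

variable {M : Type*} [MeasurableSpace M] {μ : Measure M} [SigmaFinite μ]

open scoped ENNReal

theorem measurableEmbedding_perm (n : ℕ) (π : Equiv.Perm (Fin n)) :
    MeasurableEmbedding (fun k : Fin n → M => fun i => k (π i)) :=
  (MeasurableEquiv.piCongrLeft (fun _ : Fin n => M) π).symm.measurableEmbedding

theorem lintegral_perm (n : ℕ) (π : Equiv.Perm (Fin n)) (F : (Fin n → M) → ℝ≥0∞) :
    ∫⁻ k, F (fun i => k (π i)) ∂prodMeas μ n = ∫⁻ k, F k ∂prodMeas μ n :=
  (measurePreserving_perm μ n π).lintegral_comp_emb (measurableEmbedding_perm n π) F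

theorem integral_perm (n : ℕ) (π : Equiv.Perm (Fin n)) (F : (Fin n → M) → ℂ) :
    ∫ k, F (fun i => k (π i)) ∂prodMeas μ n = ∫ k, F k ∂prodMeas μ n :=
  (measurePreserving_perm μ n π).integral_comp (measurableEmbedding_perm n π) F

theorem lintegral_removeNth (n : ℕ) (l : Fin (n + 1)) {g : M → ℝ≥0∞} {F : (Fin n → M) → ℝ≥0∞}
    (hg : AEMeasurable g μ) (hF : AEMeasurable F (prodMeas μ n)) :
    ∫⁻ k, g (k l) * F (l.removeNth k) ∂prodMeas μ (n + 1) =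
      (∫⁻ x, g x ∂μ) * ∫⁻ k, F k ∂prodMeas μ n := by
  have h := measurePreserving_piFinSuccAbove (fun _ : Fin (n + 1) => μ) l
  have h2 := h.lintegral_comp_emb (MeasurableEquiv.measurableEmbedding _)
    (fun p : M × (Fin n → M) => g p.1 * F p.2)
  rw [lintegral_prod_mul hg hF] at h2
  exact h2

theorem lintegral_snoc (n : ℕ) {F : (Fin (n + 1) → M) → ℝ≥0∞}
    (hF : AEMeasurable F (prodMeas μ (n + 1))) :
    ∫⁻ k, ∫⁻ x, F (Fin.snoc k x) ∂μ ∂prodMeas μ n = ∫⁻ k, F k ∂prodMeas μ (n + 1) := by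
  have h := measurePreserving_snoc (μ := μ) n
  rw [← h.map_eq] at hF ⊢
  rw [lintegral_map' hF h.aemeasurable]
  exact (lintegral_prod_symm _ (hF.comp_aemeasurable h.aemeasurable)).symm

/-- The transposition of `i` and `j` preserves the measure and `F`. This is how a factor `n + 1`
times `ω` of one coordinate becomes the full symbol of `dΓ(ω)`. -/
theorem lintegral_coord_eq (n : ℕ) (κ : M → ℝ≥0∞) {F : (Fin n → M) → ℝ≥0∞}
    (hF : ∀ π : Equiv.Perm (Fin n), ∀ᵐ k ∂prodMeas μ n, F k = F (fun i => k (π i)))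
    (i j : Fin n) :
    ∫⁻ k, κ (k i) * F k ∂prodMeas μ n = ∫⁻ k, κ (k j) * F k ∂prodMeas μ n := by
  rw [← lintegral_perm n (Equiv.swap i j) fun k => κ (k j) * F k]
  refine lintegral_congr_ae ?_
  filter_upwards [hF (Equiv.swap i j)] with k hk
  simp only [Equiv.swap_apply_right]
  rw [← hk]

end Config

end FiberHam

end
noncomputable section

namespace FiberHam

/-! ### Bounds on creation and annihilation operators -/

section Sym

variable {M : Type*}

/-- The symbol `κ(k₁) + ⋯ + κ(kₙ)` of `dΓ(κ)`. -/
def sym (κ : M → ℝ) (n : ℕ) (k : Fin n → M) : ℝ := ∑ i, κ (k i)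

theorem sym_perm (κ : M → ℝ) (n : ℕ) (π : Equiv.Perm (Fin n)) (k : Fin n → M) :
    sym κ n (fun i => k (π i)) = sym κ n k :=
  Equiv.sum_comp π fun i => κ (k i)

theorem sym_nonneg {κ : M → ℝ} (hκ : ∀ x, 0 < κ x) (n : ℕ) (k : Fin n → M) : 0 ≤ sym κ n k :=
  Finset.sum_nonneg fun _ _ => (hκ _).le

theorem sym_removeNth (κ : M → ℝ) (n : ℕ) (l : Fin (n + 1)) (k : Fin (n + 1) → M) :
    sym κ (n + 1) k = κ (k l) + sym κ n (l.removeNth k) :=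
  Fin.sum_univ_succAbove (fun i => κ (k i)) l

theorem sym_snoc (κ : M → ℝ) (n : ℕ) (k : Fin n → M) (x : M) :
    sym κ (n + 1) (Fin.snoc k x) = sym κ n k + κ x := by
  simp [sym, Fin.sum_univ_castSucc]

theorem measurable_sym [MeasurableSpace M] {κ : M → ℝ} (hκ : Measurable κ) (n : ℕ) :
    Measurable (sym κ n) :=
  Finset.measurable_sum _ fun i _ => hκ.comp (measurable_pi_apply i)

/-- `π` restricts to a bijection between the complement of `l` and that of `π l`; both are
identified with `Fin n`. This makes the creation formula symmetric. -/
theorem removeNth_comp_perm {n : ℕ} (π : Equiv.Perm (Fin (n + 1))) (l : Fin (n + 1)) :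
    ∃ τ : Equiv.Perm (Fin n), ∀ k : Fin (n + 1) → M,
      l.removeNth (fun i => k (π i)) = fun i => (π l).removeNth k (τ i) := by
  let e : {x // x ≠ l} ≃ {x // x ≠ π l} := π.subtypeEquiv fun x => by simp
  refine ⟨((finSuccAboveEquiv l).trans e).trans (finSuccAboveEquiv (π l)).symm, fun k => ?_⟩
  funext i
  simp only [Fin.removeNth]
  congr 1
  have h : finSuccAboveEquiv (π l) ((((finSuccAboveEquiv l).trans e).trans
      (finSuccAboveEquiv (π l)).symm) i) = e (finSuccAboveEquiv l i) := by
    simp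
  exact (congrArg Subtype.val h).symm

theorem snoc_comp_perm {n : ℕ} (π : Equiv.Perm (Fin n)) :
    ∃ τ : Equiv.Perm (Fin (n + 1)), ∀ (k : Fin n → M) (x : M),
      (Fin.snoc (fun i => k (π i)) x : Fin (n + 1) → M) =
        fun i => (Fin.snoc k x : Fin (n + 1) → M) (τ i) := by
  refine ⟨((finSuccEquivLast (n := n)).trans (Equiv.optionCongr π)).trans finSuccEquivLast.symm,
    fun k x => ?_⟩
  funext i
  induction i using Fin.lastCases with
  | last => simp
  | cast i => simp

end Sym

section Bounds

variable {M : Type*} [MeasurableSpace M] {μ : Measure M} [SigmaFinite μ]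

open scoped ENNReal

/-- The wave functions of `a†(f)ψ`. -/
def crWave (f : M → ℂ) (ψ : ∀ n, (Fin n → M) → ℂ) : ∀ n, (Fin n → M) → ℂ
  | 0 => fun _ => 0
  | n + 1 => fun k => ((Real.sqrt (n + 1))⁻¹ : ℂ) * ∑ l, f (k l) * ψ n (l.removeNth k)

/-- The wave functions of `a(f)ψ`. -/
def anWave (μ : Measure M) (f : M → ℂ) (ψ : ∀ n, (Fin n → M) → ℂ) (n : ℕ) (k : Fin n → M) : ℂ :=
  (Real.sqrt (n + 1) : ℂ) * ∫ k', (starRingEnd ℂ) (f k') * ψ (n + 1) (Fin.snoc k k') ∂μ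

theorem mem_graph_creation_iff {f : OneBoson μ} {ψ η : Fock μ} :
    (ψ, η) ∈ (creation f).graph ↔ ∀ n, η.wave n =ᵐ[prodMeas μ n] crWave f ψ.wave n := by
  rw [mem_graph_creation]
  constructor
  · rintro ⟨h0, h⟩ n
    cases n with
    | zero => exact h0
    | succ n => exact h n
  · exact fun h => ⟨h 0, fun n => h (n + 1)⟩

theorem mem_graph_annihilation_iff {f : OneBoson μ} {ψ η : Fock μ} :
    (ψ, η) ∈ (annihilation f).graph ↔ ∀ n, η.wave n =ᵐ[prodMeas μ n] anWave μ f ψ.wave n :=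
  mem_graph_annihilation

/-- The weight `(1 + ω(k₁) + ⋯ + ω(kₙ))ᵖ`. -/
def pw (ω : M → ℝ) (p : ℕ) (n : ℕ) (k : Fin n → M) : ℝ := (1 + sym ω n k) ^ p

/-- The norm `∫ |f|² (1 + ω)^{p+1} ω⁻¹` of a form factor. -/
def kn (μ : Measure M) (ω : M → ℝ) (p : ℕ) (f : M → ℂ) : ℝ≥0∞ :=
  ∫⁻ x, ENNReal.ofReal ((1 + ω x) ^ (p + 1) / ω x * ‖f x‖ ^ 2) ∂μ

theorem measurable_pw {ω : M → ℝ} (hω : Measurable ω) (p n : ℕ) : Measurable (pw ω p n) :=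
  ((measurable_sym hω n).const_add 1).pow_const p

theorem pw_nonneg {ω : M → ℝ} (hω : ∀ x, 0 < ω x) (p n : ℕ) (k : Fin n → M) : 0 ≤ pw ω p n k :=
  pow_nonneg (by linarith [sym_nonneg hω n k]) p

/-- Cauchy–Schwarz for the sum over `l`, with factors `|f ψ| ω^{-1/2}` and `ω^{1/2}`: the second sum
is the symbol of `dΓ(ω)`. The resulting power of `1 + dΓ(ω)` is split by `1 + s + t ≤ (1 + s)(1 +
t)` between the created particle and the others. -/
theorem crWave_sq_le {ω : M → ℝ} (hω : ∀ x, 0 < ω x) (p n : ℕ) (f : M → ℂ)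
    (ψ : ∀ n, (Fin n → M) → ℂ) (k : Fin (n + 1) → M) :
    pw ω p (n + 1) k * ‖crWave f ψ (n + 1) k‖ ^ 2 ≤
      ∑ l, ((n + 1 : ℝ)⁻¹ * ((1 + ω (k l)) ^ (p + 1) / ω (k l) * ‖f (k l)‖ ^ 2)) *
        (pw ω (p + 1) n (l.removeNth k) * ‖ψ n (l.removeNth k)‖ ^ 2) := by
  have hn : (0 : ℝ) < n + 1 := by positivity
  have hΩ := sym_nonneg hω (n + 1) k
  have h1 : ‖crWave f ψ (n + 1) k‖ ^ 2 ≤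
      (n + 1 : ℝ)⁻¹ * ((∑ l, ‖f (k l)‖ ^ 2 * ‖ψ n (l.removeNth k)‖ ^ 2 / ω (k l)) *
        sym ω (n + 1) k) := by
    rw [crWave, norm_mul, mul_pow]
    have hs : ‖((Real.sqrt (n + 1))⁻¹ : ℂ)‖ ^ 2 = (n + 1 : ℝ)⁻¹ := by
      rw [norm_inv, norm_real, Real.norm_of_nonneg (Real.sqrt_nonneg _), inv_pow,
        Real.sq_sqrt hn.le]
    rw [hs]
    refine mul_le_mul_of_nonneg_left ?_ (by positivity)
    have h2 : ‖∑ l, f (k l) * ψ n (l.removeNth k)‖ ≤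
        ∑ l, ‖f (k l)‖ * ‖ψ n (l.removeNth k)‖ :=
      (norm_sum_le _ _).trans_eq (by simp only [norm_mul])
    refine (pow_le_pow_left₀ (norm_nonneg _) h2 2).trans ?_
    refine Finset.sum_sq_le_sum_mul_sum_of_sq_le_mul Finset.univ (fun l _ => ?_) (fun l _ => ?_)
      (fun l _ => ?_)
    · exact div_nonneg (by positivity) (hω _).le
    · exact (hω _).le
    · have := (hω (k l)).ne'
      exact le_of_eq (by field_simp)
  have h3 : pw ω p (n + 1) k * sym ω (n + 1) k ≤ pw ω (p + 1) (n + 1) k := by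
    rw [pw, pw, pow_succ]
    exact mul_le_mul_of_nonneg_left (by linarith) (by positivity)
  calc pw ω p (n + 1) k * ‖crWave f ψ (n + 1) k‖ ^ 2
      ≤ pw ω p (n + 1) k * ((n + 1 : ℝ)⁻¹ *
        ((∑ l, ‖f (k l)‖ ^ 2 * ‖ψ n (l.removeNth k)‖ ^ 2 / ω (k l)) * sym ω (n + 1) k)) :=
        mul_le_mul_of_nonneg_left h1 (pw_nonneg hω _ _ _)
    _ = (n + 1 : ℝ)⁻¹ * (∑ l, ‖f (k l)‖ ^ 2 * ‖ψ n (l.removeNth k)‖ ^ 2 / ω (k l)) *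
        (pw ω p (n + 1) k * sym ω (n + 1) k) := by ring
    _ ≤ (n + 1 : ℝ)⁻¹ * (∑ l, ‖f (k l)‖ ^ 2 * ‖ψ n (l.removeNth k)‖ ^ 2 / ω (k l)) *
        pw ω (p + 1) (n + 1) k := by
        refine mul_le_mul_of_nonneg_left h3 (mul_nonneg (by positivity) ?_)
        exact Finset.sum_nonneg fun l _ => div_nonneg (by positivity) (hω _).le
    _ ≤ _ := by
        rw [Finset.mul_sum, Finset.sum_mul]
        refine Finset.sum_le_sum fun l _ => ?_
        have h4 : pw ω (p + 1) (n + 1) k ≤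
            (1 + ω (k l)) ^ (p + 1) * pw ω (p + 1) n (l.removeNth k) := by
          rw [pw, pw, ← mul_pow]
          refine pow_le_pow_left₀ (by linarith) ?_ _
          rw [sym_removeNth ω n l k]
          nlinarith [hω (k l), sym_nonneg hω n (l.removeNth k)]
        have h5 : 0 ≤ (n + 1 : ℝ)⁻¹ * (‖f (k l)‖ ^ 2 * ‖ψ n (l.removeNth k)‖ ^ 2 / ω (k l)) :=
          mul_nonneg (by positivity) (div_nonneg (by positivity) (hω _).le)
        refine (mul_le_mul_of_nonneg_left h4 h5).trans_eq ?_
        ring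

theorem lintegral_crWave_le {ω : M → ℝ} (hω : ∀ x, 0 < ω x) (hm : Measurable ω) (p n : ℕ)
    {f : M → ℂ} (hf : AEStronglyMeasurable f μ) {ψ : ∀ n, (Fin n → M) → ℂ}
    (hψ : ∀ n, AEStronglyMeasurable (ψ n) (prodMeas μ n)) :
    ∫⁻ k, ENNReal.ofReal (pw ω p (n + 1) k * ‖crWave f ψ (n + 1) k‖ ^ 2) ∂prodMeas μ (n + 1) ≤
      kn μ ω p f * ∫⁻ k, ENNReal.ofReal (pw ω (p + 1) n k * ‖ψ n k‖ ^ 2) ∂prodMeas μ n := by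
  set A : M → ℝ≥0∞ := fun x =>
    ENNReal.ofReal ((n + 1 : ℝ)⁻¹ * ((1 + ω x) ^ (p + 1) / ω x * ‖f x‖ ^ 2)) with hA
  set B : (Fin n → M) → ℝ≥0∞ := fun k => ENNReal.ofReal (pw ω (p + 1) n k * ‖ψ n k‖ ^ 2) with hB
  have hAm : AEMeasurable A μ :=
    ((((hm.const_add 1).pow_const _).div hm).aemeasurable.mul
      (hf.norm.aemeasurable.pow_const 2)).const_mul _ |>.ennreal_ofReal
  have hBm : AEMeasurable B (prodMeas μ n) :=
    ((measurable_pw hm _ _).aemeasurable.mul ((hψ n).norm.aemeasurable.pow_const 2)).ennreal_ofReal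
  have hn : (0 : ℝ) < n + 1 := by positivity
  have hAint : ∫⁻ x, A x ∂μ = ENNReal.ofReal (n + 1 : ℝ)⁻¹ * kn μ ω p f := by
    rw [kn, ← lintegral_const_mul' _ _ ENNReal.ofReal_ne_top]
    refine lintegral_congr fun x => ?_
    exact ENNReal.ofReal_mul (by positivity)
  have hAB : ∀ l : Fin (n + 1), AEMeasurable (fun k : Fin (n + 1) → M => A (k l) * B (l.removeNth k))
      (prodMeas μ (n + 1)) := fun l =>
    (hAm.comp_quasiMeasurePreserving
      (Measure.quasiMeasurePreserving_eval (fun _ : Fin (n + 1) => μ) l)).mul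
      (hBm.comp_quasiMeasurePreserving (quasi_removeNth n l))
  calc _ ≤ ∫⁻ k, ∑ l : Fin (n + 1), A (k l) * B (l.removeNth k) ∂prodMeas μ (n + 1) := by
        refine lintegral_mono fun k => ?_
        refine (ENNReal.ofReal_le_ofReal (crWave_sq_le hω p n f ψ k)).trans ?_
        rw [ENNReal.ofReal_sum_of_nonneg]
        · refine Finset.sum_le_sum fun l _ => ?_
          rw [ENNReal.ofReal_mul]
          exact mul_nonneg (by positivity) (mul_nonneg (div_nonneg
            (pow_nonneg (by linarith [hω (k l)]) _) (hω _).le) (sq_nonneg _))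
        · intro l _
          refine mul_nonneg (mul_nonneg (by positivity) (mul_nonneg (div_nonneg
            (pow_nonneg (by linarith [hω (k l)]) _) (hω _).le) (sq_nonneg _)))
            (mul_nonneg (pw_nonneg hω _ _ _) (sq_nonneg _))
    _ = ∑ l : Fin (n + 1), (∫⁻ x, A x ∂μ) * ∫⁻ k, B k ∂prodMeas μ n := by
        rw [lintegral_finsetSum' _ fun l _ => hAB l]
        exact Finset.sum_congr rfl fun l _ => lintegral_removeNth n l hAm hBm
    _ = kn μ ω p f * ∫⁻ k, B k ∂prodMeas μ n := by
        rw [Finset.sum_const, Finset.card_univ, Fintype.card_fin, hAint, nsmul_eq_mul, ← mul_assoc,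
          ← mul_assoc]
        congr 1
        have : ((n + 1 : ℕ) : ℝ≥0∞) = ENNReal.ofReal (n + 1 : ℝ) := by
          rw [← Nat.cast_add_one, ENNReal.ofReal_natCast]
        rw [this, ← ENNReal.ofReal_mul hn.le, mul_inv_cancel₀ hn.ne', ENNReal.ofReal_one, one_mul]
    _ = _ := rfl

/-- Cauchy–Schwarz with the weight `ω` split as `ω^{-1/2} · ω^{1/2}`, carried out in `[0, ∞]` so
that no integrability is required. -/
theorem enorm_integral_sq_le {ω : M → ℝ} (hω : ∀ x, 0 < ω x) (hm : Measurable ω)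
    {f g : M → ℂ} (hf : AEStronglyMeasurable f μ) (hg : AEStronglyMeasurable g μ) :
    ‖∫ x, (starRingEnd ℂ) (f x) * g x ∂μ‖ₑ ^ 2 ≤
      (∫⁻ x, ENNReal.ofReal (‖f x‖ ^ 2 / ω x) ∂μ) *
        ∫⁻ x, ENNReal.ofReal (ω x * ‖g x‖ ^ 2) ∂μ := by
  set u : M → ℝ≥0∞ := fun x => ENNReal.ofReal (‖f x‖ ^ 2 / ω x) with hu
  set v : M → ℝ≥0∞ := fun x => ENNReal.ofReal (ω x * ‖g x‖ ^ 2) with hv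
  have hum : AEMeasurable u μ :=
    ((hf.norm.aemeasurable.pow_const 2).div hm.aemeasurable).ennreal_ofReal
  have hvm : AEMeasurable v μ :=
    (hm.aemeasurable.mul (hg.norm.aemeasurable.pow_const 2)).ennreal_ofReal
  have h1 : ‖∫ x, (starRingEnd ℂ) (f x) * g x ∂μ‖ₑ ≤
      (∫⁻ x, u x ∂μ) ^ (1 / 2 : ℝ) * (∫⁻ x, v x ∂μ) ^ (1 / 2 : ℝ) := by
    refine (enorm_integral_le_lintegral_enorm _).trans ?_
    refine le_trans (lintegral_mono fun x => ?_) (ENNReal.lintegral_mul_norm_pow_le hum hvm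
      (by norm_num) (by norm_num) (by norm_num))
    rw [← ENNReal.mul_rpow_of_nonneg _ _ (by norm_num : (0 : ℝ) ≤ 1 / 2), hu, hv,
      ← ENNReal.ofReal_mul (div_nonneg (sq_nonneg _) (hω x).le)]
    have : ‖f x‖ ^ 2 / ω x * (ω x * ‖g x‖ ^ 2) = (‖f x‖ * ‖g x‖) ^ 2 := by
      have := (hω x).ne'
      field_simp
    rw [this, ENNReal.ofReal_rpow_of_nonneg (sq_nonneg _) (by norm_num), ← Real.sqrt_eq_rpow,
      Real.sqrt_sq (by positivity), ← ofReal_norm, norm_mul, RCLike.norm_conj]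
  refine (pow_le_pow_left₀ zero_le h1 2).trans_eq ?_
  rw [mul_pow, ← ENNReal.rpow_natCast, ← ENNReal.rpow_natCast, ← ENNReal.rpow_mul,
    ← ENNReal.rpow_mul]
  norm_num

/-- The weighted Cauchy–Schwarz inequality leaves a factor `ω` in the integrated variable. By
symmetry, `n + 1` times that factor may be replaced by the sum of `ω` over all coordinates, which is
absorbed into one more power of `1 + dΓ(ω)`. -/
theorem lintegral_anWave_le {ω : M → ℝ} (hω : ∀ x, 0 < ω x) (hm : Measurable ω) (p n : ℕ)
    {f : M → ℂ} (hf : AEStronglyMeasurable f μ) {ψ : ∀ n, (Fin n → M) → ℂ}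
    (hψ : ∀ n, AEStronglyMeasurable (ψ n) (prodMeas μ n))
    (hs : ∀ n (π : Equiv.Perm (Fin n)), ∀ᵐ k ∂(prodMeas μ n), ψ n k = ψ n (fun i => k (π i))) :
    ∫⁻ k, ENNReal.ofReal (pw ω p n k * ‖anWave μ f ψ n k‖ ^ 2) ∂prodMeas μ n ≤
      kn μ ω p f *
        ∫⁻ k, ENNReal.ofReal (pw ω (p + 1) (n + 1) k * ‖ψ (n + 1) k‖ ^ 2) ∂prodMeas μ (n + 1) := by
  set K : ℝ≥0∞ := ∫⁻ x, ENNReal.ofReal (‖f x‖ ^ 2 / ω x) ∂μ with hK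
  have hKle : K ≤ kn μ ω p f := by
    refine lintegral_mono fun x => ENNReal.ofReal_le_ofReal ?_
    rw [div_mul_eq_mul_div]
    refine div_le_div_of_nonneg_right ?_ (hω x).le
    exact le_mul_of_one_le_left (sq_nonneg _) (one_le_pow₀ (by linarith [hω x]))
  have hn : (0 : ℝ) < n + 1 := by positivity
  set F : (Fin (n + 1) → M) → ℝ≥0∞ :=
    fun k => ENNReal.ofReal (pw ω p (n + 1) k * ‖ψ (n + 1) k‖ ^ 2) with hF
  have hFm : AEMeasurable F (prodMeas μ (n + 1)) :=
    ((measurable_pw hm _ _).aemeasurable.mul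
      ((hψ _).norm.aemeasurable.pow_const 2)).ennreal_ofReal
  have hωm : ∀ l : Fin (n + 1), AEMeasurable
      (fun k : Fin (n + 1) → M => ENNReal.ofReal (ω (k l))) (prodMeas μ (n + 1)) := fun l =>
    (hm.comp (measurable_pi_apply l)).aemeasurable.ennreal_ofReal
  have hslice : ∀ᵐ k ∂prodMeas μ n, AEStronglyMeasurable (fun x => ψ (n + 1) (Fin.snoc k x)) μ := by
    have h1 := (hψ (n + 1)).comp_measurePreserving (measurePreserving_snoc (μ := μ) n)
    exact (h1.comp_measurePreserving
      (Measure.measurePreserving_swap (μ := prodMeas μ n) (ν := μ))).prodMk_left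
  have hpt : ∀ᵐ k ∂prodMeas μ n, ENNReal.ofReal (pw ω p n k * ‖anWave μ f ψ n k‖ ^ 2) ≤
      ENNReal.ofReal (n + 1 : ℝ) * K * ∫⁻ x, (fun k' : Fin (n + 1) → M =>
        ENNReal.ofReal (ω (k' (Fin.last n))) * F k') (Fin.snoc k x) ∂μ := by
    filter_upwards [hslice] with k hk
    have h2 := enorm_integral_sq_le hω hm hf hk
    rw [anWave, norm_mul, mul_pow, norm_real, Real.norm_of_nonneg (Real.sqrt_nonneg _),
      Real.sq_sqrt hn.le, mul_left_comm, ENNReal.ofReal_mul hn.le, mul_assoc,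
      ENNReal.ofReal_mul (pw_nonneg hω _ _ _), ← enorm_sq_eq_ofReal]
    refine mul_le_mul_right ((mul_le_mul_right h2 _).trans ?_) _
    rw [mul_left_comm]
    refine mul_le_mul_right ?_ _
    rw [← lintegral_const_mul' _ _ ENNReal.ofReal_ne_top]
    refine lintegral_mono fun x => ?_
    simp only [Fin.snoc_last, hF]
    rw [← ENNReal.ofReal_mul (pw_nonneg hω _ _ _), ← ENNReal.ofReal_mul (hω x).le]
    refine ENNReal.ofReal_le_ofReal ?_
    rw [mul_left_comm]
    refine mul_le_mul_of_nonneg_left (mul_le_mul_of_nonneg_right ?_ (sq_nonneg _)) (hω x).le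
    rw [pw, pw, sym_snoc]
    exact pow_le_pow_left₀ (by linarith [sym_nonneg hω n k]) (by linarith [hω x]) p
  have hFs : ∀ π : Equiv.Perm (Fin (n + 1)), ∀ᵐ k ∂prodMeas μ (n + 1),
      F k = F (fun i => k (π i)) := fun π => by
    filter_upwards [hs (n + 1) π] with k hk
    simp only [hF, pw]
    rw [sym_perm, ← hk]
  calc _ ≤ ENNReal.ofReal (n + 1 : ℝ) * K * ∫⁻ k,
        ENNReal.ofReal (ω (k (Fin.last n))) * F k ∂prodMeas μ (n + 1) := by
        refine (lintegral_mono_ae hpt).trans_eq ?_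
        have hm2 : AEMeasurable (fun k : Fin (n + 1) → M =>
          ENNReal.ofReal (ω (k (Fin.last n))) * F k) (prodMeas μ (n + 1)) := (hωm _).mul hFm
        rw [lintegral_const_mul'', lintegral_snoc n hm2]
        have h1 := hm2.comp_quasiMeasurePreserving
          (measurePreserving_snoc (μ := μ) n).quasiMeasurePreserving
        exact (h1.comp_quasiMeasurePreserving (Measure.measurePreserving_swap
          (μ := prodMeas μ n) (ν := μ)).quasiMeasurePreserving).lintegral_prod_right'
    _ = K * ∑ l : Fin (n + 1), ∫⁻ k, ENNReal.ofReal (ω (k l)) * F k ∂prodMeas μ (n + 1) := by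
        rw [Finset.sum_congr rfl fun l _ => lintegral_coord_eq (n + 1)
          (fun x => ENNReal.ofReal (ω x)) hFs l (Fin.last n), Finset.sum_const, Finset.card_univ,
          Fintype.card_fin, nsmul_eq_mul]
        have : ((n + 1 : ℕ) : ℝ≥0∞) = ENNReal.ofReal (n + 1 : ℝ) := by
          rw [← Nat.cast_add_one, ENNReal.ofReal_natCast]
        rw [this, mul_assoc, mul_left_comm]
    _ ≤ _ := by
        have hsum := lintegral_finsetSum' (μ := prodMeas μ (n + 1)) Finset.univ
          (f := fun (l : Fin (n + 1)) k => ENNReal.ofReal (ω (k l)) * F k)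
          fun l _ => (hωm l).mul hFm
        rw [← hsum]
        refine mul_le_mul' hKle (lintegral_mono fun k => ?_)
        rw [← Finset.sum_mul, ← ENNReal.ofReal_sum_of_nonneg fun l _ => (hω _).le]
        change ENNReal.ofReal (sym ω (n + 1) k) * ENNReal.ofReal _ ≤ _
        rw [← ENNReal.ofReal_mul (sym_nonneg hω (n + 1) k)]
        refine ENNReal.ofReal_le_ofReal ?_
        rw [← mul_assoc]
        refine mul_le_mul_of_nonneg_right ?_ (sq_nonneg _)
        have h0 := sym_nonneg hω (n + 1) k
        rw [pw, pw, pow_succ, mul_comm]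
        exact mul_le_mul_of_nonneg_left (by linarith) (by positivity)

end Bounds

end FiberHam

end
noncomputable section

namespace FiberHam

/-! ### Domains, adjointness and commutation relations -/

section FockOps

variable {M : Type*} [MeasurableSpace M] {μ : Measure M} [SigmaFinite μ]

open scoped ENNReal

theorem wsq_vec_add_le {w : ∀ n, (Fin n → M) → ℝ} (hm : ∀ n, Measurable (w n))
    (hw : ∀ n k, 0 ≤ w n k) (ψ η : Fock μ) : wsq w (ψ + η) ≤ 2 * (wsq w ψ + wsq w η) := by
  rw [wsq, wsq, wsq, ← ENNReal.tsum_add, ← ENNReal.tsum_mul_left]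
  refine ENNReal.tsum_le_tsum fun n => ?_
  have hm1 : ∀ χ : Fock μ, AEMeasurable (fun k => ENNReal.ofReal (w n k * ‖χ.wave n k‖ ^ 2))
      (prodMeas μ n) := fun χ =>
    ((hm n).aemeasurable.mul ((wave_aesm χ n).norm.aemeasurable.pow_const 2)).ennreal_ofReal
  rw [← lintegral_add_left' (hm1 ψ), ← lintegral_const_mul' _ _ (by norm_num)]
  refine lintegral_mono_ae ?_
  filter_upwards [wave_add ψ η n] with k hk
  rw [hk]
  have h2 : (2 : ℝ≥0∞) = ENNReal.ofReal 2 := by norm_num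
  rw [← ENNReal.ofReal_add (mul_nonneg (hw n k) (sq_nonneg _)) (mul_nonneg (hw n k) (sq_nonneg _)),
    h2, ← ENNReal.ofReal_mul (by norm_num)]
  refine ENNReal.ofReal_le_ofReal ?_
  rw [← mul_add, mul_left_comm]
  refine mul_le_mul_of_nonneg_left ?_ (hw n k)
  have := norm_add_le (ψ.wave n k) (η.wave n k)
  nlinarith [sq_nonneg (‖ψ.wave n k‖ - ‖η.wave n k‖), norm_nonneg (ψ.wave n k + η.wave n k)]

theorem wave_sum {ι : Type*} (s : Finset ι) (η : ι → Fock μ) (n : ℕ) :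
    Fock.wave (∑ i ∈ s, η i) n =ᵐ[prodMeas μ n] fun k => ∑ i ∈ s, (η i).wave n k := by
  classical
  induction s using Finset.induction_on with
  | empty => simpa using wave_zero (μ := μ) n
  | insert a s ha ih =>
    rw [Finset.sum_insert ha]
    filter_upwards [wave_add (η a) (∑ i ∈ s, η i) n, ih] with k h1 h2
    rw [h1, h2, Finset.sum_insert ha]

theorem aesm_coord {f : M → ℂ} (hf : AEStronglyMeasurable f μ) (n : ℕ) (l : Fin n) :
    AEStronglyMeasurable (fun k : Fin n → M => f (k l)) (prodMeas μ n) :=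
  hf.comp_quasiMeasurePreserving (Measure.quasiMeasurePreserving_eval (fun _ : Fin n => μ) l)

theorem ae_coord {p : M → Prop} (h : ∀ᵐ x ∂μ, p x) (n : ℕ) :
    ∀ᵐ k ∂prodMeas μ n, ∀ l, p (k l) :=
  ae_all_iff.2 fun l => (Measure.quasiMeasurePreserving_eval (fun _ : Fin n => μ) l).ae h

theorem ae_removeNth {n : ℕ} {p : (Fin n → M) → Prop} (h : ∀ᵐ k ∂prodMeas μ n, p k) :
    ∀ᵐ k ∂prodMeas μ (n + 1), ∀ l : Fin (n + 1), p (l.removeNth k) :=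
  ae_all_iff.2 fun l => (quasi_removeNth n l).ae h

theorem aesm_crWave {f : M → ℂ} (hf : AEStronglyMeasurable f μ) (ψ : Fock μ) (n : ℕ) :
    AEStronglyMeasurable (crWave f ψ.wave n) (prodMeas μ n) := by
  cases n with
  | zero => exact aestronglyMeasurable_const
  | succ n =>
    refine AEStronglyMeasurable.const_mul ?_ _
    refine Finset.aestronglyMeasurable_fun_sum _ fun l _ => (aesm_coord hf _ l).mul ?_
    exact (wave_aesm ψ n).comp_quasiMeasurePreserving (quasi_removeNth n l)

theorem aesm_anWave {f : M → ℂ} (hf : AEStronglyMeasurable f μ) (ψ : Fock μ) (n : ℕ) :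
    AEStronglyMeasurable (anWave μ f ψ.wave n) (prodMeas μ n) := by
  refine AEStronglyMeasurable.const_mul ?_ _
  have h1 := (wave_aesm ψ (n + 1)).comp_measurePreserving (measurePreserving_snoc (μ := μ) n)
  have h2 := h1.comp_measurePreserving
    (Measure.measurePreserving_swap (μ := prodMeas μ n) (ν := μ))
  have h3 : AEStronglyMeasurable (fun p : (Fin n → M) × M => (starRingEnd ℂ) (f p.2))
      ((prodMeas μ n).prod μ) := hf.star.comp_snd
  exact (h3.mul h2).integral_prod_right'

theorem crWave_symm (f : M → ℂ) (ψ : Fock μ) (n : ℕ) (π : Equiv.Perm (Fin n)) :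
    ∀ᵐ k ∂prodMeas μ n, crWave f ψ.wave n k = crWave f ψ.wave n (fun i => k (π i)) := by
  cases n with
  | zero => exact Filter.Eventually.of_forall fun _ => rfl
  | succ n =>
    have h : ∀ᵐ k ∂prodMeas μ (n + 1), ∀ l : Fin (n + 1), ∀ τ : Equiv.Perm (Fin n),
        ψ.wave n (l.removeNth k) = ψ.wave n (fun i => l.removeNth k (τ i)) :=
      ae_removeNth (ae_all_iff.2 fun τ => wave_symm ψ n τ)
    filter_upwards [h] with k hk
    simp only [crWave]
    congr 1
    rw [← Equiv.sum_comp π]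
    refine Finset.sum_congr rfl fun l _ => ?_
    obtain ⟨τ, hτ⟩ := removeNth_comp_perm (M := M) π l
    rw [hτ k, ← hk]

theorem anWave_symm (f : M → ℂ) (ψ : Fock μ) (n : ℕ) (π : Equiv.Perm (Fin n)) :
    ∀ᵐ k ∂prodMeas μ n, anWave μ f ψ.wave n k = anWave μ f ψ.wave n (fun i => k (π i)) := by
  obtain ⟨τ, hτ⟩ := snoc_comp_perm (M := M) π
  filter_upwards [ae_snoc (wave_symm ψ (n + 1) τ)] with k hk
  simp only [anWave]
  congr 1
  refine integral_congr_ae ?_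
  filter_upwards [hk] with x hx
  rw [hτ k x, hx]

variable {ω : M → ℝ}

theorem tsum_crWave_le (hω : ∀ x, 0 < ω x) (hm : Measurable ω) (p : ℕ) (f : OneBoson μ)
    (ψ : Fock μ) :
    ∑' n, ∫⁻ k, ENNReal.ofReal (pw ω p n k * ‖crWave f ψ.wave n k‖ ^ 2) ∂prodMeas μ n ≤
      kn μ ω p f * wsq (pw ω (p + 1)) ψ := by
  rw [tsum_eq_zero_add' ENNReal.summable, wsq, ← ENNReal.tsum_mul_left]
  have h0 : ∫⁻ k, ENNReal.ofReal (pw ω p 0 k * ‖crWave f ψ.wave 0 k‖ ^ 2) ∂prodMeas μ 0 = 0 := by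
    simp [crWave]
  rw [h0, zero_add]
  exact ENNReal.tsum_le_tsum fun n =>
    lintegral_crWave_le hω hm p n (Lp.aestronglyMeasurable f) (wave_aesm ψ)

theorem tsum_anWave_le (hω : ∀ x, 0 < ω x) (hm : Measurable ω) (p : ℕ) (f : OneBoson μ)
    (ψ : Fock μ) :
    ∑' n, ∫⁻ k, ENNReal.ofReal (pw ω p n k * ‖anWave μ f ψ.wave n k‖ ^ 2) ∂prodMeas μ n ≤
      kn μ ω p f * wsq (pw ω (p + 1)) ψ := by
  rw [wsq, ← ENNReal.tsum_mul_left]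
  refine le_trans (ENNReal.tsum_le_tsum fun n => ?_)
    (ENNReal.tsum_comp_le_tsum_of_injective Nat.succ_injective _)
  exact lintegral_anWave_le hω hm p n (Lp.aestronglyMeasurable f) (wave_aesm ψ) (wave_symm ψ)

theorem mem_domain_creation (hω : ∀ x, 0 < ω x) (hm : Measurable ω) {f : OneBoson μ}
    (hf : kn μ ω 0 f ≠ ⊤) {ψ : Fock μ} (hψ : wsq (pw ω 1) ψ ≠ ⊤) : ψ ∈ (creation f).domain := by
  obtain ⟨η, hη⟩ := exists_fock (aesm_crWave (Lp.aestronglyMeasurable f) ψ) (crWave_symm f ψ) (by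
    refine ne_top_of_le_ne_top (ENNReal.mul_ne_top hf hψ) ?_
    refine le_trans ?_ (tsum_crWave_le hω hm 0 f ψ)
    simp [pw])
  exact LinearPMap.mem_domain_of_mem_graph (mem_graph_creation_iff.2 hη)

theorem mem_domain_annihilation (hω : ∀ x, 0 < ω x) (hm : Measurable ω) {f : OneBoson μ}
    (hf : kn μ ω 0 f ≠ ⊤) {ψ : Fock μ} (hψ : wsq (pw ω 1) ψ ≠ ⊤) :
    ψ ∈ (annihilation f).domain := by
  obtain ⟨η, hη⟩ := exists_fock (aesm_anWave (Lp.aestronglyMeasurable f) ψ) (anWave_symm f ψ) (by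
    refine ne_top_of_le_ne_top (ENNReal.mul_ne_top hf hψ) ?_
    refine le_trans ?_ (tsum_anWave_le hω hm 0 f ψ)
    simp [pw])
  exact LinearPMap.mem_domain_of_mem_graph (mem_graph_annihilation_iff.2 hη)

theorem wsq_creation_le (hω : ∀ x, 0 < ω x) (hm : Measurable ω) (p : ℕ) {f : OneBoson μ}
    {ψ : Fock μ} (hψ : ψ ∈ (creation f).domain) :
    wsq (pw ω p) (ev (creation f) ψ) ≤ kn μ ω p f * wsq (pw ω (p + 1)) ψ := by
  refine le_trans (le_of_eq ?_) (tsum_crWave_le hω hm p f ψ)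
  refine tsum_congr fun n => lintegral_congr_ae ?_
  filter_upwards [mem_graph_creation_iff.1 (mem_graph_ev _ hψ) n] with k hk
  rw [hk]

theorem wsq_annihilation_le (hω : ∀ x, 0 < ω x) (hm : Measurable ω) (p : ℕ) {f : OneBoson μ}
    {ψ : Fock μ} (hψ : ψ ∈ (annihilation f).domain) :
    wsq (pw ω p) (ev (annihilation f) ψ) ≤ kn μ ω p f * wsq (pw ω (p + 1)) ψ := by
  refine le_trans (le_of_eq ?_) (tsum_anWave_le hω hm p f ψ)
  refine tsum_congr fun n => lintegral_congr_ae ?_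
  filter_upwards [mem_graph_annihilation_iff.1 (mem_graph_ev _ hψ) n] with k hk
  rw [hk]

/-- The intersection of the maximal domains of `a†(f)` and `a(f)`. -/
def ladderDomain (f : OneBoson μ) : Submodule ℂ (Fock μ) :=
  (creation f).domain ⊓ (annihilation f).domain

theorem mem_ladderDomain (hω : ∀ x, 0 < ω x) (hm : Measurable ω) {f : OneBoson μ}
    (hf : kn μ ω 0 f ≠ ⊤) {ψ : Fock μ} (hψ : wsq (pw ω 1) ψ ≠ ⊤) : ψ ∈ ladderDomain f :=
  ⟨mem_domain_creation hω hm hf hψ, mem_domain_annihilation hω hm hf hψ⟩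

theorem ladderDomain_le_field (f : OneBoson μ) : ladderDomain f ≤ (field f).domain :=
  (creation f + annihilation f).le_closure.1

/-- Only the fact that an operator is contained in its closure enters; essential self-adjointness of
`a†(f) + a(f)` plays no role in the argument. -/
theorem ev_field {f : OneBoson μ} {ψ : Fock μ} (hψ : ψ ∈ ladderDomain f) :
    ev (field f) ψ = ev (creation f) ψ + ev (annihilation f) ψ := by
  rw [← ev_add _ _ hψ.1 hψ.2]
  exact ev_eq_of_le (creation f + annihilation f).le_closure hψ

theorem wsq_field_le (hω : ∀ x, 0 < ω x) (hm : Measurable ω) (p : ℕ) {f : OneBoson μ}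
    {ψ : Fock μ} (hψ : ψ ∈ ladderDomain f) :
    wsq (pw ω p) (ev (field f) ψ) ≤ 4 * kn μ ω p f * wsq (pw ω (p + 1)) ψ := by
  rw [ev_field hψ]
  refine (wsq_vec_add_le (measurable_pw hm p) (pw_nonneg hω p) _ _).trans ?_
  have h := add_le_add (wsq_creation_le hω hm p hψ.1) (wsq_annihilation_le hω hm p hψ.2)
  refine (mul_le_mul_right h 2).trans_eq ?_
  rw [← two_mul, ← mul_assoc, ← mul_assoc]
  norm_num

/-! ### Adjointness -/

theorem memLp_mul_removeNth (f : OneBoson μ) (ψ : Fock μ) (n : ℕ) (l : Fin (n + 1)) :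
    MemLp (fun k : Fin (n + 1) → M => f (k l) * ψ.wave n (l.removeNth k)) 2
      (prodMeas μ (n + 1)) := by
  refine memLp_two_of_lintegral ((aesm_coord (Lp.aestronglyMeasurable f) _ l).mul
    ((wave_aesm ψ n).comp_quasiMeasurePreserving (quasi_removeNth n l))) ?_
  simp only [norm_mul, mul_pow, ENNReal.ofReal_mul (sq_nonneg _)]
  rw [lintegral_removeNth n l (g := fun x => ENNReal.ofReal (‖f x‖ ^ 2))
    (F := fun k => ENNReal.ofReal (‖ψ.wave n k‖ ^ 2))
    ((Lp.aestronglyMeasurable f).norm.aemeasurable.pow_const 2).ennreal_ofReal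
    ((wave_aesm ψ n).norm.aemeasurable.pow_const 2).ennreal_ofReal]
  have h1 : ∫⁻ x, ENNReal.ofReal (‖f x‖ ^ 2) ∂μ ≠ ⊤ := by
    rw [← ofReal_norm_sq_Lp]
    exact ENNReal.ofReal_ne_top
  have h2 : ∫⁻ k, ENNReal.ofReal (‖ψ.wave n k‖ ^ 2) ∂prodMeas μ n ≠ ⊤ := by
    have := ofReal_norm_sq_Lp ((ψ n : SymL2 μ n) : Lp ℂ 2 (prodMeas μ n))
    rw [Fock.wave, ← this]
    exact ENNReal.ofReal_ne_top
  exact ENNReal.mul_ne_top h1 h2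

/-- By symmetry of `φ` and `ψ` the `n + 1` summands of the creation formula have equal integrals;
the last one is evaluated by Fubini, and `(n + 1)/√(n + 1) = √(n + 1)`. -/
theorem integral_crWave (f : OneBoson μ) (φ ψ : Fock μ) (n : ℕ) :
    ∫ k, (starRingEnd ℂ) (φ.wave (n + 1) k) * crWave f ψ.wave (n + 1) k ∂prodMeas μ (n + 1) =
      ∫ k, (starRingEnd ℂ) (anWave μ f φ.wave n k) * ψ.wave n k ∂prodMeas μ n := by
  have hn : (0 : ℝ) < n + 1 := by positivity
  set T : Fin (n + 1) → (Fin (n + 1) → M) → ℂ := fun l k =>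
    (starRingEnd ℂ) (φ.wave (n + 1) k) * (f (k l) * ψ.wave n (l.removeNth k)) with hT
  have hint : ∀ l, Integrable (T l) (prodMeas μ (n + 1)) := fun l =>
    (memLp_wave φ (n + 1)).star.integrable_mul (memLp_mul_removeNth f ψ n l)
  have heq : ∀ l, ∫ k, T l k ∂prodMeas μ (n + 1) = ∫ k, T (Fin.last n) k ∂prodMeas μ (n + 1) := by
    intro l
    rw [← integral_perm (n + 1) (Equiv.swap l (Fin.last n)) (T (Fin.last n))]
    refine integral_congr_ae ?_
    obtain ⟨τ, hτ⟩ := removeNth_comp_perm (M := M) (Equiv.swap l (Fin.last n)) (Fin.last n)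
    filter_upwards [wave_symm φ (n + 1) (Equiv.swap l (Fin.last n)),
      ae_removeNth (wave_symm ψ n τ)] with k h1 h2
    simp only [hT]
    rw [hτ k, Equiv.swap_apply_right, ← h1, ← h2]
  have hlast : ∫ k, T (Fin.last n) k ∂prodMeas μ (n + 1) =
      ∫ k, ∫ x, (starRingEnd ℂ) ((starRingEnd ℂ) (f x) * φ.wave (n + 1) (Fin.snoc k x)) *
        ψ.wave n k ∂μ ∂prodMeas μ n := by
    have h := measurePreserving_snoc (μ := μ) n
    have hi : Integrable (fun p : M × (Fin n → M) => T (Fin.last n) (Fin.snoc p.2 p.1))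
        (μ.prod (prodMeas μ n)) := h.integrable_comp_of_integrable (hint (Fin.last n))
    have h1 : ∫ k, T (Fin.last n) k ∂prodMeas μ (n + 1) =
        ∫ p : M × (Fin n → M), T (Fin.last n) (Fin.snoc p.2 p.1) ∂μ.prod (prodMeas μ n) := by
      conv_lhs => rw [← h.map_eq]
      refine integral_map h.aemeasurable ?_
      rw [h.map_eq]
      exact (hint _).1
    rw [h1, integral_prod_symm _ hi]
    refine integral_congr_ae (Filter.Eventually.of_forall fun k => ?_)
    refine integral_congr_ae (Filter.Eventually.of_forall fun x => ?_)
    simp only [hT, Fin.snoc_last, map_mul, conj_conj]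
    have : (Fin.last n).removeNth (Fin.snoc k x : Fin (n + 1) → M) = k := by
      simp [Fin.removeNth_last]
    rw [this]
    ring
  have hs : ((Real.sqrt (n + 1))⁻¹ : ℂ) * ((n + 1 : ℕ) : ℂ) = (Real.sqrt (n + 1) : ℂ) := by
    have h1 : ((n + 1 : ℕ) : ℂ) = (Real.sqrt (n + 1) : ℂ) * (Real.sqrt (n + 1) : ℂ) := by
      rw [← ofReal_mul, Real.mul_self_sqrt hn.le]
      push_cast
      ring
    have h2 : (Real.sqrt (n + 1) : ℂ) ≠ 0 := by
      rw [Ne, ofReal_eq_zero, Real.sqrt_eq_zero hn.le]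
      exact hn.ne'
    rw [h1]
    field_simp
  calc _ = ∫ k, ((Real.sqrt (n + 1))⁻¹ : ℂ) * ∑ l, T l k ∂prodMeas μ (n + 1) := by
        refine integral_congr_ae (Filter.Eventually.of_forall fun k => ?_)
        simp only [crWave, hT]
        rw [mul_left_comm, Finset.mul_sum]
    _ = (Real.sqrt (n + 1) : ℂ) * ∫ k, T (Fin.last n) k ∂prodMeas μ (n + 1) := by
        rw [integral_const_mul, integral_finsetSum _ fun l _ => hint l,
          Finset.sum_congr rfl fun l _ => heq l, Finset.sum_const, Finset.card_univ,
          Fintype.card_fin, nsmul_eq_mul, ← mul_assoc, hs]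
    _ = _ := by
        rw [hlast, ← integral_const_mul]
        refine integral_congr_ae (Filter.Eventually.of_forall fun k => ?_)
        simp only [anWave]
        rw [integral_mul_const, integral_conj, map_mul, conj_ofReal, mul_assoc]

theorem inner_annihilation {f : OneBoson μ} {φ ψ : Fock μ} (hφ : φ ∈ (annihilation f).domain)
    (hψ : ψ ∈ (creation f).domain) :
    inner ℂ (ev (annihilation f) φ) ψ = inner ℂ φ (ev (creation f) ψ) := by
  have hA := mem_graph_annihilation_iff.1 (mem_graph_ev _ hφ)
  have hC := mem_graph_creation_iff.1 (mem_graph_ev _ hψ)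
  have h1 := hasSum_inner_wave φ (ev (creation f) ψ)
  rw [← hasSum_nat_add_iff' 1] at h1
  have h0 : ∫ k, (starRingEnd ℂ) (φ.wave 0 k) * (ev (creation f) ψ).wave 0 k ∂prodMeas μ 0 = 0 := by
    refine integral_eq_zero_of_ae ?_
    filter_upwards [hC 0] with k hk
    rw [hk]
    simp [crWave]
  simp only [Finset.range_one, Finset.sum_singleton, h0, sub_zero] at h1
  refine (hasSum_inner_wave _ _).unique ?_
  have e : (fun n => ∫ k, (starRingEnd ℂ) ((ev (annihilation f) φ).wave n k) * ψ.wave n k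
      ∂prodMeas μ n) = fun n => ∫ k, (starRingEnd ℂ) (φ.wave (n + 1) k) *
        (ev (creation f) ψ).wave (n + 1) k ∂prodMeas μ (n + 1) := funext fun n => ?_
  · rw [e]
    exact h1
  have e1 : ∫ k, (starRingEnd ℂ) (φ.wave (n + 1) k) * (ev (creation f) ψ).wave (n + 1) k
      ∂prodMeas μ (n + 1) = ∫ k, (starRingEnd ℂ) (φ.wave (n + 1) k) * crWave f ψ.wave (n + 1) k
      ∂prodMeas μ (n + 1) := integral_congr_ae (by
    filter_upwards [hC (n + 1)] with k hk
    rw [hk])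
  rw [e1, integral_crWave]
  refine integral_congr_ae ?_
  filter_upwards [hA n] with k hk
  rw [hk]

theorem inner_field {f : OneBoson μ} {φ ψ : Fock μ} (hφ : φ ∈ ladderDomain f)
    (hψ : ψ ∈ ladderDomain f) :
    inner ℂ (ev (field f) φ) ψ = inner ℂ φ (ev (field f) ψ) := by
  rw [ev_field hφ, ev_field hψ, inner_add_left, inner_add_right, inner_annihilation hφ.2 hψ.1]
  have h := inner_annihilation hψ.2 hφ.1
  have h2 := congrArg (starRingEnd ℂ) h
  rw [inner_conj_symm, inner_conj_symm] at h2
  rw [h2, add_comm]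

/-! ### Commutation relations -/

theorem wave_dGamma {κ : M → ℝ} {ψ : Fock μ} (hψ : ψ ∈ (dGamma μ κ).domain) (n : ℕ) :
    (ev (dGamma μ κ) ψ).wave n =ᵐ[prodMeas μ n] fun k => (sym κ n k : ℂ) * ψ.wave n k :=
  mem_graph_dGamma.1 (mem_graph_ev _ hψ) n

theorem inner_dGamma {κ : M → ℝ} {φ ψ : Fock μ} (hφ : φ ∈ (dGamma μ κ).domain)
    (hψ : ψ ∈ (dGamma μ κ).domain) :
    inner ℂ (ev (dGamma μ κ) φ) ψ = inner ℂ φ (ev (dGamma μ κ) ψ) := by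
  refine inner_congr_wave fun n => ?_
  filter_upwards [wave_dGamma hφ n, wave_dGamma hψ n] with k h1 h2
  rw [h1, h2, map_mul, conj_ofReal]
  ring

/-- The commutator `[dΓ(κ), a†(f)] = a†(κf)`: splitting `κ(k_l)` off the symbol leaves the symbol of
the remaining particles. Stating it in the graph also yields `a†(f)ψ ∈ dom dΓ(κ)`. For `a(f)` the
commutator has the opposite sign. -/
theorem mem_graph_dGamma_creation {κ : M → ℝ} {f g : OneBoson μ}
    (hg : g =ᵐ[μ] fun x => (κ x : ℂ) * f x) {ψ : Fock μ} (h1 : ψ ∈ (dGamma μ κ).domain)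
    (h2 : ψ ∈ (creation f).domain) (h3 : ev (dGamma μ κ) ψ ∈ (creation f).domain)
    (h4 : ψ ∈ (creation g).domain) :
    (ev (creation f) ψ, ev (creation f) (ev (dGamma μ κ) ψ) + ev (creation g) ψ) ∈
      (dGamma μ κ).graph := by
  refine mem_graph_dGamma.2 fun n => ?_
  have e2 := mem_graph_creation_iff.1 (mem_graph_ev _ h2) n
  have e3 := mem_graph_creation_iff.1 (mem_graph_ev _ h3) n
  have e4 := mem_graph_creation_iff.1 (mem_graph_ev _ h4) n
  have e5 := wave_add (ev (creation f) (ev (dGamma μ κ) ψ)) (ev (creation g) ψ) n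
  cases n with
  | zero =>
    filter_upwards [e2, e3, e4, e5] with k e2 e3 e4 e5
    rw [e5, e2, e3, e4]
    simp [crWave]
  | succ n =>
    filter_upwards [e2, e3, e4, e5, ae_removeNth (wave_dGamma h1 n), ae_coord hg (n + 1)] with
      k e2 e3 e4 e5 e6 e7
    rw [e5, e2, e3, e4]
    simp only [crWave]
    rw [← mul_add, ← Finset.sum_add_distrib, mul_left_comm]
    congr 1
    rw [Finset.mul_sum]
    refine Finset.sum_congr rfl fun l _ => ?_
    rw [e6 l, e7 l]
    have h := sym_removeNth κ n l k
    change _ = (sym κ (n + 1) k : ℂ) * _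
    rw [h]
    push_cast
    ring

theorem mem_graph_dGamma_annihilation {κ : M → ℝ} {f g : OneBoson μ}
    (hg : g =ᵐ[μ] fun x => (κ x : ℂ) * f x) {ψ : Fock μ} (h1 : ψ ∈ (dGamma μ κ).domain)
    (h2 : ψ ∈ (annihilation f).domain) (h3 : ev (dGamma μ κ) ψ ∈ (annihilation f).domain)
    (h4 : ψ ∈ (annihilation g).domain) :
    (ev (annihilation f) ψ, ev (annihilation f) (ev (dGamma μ κ) ψ) - ev (annihilation g) ψ) ∈
      (dGamma μ κ).graph := by
  refine mem_graph_dGamma.2 fun n => ?_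
  filter_upwards [mem_graph_annihilation_iff.1 (mem_graph_ev _ h2) n,
    mem_graph_annihilation_iff.1 (mem_graph_ev _ h3) n,
    mem_graph_annihilation_iff.1 (mem_graph_ev _ h4) n,
    wave_sub (ev (annihilation f) (ev (dGamma μ κ) ψ)) (ev (annihilation g) ψ) n,
    ae_snoc (wave_dGamma h1 (n + 1)), integrable_snoc f ψ n, integrable_snoc g ψ n] with
    k e2 e3 e4 e5 e6 i1 i2
  rw [e5, e2, e3, e4]
  simp only [anWave]
  rw [← mul_sub, mul_left_comm]
  congr 1
  have : ∫ x, (starRingEnd ℂ) (f x) * (ev (dGamma μ κ) ψ).wave (n + 1) (Fin.snoc k x) ∂μ =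
      ∫ x, ((sym κ n k : ℂ) * ((starRingEnd ℂ) (f x) * ψ.wave (n + 1) (Fin.snoc k x)) +
        (starRingEnd ℂ) (g x) * ψ.wave (n + 1) (Fin.snoc k x)) ∂μ := by
    refine integral_congr_ae ?_
    filter_upwards [e6, hg] with x e6 e7
    rw [e6, e7, sym_snoc, map_mul, conj_ofReal]
    push_cast
    ring
  rw [this, integral_add (i1.const_mul _) i2, integral_const_mul]
  simp only [add_sub_cancel_right, sym]

theorem mem_graph_creation_sum {ι : Type*} [Fintype ι] {g : ι → OneBoson μ} {h : OneBoson μ}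
    (c : ℂ) (hh : h =ᵐ[μ] fun x => c * ∑ i, g i x) {ψ : Fock μ}
    (hψ : ∀ i, ψ ∈ (creation (g i)).domain) :
    (ψ, c • ∑ i, ev (creation (g i)) ψ) ∈ (creation h).graph := by
  refine mem_graph_creation_iff.2 fun n => ?_
  have e1 : ∀ᵐ k ∂prodMeas μ n, ∀ i, (ev (creation (g i)) ψ).wave n k = crWave (g i) ψ.wave n k :=
    ae_all_iff.2 fun i => mem_graph_creation_iff.1 (mem_graph_ev _ (hψ i)) n
  filter_upwards [e1, wave_smul c (∑ i, ev (creation (g i)) ψ) n, ae_coord hh n,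
    wave_sum Finset.univ (fun i => ev (creation (g i)) ψ) n] with k e1 e2 e3 e4
  rw [e2, e4]
  simp only [e1]
  cases n with
  | zero => simp [crWave]
  | succ n =>
    simp only [crWave, ← Finset.mul_sum]
    rw [mul_left_comm, Finset.sum_comm, Finset.mul_sum]
    congr 1
    refine Finset.sum_congr rfl fun l _ => ?_
    rw [e3 l, ← Finset.sum_mul, mul_assoc]

/-- Annihilation is antilinear in `f`, creation linear. This difference turns `φ(i f)` into `i
(a†(f) - a(f))`, the shape of the commutators. -/
theorem mem_graph_annihilation_sum {ι : Type*} [Fintype ι] {g : ι → OneBoson μ} {h : OneBoson μ}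
    (c : ℂ) (hh : h =ᵐ[μ] fun x => c * ∑ i, g i x) {ψ : Fock μ}
    (hψ : ∀ i, ψ ∈ (annihilation (g i)).domain) :
    (ψ, (starRingEnd ℂ) c • ∑ i, ev (annihilation (g i)) ψ) ∈ (annihilation h).graph := by
  refine mem_graph_annihilation_iff.2 fun n => ?_
  have e1 : ∀ᵐ k ∂prodMeas μ n, ∀ i,
      (ev (annihilation (g i)) ψ).wave n k = anWave μ (g i) ψ.wave n k :=
    ae_all_iff.2 fun i => mem_graph_annihilation_iff.1 (mem_graph_ev _ (hψ i)) n
  have i1 : ∀ᵐ k ∂prodMeas μ n, ∀ i,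
      Integrable (fun k' => (starRingEnd ℂ) (g i k') * ψ.wave (n + 1) (Fin.snoc k k')) μ :=
    ae_all_iff.2 fun i => integrable_snoc (g i) ψ n
  filter_upwards [e1, wave_smul ((starRingEnd ℂ) c) (∑ i, ev (annihilation (g i)) ψ) n, i1,
    wave_sum Finset.univ (fun i => ev (annihilation (g i)) ψ) n] with k e1 e2 i1 e4
  rw [e2, e4]
  simp only [e1, anWave, ← Finset.mul_sum]
  rw [mul_left_comm, ← integral_finsetSum _ fun i _ => i1 i, ← integral_const_mul]
  congr 1
  refine integral_congr_ae ?_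
  filter_upwards [hh] with x hx
  rw [hx, map_mul, map_sum, ← Finset.sum_mul, mul_assoc]

end FockOps

end FiberHam

end
noncomputable section

namespace FiberHam

section Model

variable {M : Type*} [MeasurableSpace M] {μ : Measure M} [SigmaFinite μ] {ν : ℕ}

open scoped ENNReal

/-! ### Real weighted norms -/

/-- The real weighted norm `(∑ₙ ∫ wₙ |ψₙ|²)^{1/2}`. -/
def wn (w : ∀ n, (Fin n → M) → ℝ) (ψ : Fock μ) : ℝ := Real.sqrt (wsq w ψ).toReal

theorem wn_nonneg (w : ∀ n, (Fin n → M) → ℝ) (ψ : Fock μ) : 0 ≤ wn w ψ := Real.sqrt_nonneg _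

theorem norm_le_mul_wn {w : ∀ n, (Fin n → M) → ℝ} {v ψ : Fock μ} {K : ℝ≥0∞} (hK : K ≠ ⊤)
    (hψ : wsq w ψ ≠ ⊤) (h : wsq (fun _ _ => 1) v ≤ K * wsq w ψ) :
    ‖v‖ ≤ Real.sqrt K.toReal * wn w ψ := by
  rw [wn, ← Real.sqrt_mul ENNReal.toReal_nonneg, ← ENNReal.toReal_mul]
  refine Real.le_sqrt_of_sq_le ?_
  rw [← ofReal_norm_sq] at h
  exact (ENNReal.ofReal_le_iff_le_toReal (ENNReal.mul_ne_top hK hψ)).1 h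

theorem ofReal_norm_sq_of_wave_eq {ψ η : Fock μ} {g : ∀ n, (Fin n → M) → ℂ}
    (h : ∀ n, η.wave n =ᵐ[prodMeas μ n] fun k => g n k * ψ.wave n k) :
    ENNReal.ofReal (‖η‖ ^ 2) = wsq (fun n k => ‖g n k‖ ^ 2) ψ := by
  rw [ofReal_norm_sq, wsq_of_wave_eq h]
  simp only [one_mul]

/-- The bridge from symbols to operators: a pointwise inequality between a weight and the square of
a symbol becomes a bound by the norm of the multiplied vector. -/
theorem wsq_le_of_wave_eq {w : ∀ n, (Fin n → M) → ℝ} {ψ η : Fock μ} {g : ∀ n, (Fin n → M) → ℝ}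
    (hg : ∀ n, Measurable (g n))
    (h : ∀ n, η.wave n =ᵐ[prodMeas μ n] fun k => (g n k : ℂ) * ψ.wave n k) {α β : ℝ}
    (hα : 0 ≤ α) (hβ : 0 ≤ β) (hw : ∀ n k, w n k ≤ α * g n k ^ 2 + β) :
    wsq w ψ ≤ ENNReal.ofReal (α * ‖η‖ ^ 2 + β * ‖ψ‖ ^ 2) := by
  refine (wsq_mono ψ (w' := fun n k => α * g n k ^ 2 + β * 1) fun n k => by
    rw [mul_one]; exact hw n k).trans ?_
  rw [wsq_add ψ (fun n => ((hg n).pow_const 2).const_mul _) (fun n k => by positivity)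
    (fun n k => by positivity), wsq_const_mul (fun n k => g n k ^ 2) ψ hα,
    wsq_const_mul (fun _ _ => 1) ψ hβ, ENNReal.ofReal_add (by positivity) (by positivity),
    ENNReal.ofReal_mul hα, ENNReal.ofReal_mul hβ, ofReal_norm_sq_of_wave_eq h, ← ofReal_norm_sq]
  simp only [norm_real, Real.norm_eq_abs, sq_abs, le_refl]

theorem wn_le_of_wave_eq {w : ∀ n, (Fin n → M) → ℝ} {ψ η : Fock μ} {g : ∀ n, (Fin n → M) → ℝ}
    (hg : ∀ n, Measurable (g n))
    (h : ∀ n, η.wave n =ᵐ[prodMeas μ n] fun k => (g n k : ℂ) * ψ.wave n k) {α β : ℝ}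
    (hα : 0 ≤ α) (hβ : 0 ≤ β) (hw : ∀ n k, w n k ≤ α ^ 2 * g n k ^ 2 + β ^ 2) :
    wn w ψ ≤ α * ‖η‖ + β * ‖ψ‖ := by
  have h1 := wsq_le_of_wave_eq hg h (sq_nonneg α) (sq_nonneg β) hw
  rw [wn]
  refine Real.sqrt_le_iff.2 ⟨by positivity, ?_⟩
  refine (ENNReal.toReal_le_of_le_ofReal (by positivity) h1).trans ?_
  nlinarith [mul_nonneg (mul_nonneg hα (norm_nonneg η)) (mul_nonneg hβ (norm_nonneg ψ))]

/-! ### The operators `M_a(ξ)` as multiplications by symbols -/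

/-! ### Multiplication operators of the model -/

/-- Positivity and measurability of the symbols. -/
structure PosSymbols (ω : M → ℝ) (m : Fin ν → M → ℝ) : Prop where
  pos : ∀ x, 0 < ω x
  meas_omega : Measurable ω
  meas_m : ∀ l, Measurable (m l)

theorem mem_domain_dGamma_iff {κ : M → ℝ} (hκ : Measurable κ) {ψ : Fock μ} :
    ψ ∈ (dGamma μ κ).domain ↔ wsq (fun n k => sym κ n k ^ 2) ψ ≠ ⊤ := by
  constructor
  · intro h
    have := ofReal_norm_sq_of_wave_eq (wave_dGamma h)
    simp only [norm_real, Real.norm_eq_abs, sq_abs] at this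
    rw [← this]
    exact ENNReal.ofReal_ne_top
  · intro h
    obtain ⟨η, hη⟩ := exists_mul (ψ := ψ) (g := fun n k => (sym κ n k : ℂ))
      (fun n => measurable_ofReal.comp (measurable_sym hκ n))
      (fun n π k => by rw [sym_perm]) (by simpa using h)
    exact LinearPMap.mem_domain_of_mem_graph (mem_graph_dGamma.2 hη)

theorem wave_opScalar_sub {κ : M → ℝ} {ψ : Fock μ} (hψ : ψ ∈ (dGamma μ κ).domain) (t : ℝ) (n : ℕ) :
    (ev (opScalar (t : ℂ) - dGamma μ κ) ψ).wave n =ᵐ[prodMeas μ n]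
      fun k => ((t - sym κ n k : ℝ) : ℂ) * ψ.wave n k := by
  rw [ev_sub _ _ (mem_domain_opScalar _ _) hψ, ev_opScalar]
  filter_upwards [wave_sub ((t : ℂ) • ψ) (ev (dGamma μ κ) ψ) n, wave_smul (t : ℂ) ψ n,
    wave_dGamma hψ n] with k h1 h2 h3
  rw [h1, h2, h3]
  push_cast
  ring

variable (μ)

/-- The scalar operator `½ (ξ - dΓ(m))² + a dΓ(ω)`. -/
def opMsc (ω : M → ℝ) (m : Fin ν → M → ℝ) (a : ℝ) (ξ : EuclideanSpace ℝ (Fin ν)) :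
    Fock μ →ₗ.[ℂ] Fock μ :=
  (1 / 2 : ℂ) • opDot (kin μ m ξ) (kin μ m ξ) + (a : ℂ) • dGamma μ ω

variable {μ}

/-- The symbol `|ξ - m|²` of `(ξ - dΓ(m))²`. -/
def symX (m : Fin ν → M → ℝ) (ξ : EuclideanSpace ℝ (Fin ν)) (n : ℕ) (k : Fin n → M) : ℝ :=
  ∑ l, (ξ l - sym (m l) n k) ^ 2

/-- The symbol `½ |ξ - m|² + a ω` of `M_a(ξ)`. -/
def symMa (ω : M → ℝ) (m : Fin ν → M → ℝ) (a : ℝ) (ξ : EuclideanSpace ℝ (Fin ν)) (n : ℕ)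
    (k : Fin n → M) : ℝ :=
  1 / 2 * symX m ξ n k + a * sym ω n k

theorem symX_nonneg (m : Fin ν → M → ℝ) (ξ : EuclideanSpace ℝ (Fin ν)) (n : ℕ) (k : Fin n → M) :
    0 ≤ symX m ξ n k := Finset.sum_nonneg fun _ _ => sq_nonneg _

theorem symX_perm (m : Fin ν → M → ℝ) (ξ : EuclideanSpace ℝ (Fin ν)) (n : ℕ)
    (π : Equiv.Perm (Fin n)) (k : Fin n → M) :
    symX m ξ n (fun i => k (π i)) = symX m ξ n k := by
  simp only [symX, sym_perm]

theorem symMa_perm (ω : M → ℝ) (m : Fin ν → M → ℝ) (a : ℝ) (ξ : EuclideanSpace ℝ (Fin ν)) (n : ℕ)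
    (π : Equiv.Perm (Fin n)) (k : Fin n → M) :
    symMa ω m a ξ n (fun i => k (π i)) = symMa ω m a ξ n k := by
  simp only [symMa, symX_perm, sym_perm]

variable {ω : M → ℝ} {m : Fin ν → M → ℝ}

theorem PosSymbols.measurable_symX (hs : PosSymbols ω m) (ξ : EuclideanSpace ℝ (Fin ν)) (n : ℕ) :
    Measurable (symX m ξ n) :=
  Finset.measurable_sum _ fun l _ => ((measurable_sym (hs.meas_m l) n).const_sub _).pow_const 2

theorem PosSymbols.measurable_symMa (hs : PosSymbols ω m) (a : ℝ) (ξ : EuclideanSpace ℝ (Fin ν))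
    (n : ℕ) : Measurable (symMa ω m a ξ n) :=
  ((hs.measurable_symX ξ n).const_mul _).add ((measurable_sym hs.meas_omega n).const_mul _)

theorem mem_domain_kin {ξ : EuclideanSpace ℝ (Fin ν)} {l : Fin ν} {ψ : Fock μ} :
    ψ ∈ (kin μ m ξ l).domain ↔ ψ ∈ (dGamma μ (m l)).domain :=
  ⟨fun h => h.2, fun h => ⟨mem_domain_opScalar _ _, h⟩⟩

theorem ev_kin {ξ : EuclideanSpace ℝ (Fin ν)} {l : Fin ν} {ψ : Fock μ}
    (h : ψ ∈ (dGamma μ (m l)).domain) :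
    ev (kin μ m ξ l) ψ = (ξ l : ℂ) • ψ - ev (dGamma μ (m l)) ψ := by
  rw [kin, ev_sub _ _ (mem_domain_opScalar _ _) h, ev_opScalar]

theorem wave_kin {ξ : EuclideanSpace ℝ (Fin ν)} {l : Fin ν} {ψ : Fock μ}
    (h : ψ ∈ (dGamma μ (m l)).domain) (n : ℕ) :
    (ev (kin μ m ξ l) ψ).wave n =ᵐ[prodMeas μ n]
      fun k => ((ξ l - sym (m l) n k : ℝ) : ℂ) * ψ.wave n k :=
  wave_opScalar_sub h (ξ l) n

/-- Shifting by the scalar `ξ_l` changes `dΓ(m_l)ψ` only by a multiple of `ψ`, so the iterated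
domain is independent of `ξ`. This is why all the `M_a(ξ)` share one domain. -/
theorem kin_kin_mem_iff {ξ : EuclideanSpace ℝ (Fin ν)} {l : Fin ν} {ψ : Fock μ} :
    (ψ ∈ (kin μ m ξ l).domain ∧ ev (kin μ m ξ l) ψ ∈ (kin μ m ξ l).domain) ↔
      ψ ∈ (dGamma μ (m l)).domain ∧ ev (dGamma μ (m l)) ψ ∈ (dGamma μ (m l)).domain := by
  rw [mem_domain_kin, mem_domain_kin]
  refine and_congr_right fun h => ?_
  rw [ev_kin h]
  constructor
  · intro h2
    have := Submodule.sub_mem _ ((dGamma μ (m l)).domain.smul_mem (ξ l : ℂ) h) h2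
    simpa using this
  · exact fun h2 => Submodule.sub_mem _ (Submodule.smul_mem _ _ h) h2

theorem opMsc_domain (a : ℝ) (ξ : EuclideanSpace ℝ (Fin ν)) :
    (opMsc μ ω m a ξ).domain = (opM μ ω m).domain := by
  ext ψ
  change (ψ ∈ (opDot (kin μ m ξ) (kin μ m ξ)).domain ∧ ψ ∈ (dGamma μ ω).domain) ↔
    (ψ ∈ (opDot (fun l => dGamma μ (m l)) (fun l => dGamma μ (m l))).domain ∧
      ψ ∈ (dGamma μ ω).domain)
  rw [mem_domain_opDot, mem_domain_opDot]
  simp only [kin_kin_mem_iff]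

/-- The component conditions describing `dom M`. -/
theorem mem_opM_domain {ψ : Fock μ} : ψ ∈ (opM μ ω m).domain ↔
    (∀ l, ψ ∈ (dGamma μ (m l)).domain ∧ ev (dGamma μ (m l)) ψ ∈ (dGamma μ (m l)).domain) ∧
      ψ ∈ (dGamma μ ω).domain := by
  change (ψ ∈ (opDot (fun l => dGamma μ (m l)) (fun l => dGamma μ (m l))).domain ∧
      ψ ∈ (dGamma μ ω).domain) ↔ _
  rw [mem_domain_opDot]

theorem ev_opMsc {a : ℝ} {ξ : EuclideanSpace ℝ (Fin ν)} {ψ : Fock μ}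
    (h : ψ ∈ (opM μ ω m).domain) :
    ev (opMsc μ ω m a ξ) ψ =
      (1 / 2 : ℂ) • ∑ l, ev (kin μ m ξ l) (ev (kin μ m ξ l) ψ) + (a : ℂ) • ev (dGamma μ ω) ψ := by
  rw [mem_opM_domain] at h
  have h1 := fun l => (kin_kin_mem_iff (ξ := ξ)).2 (h.1 l)
  rw [opMsc, ev_add ((1 / 2 : ℂ) • opDot (kin μ m ξ) (kin μ m ξ)) ((a : ℂ) • dGamma μ ω)
    (mem_domain_opDot.2 h1) h.2, ev_smul _ _ (mem_domain_opDot.2 h1),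
    ev_smul _ _ h.2, ev_opDot h1]

theorem wave_opMsc {a : ℝ} {ξ : EuclideanSpace ℝ (Fin ν)} {ψ : Fock μ}
    (h : ψ ∈ (opM μ ω m).domain) (n : ℕ) :
    (ev (opMsc μ ω m a ξ) ψ).wave n =ᵐ[prodMeas μ n]
      fun k => (symMa ω m a ξ n k : ℂ) * ψ.wave n k := by
  rw [ev_opMsc h]
  rw [mem_opM_domain] at h
  have h1 := fun l => (kin_kin_mem_iff (ξ := ξ)).2 (h.1 l)
  have e1 : ∀ᵐ k ∂prodMeas μ n, ∀ l, (ev (kin μ m ξ l) ψ).wave n k =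
      ((ξ l - sym (m l) n k : ℝ) : ℂ) * ψ.wave n k :=
    ae_all_iff.2 fun l => wave_kin (h.1 l).1 n
  have e2 : ∀ᵐ k ∂prodMeas μ n, ∀ l, (ev (kin μ m ξ l) (ev (kin μ m ξ l) ψ)).wave n k =
      ((ξ l - sym (m l) n k : ℝ) : ℂ) * (ev (kin μ m ξ l) ψ).wave n k :=
    ae_all_iff.2 fun l => wave_kin (mem_domain_kin.1 (h1 l).2) n
  filter_upwards [e1, e2, wave_dGamma h.2 n,
    wave_add ((1 / 2 : ℂ) • ∑ l, ev (kin μ m ξ l) (ev (kin μ m ξ l) ψ))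
      ((a : ℂ) • ev (dGamma μ ω) ψ) n,
    wave_smul (1 / 2 : ℂ) (∑ l, ev (kin μ m ξ l) (ev (kin μ m ξ l) ψ)) n,
    wave_smul (a : ℂ) (ev (dGamma μ ω) ψ) n,
    wave_sum Finset.univ (fun l => ev (kin μ m ξ l) (ev (kin μ m ξ l) ψ)) n] with
    k e1 e2 e3 e4 e5 e6 e7
  rw [e4, e5, e6, e7, e3]
  simp only [e1, e2, symMa, symX]
  push_cast
  rw [add_mul, mul_assoc, Finset.sum_mul, mul_assoc]
  congr 2
  exact Finset.sum_congr rfl fun l _ => by ring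

/-- All summands of the symbol are nonnegative, so nothing cancels: square integrability of the
total controls each `dΓ(m_l)²` and `dΓ(ω)` separately, and the natural domain of the sum is the
maximal one. -/
theorem PosSymbols.mem_opM_domain_iff (hs : PosSymbols ω m) {ψ : Fock μ} :
    ψ ∈ (opM μ ω m).domain ↔ wsq (fun n k => symMa ω m 1 0 n k ^ 2) ψ ≠ ⊤ := by
  constructor
  · intro h
    have := ofReal_norm_sq_of_wave_eq (wave_opMsc (a := 1) (ξ := 0) h)
    simp only [norm_real, Real.norm_eq_abs, sq_abs] at this
    rw [← this]
    exact ENNReal.ofReal_ne_top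
  · intro h
    have hΩ := fun n k => sym_nonneg hs.pos n k
    have hX : ∀ (l : Fin ν) n (k : Fin n → M), sym (m l) n k ^ 2 ≤ 2 * symMa ω m 1 0 n k := by
      intro l n k
      have : (0 - sym (m l) n k) ^ 2 ≤ symX m 0 n k :=
        Finset.single_le_sum (f := fun l => ((0 : EuclideanSpace ℝ (Fin ν)) l - sym (m l) n k) ^ 2)
          (fun _ _ => sq_nonneg _) (Finset.mem_univ l)
      rw [symMa]
      nlinarith [hΩ n k]
    have hfin : wsq (fun n k => 4 * symMa ω m 1 0 n k ^ 2 + 1) ψ ≠ ⊤ := by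
      rw [wsq_add ψ (fun n => ((hs.measurable_symMa 1 0 n).pow_const 2).const_mul 4)
        (fun n k => by positivity) (fun n k => by positivity),
        wsq_const_mul (fun n k => symMa ω m 1 0 n k ^ 2) ψ (by norm_num), ← ofReal_norm_sq]
      exact ENNReal.add_ne_top.2 ⟨ENNReal.mul_ne_top ENNReal.ofReal_ne_top h, ENNReal.ofReal_ne_top⟩
    have h1 : ∀ l, ψ ∈ (dGamma μ (m l)).domain := fun l => by
      rw [mem_domain_dGamma_iff (hs.meas_m l)]
      refine ne_top_of_le_ne_top hfin (wsq_mono ψ fun n k => ?_)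
      nlinarith [hX l n k, sq_nonneg (symMa ω m 1 0 n k - 1)]
    rw [mem_opM_domain]
    refine ⟨fun l => ⟨h1 l, ?_⟩, ?_⟩
    · rw [mem_domain_dGamma_iff (hs.meas_m l), wsq_of_wave_eq (wave_dGamma (h1 l))]
      refine ne_top_of_le_ne_top hfin (wsq_mono ψ fun n k => ?_)
      rw [norm_real, Real.norm_eq_abs, sq_abs]
      nlinarith [hX l n k, sq_nonneg (sym (m l) n k)]
    · rw [mem_domain_dGamma_iff hs.meas_omega]
      refine ne_top_of_le_ne_top h (wsq_mono ψ fun n k => ?_)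
      have := symX_nonneg m 0 n k
      refine pow_le_pow_left₀ (hΩ n k) ?_ 2
      rw [symMa]
      linarith

/-! ### Pointwise comparison of symbols -/

/-- The weight `(1 + ω)|ξ - m|² + (1 + ω)²` controlling the interaction terms. -/
def intWeight (ω : M → ℝ) (m : Fin ν → M → ℝ) (ξ : EuclideanSpace ℝ (Fin ν)) (n : ℕ)
    (k : Fin n → M) : ℝ :=
  (1 + sym ω n k) * symX m ξ n k + (1 + sym ω n k) ^ 2

/-- With `X = |ξ - m|²`, the dangerous part of the weight is `XΩ`. It is matched by the cross term
of `(½X + aΩ)²`, whose coefficient grows with `a`; this is what allows a small `ε`. -/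
theorem PosSymbols.intWeight_le (hs : PosSymbols ω m) (ξ : EuclideanSpace ℝ (Fin ν)) {ε : ℝ}
    (hε : 0 < ε) : ∃ a : ℝ, 1 ≤ a ∧ ∃ c : ℝ, 0 ≤ c ∧ ∀ n (k : Fin n → M),
      intWeight ω m ξ n k ≤ ε ^ 2 * symMa ω m a ξ n k ^ 2 + c ^ 2 := by
  have hε2 : 0 < ε ^ 2 := by positivity
  -- For `e = ε²` and `d = 1/e`, the choice `a = 1 + 2d` gives the coefficients `e/4`, `e + 2` and
  -- `(1 + 2d)(e + 2) ≥ 2` for `X²`, `XΩ` and `Ω²`. The rest of the weight follows from `X ≤ eX²/4 +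
  -- d` and `2Ω ≤ Ω² + 1`, at the price of the constant `2 + d`.
  refine ⟨1 + 2 / ε ^ 2, by have := div_pos two_pos hε2; linarith, Real.sqrt (2 + 1 / ε ^ 2),
    Real.sqrt_nonneg _, fun n k => ?_⟩
  have hΩ := sym_nonneg hs.pos n k
  have hX := symX_nonneg m ξ n k
  rw [Real.sq_sqrt (by positivity), intWeight, symMa]
  set Ω := sym ω n k
  set X := symX m ξ n k
  set d := 1 / ε ^ 2 with hd
  have hd0 : 0 < d := by positivity
  have hed : ε ^ 2 * d = 1 := by rw [hd]; field_simp
  have h2 : 2 / ε ^ 2 = 2 * d := by rw [hd]; ring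
  rw [h2]
  set e := ε ^ 2
  have h3 : X ≤ e * X ^ 2 / 4 + d := by nlinarith [sq_nonneg (e * X - 2)]
  have h4 : e * (1 / 2 * X + (1 + 2 * d) * Ω) ^ 2 =
      e * X ^ 2 / 4 + (e + 2) * (X * Ω) + (1 + 2 * d) * (e + 2) * Ω ^ 2 := by
    linear_combination (2 * X * Ω + 2 * (1 + 2 * d) * Ω ^ 2) * hed
  rw [h4]
  have h5 : 0 ≤ X * Ω := mul_nonneg hX hΩ
  have h6 : 2 ≤ (1 + 2 * d) * (e + 2) := by nlinarith
  nlinarith [sq_nonneg (Ω - 1), mul_le_mul_of_nonneg_right h6 (sq_nonneg Ω)]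

theorem PosSymbols.intWeight_le_one (hs : PosSymbols ω m) (ξ : EuclideanSpace ℝ (Fin ν)) (n : ℕ)
    (k : Fin n → M) : intWeight ω m ξ n k ≤ 2 ^ 2 * symMa ω m 1 ξ n k ^ 2 + 2 ^ 2 := by
  have hΩ := sym_nonneg hs.pos n k
  have hX := symX_nonneg m ξ n k
  rw [intWeight, symMa]
  nlinarith [mul_nonneg hX hΩ, sq_nonneg (symX m ξ n k - 2), sq_nonneg (sym ω n k - 1)]

/-- Comparison of the symbols of `M_a(ξ)` and `M_b(η)`. -/
theorem PosSymbols.symMa_le (hs : PosSymbols ω m) {a b : ℝ} (ha : 1 ≤ a) (hb : 1 ≤ b)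
    (ξ η : EuclideanSpace ℝ (Fin ν)) : ∃ c : ℝ, 0 ≤ c ∧ ∀ n (k : Fin n → M),
      symMa ω m a ξ n k ^ 2 ≤ c ^ 2 * symMa ω m b η n k ^ 2 + c ^ 2 := by
  set s : ℝ := ∑ l, (ξ l - η l) ^ 2 with hs'
  have hs0 : 0 ≤ s := Finset.sum_nonneg fun _ _ => sq_nonneg _
  set C := 2 * (a + 2 + s) with hC
  refine ⟨C, by positivity, fun n k => ?_⟩
  have hΩ := sym_nonneg hs.pos n k
  have hX := symX_nonneg m ξ n k
  have hY := symX_nonneg m η n k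
  have hXY : symX m ξ n k ≤ 2 * symX m η n k + 2 * s := by
    rw [symX, symX, hs', Finset.mul_sum, Finset.mul_sum, ← Finset.sum_add_distrib]
    refine Finset.sum_le_sum fun l _ => ?_
    nlinarith [sq_nonneg ((ξ l - η l) - (η l - sym (m l) n k))]
  have h0 : 0 ≤ symMa ω m a ξ n k := by
    rw [symMa]
    positivity
  have hb0 : 0 ≤ symMa ω m b η n k := by
    rw [symMa]
    positivity
  have h1 : symMa ω m a ξ n k ≤ (a + 2 + s) * (symMa ω m b η n k + 1) := by
    rw [symMa, symMa]
    nlinarith [mul_nonneg hs0 hY, mul_nonneg hs0 hΩ, mul_nonneg (sub_nonneg.2 ha) hY,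
      mul_nonneg (sub_nonneg.2 hb) hΩ, mul_nonneg (mul_nonneg (sub_nonneg.2 hb) hΩ)
        (by linarith : 0 ≤ a + 1 + s)]
  have h2 := pow_le_pow_left₀ h0 h1 2
  refine h2.trans ?_
  rw [mul_pow, hC, mul_pow]
  have h3 : (symMa ω m b η n k + 1) ^ 2 ≤ 2 ^ 2 * (symMa ω m b η n k ^ 2 + 1) := by
    nlinarith [sq_nonneg (symMa ω m b η n k - 1)]
  nlinarith [mul_le_mul_of_nonneg_left h3 (sq_nonneg (a + 2 + s))]

theorem PosSymbols.norm_opMsc_le (hs : PosSymbols ω m) {a b : ℝ} (ha : 1 ≤ a) (hb : 1 ≤ b)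
    (ξ η : EuclideanSpace ℝ (Fin ν)) : ∃ c : ℝ, 0 ≤ c ∧ ∀ ψ ∈ (opM μ ω m).domain,
      ‖ev (opMsc μ ω m a ξ) ψ‖ ≤ c * (‖ev (opMsc μ ω m b η) ψ‖ + ‖ψ‖) := by
  obtain ⟨c, hc, h⟩ := hs.symMa_le ha hb ξ η
  refine ⟨c, hc, fun ψ hψ => ?_⟩
  have h1 := wn_le_of_wave_eq (hs.measurable_symMa b η) (wave_opMsc hψ) hc hc h
  have h2 := ofReal_norm_sq_of_wave_eq (wave_opMsc (a := a) (ξ := ξ) hψ)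
  simp only [norm_real, Real.norm_eq_abs, sq_abs] at h2
  rw [wn, ← h2, ENNReal.toReal_ofReal (sq_nonneg _), Real.sqrt_sq (norm_nonneg _)] at h1
  linarith

theorem PosSymbols.wsq_intWeight_ne_top (hs : PosSymbols ω m) {ξ : EuclideanSpace ℝ (Fin ν)}
    {ψ : Fock μ} (hψ : ψ ∈ (opM μ ω m).domain) : wsq (intWeight ω m ξ) ψ ≠ ⊤ :=
  ne_top_of_le_ne_top ENNReal.ofReal_ne_top
    (wsq_le_of_wave_eq (hs.measurable_symMa 1 ξ) (wave_opMsc hψ) (by norm_num) (by norm_num)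
      (hs.intWeight_le_one ξ))

theorem PosSymbols.pw_le_intWeight (hs : PosSymbols ω m) (ξ : EuclideanSpace ℝ (Fin ν)) {p : ℕ}
    (hp : p ≤ 2) (n : ℕ) (k : Fin n → M) : pw ω p n k ≤ intWeight ω m ξ n k := by
  have hΩ := sym_nonneg hs.pos n k
  have hX := symX_nonneg m ξ n k
  have : pw ω p n k ≤ (1 + sym ω n k) ^ 2 := pow_le_pow_right₀ (by linarith) hp
  rw [intWeight]
  nlinarith [mul_nonneg (by linarith : 0 ≤ 1 + sym ω n k) hX]

end Model

end FiberHam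

end
-- Interaction terms as perturbations controlled by a weight
noncomputable section

namespace FiberHam

section Interaction

variable {M : Type*} [MeasurableSpace M] {μ : Measure M} [SigmaFinite μ] {ν : ℕ}
  {ω : M → ℝ} {m : Fin ν → M → ℝ}

open scoped ENNReal

/-! ### Form factors in `𝔨` -/

/-- Membership of a function in `𝔨 = L²([ω⁻¹ + (ω + ½m²)²] μ)`. -/
def InK (μ : Measure M) (ω : M → ℝ) (m : Fin ν → M → ℝ) (f : M → ℂ) : Prop :=
  ∫⁻ x, ENNReal.ofReal (((ω x)⁻¹ + totalSymbol ω m x ^ 2) * ‖f x‖ ^ 2) ∂μ ≠ ⊤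

theorem PosSymbols.omega_le_totalSymbol (x : M) : ω x ≤ totalSymbol ω m x := by
  rw [totalSymbol]
  have : 0 ≤ ∑ l, m l x ^ 2 := Finset.sum_nonneg fun _ _ => sq_nonneg _
  linarith

theorem InK.lintegral_ne_top {f : M → ℂ} (hf : InK μ ω m f) {w : M → ℝ} {C : ℝ} (hC : 0 ≤ C)
    (hw : ∀ x, w x ≤ C * ((ω x)⁻¹ + totalSymbol ω m x ^ 2)) :
    ∫⁻ x, ENNReal.ofReal (w x * ‖f x‖ ^ 2) ∂μ ≠ ⊤ := by
  refine ne_top_of_le_ne_top (ENNReal.mul_ne_top (ENNReal.ofReal_ne_top (r := C)) hf) ?_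
  rw [← lintegral_const_mul' _ _ ENNReal.ofReal_ne_top]
  refine lintegral_mono fun x => ?_
  rw [← ENNReal.ofReal_mul hC, ← mul_assoc]
  exact ENNReal.ofReal_le_ofReal (mul_le_mul_of_nonneg_right (hw x) (sq_nonneg _))

/-- Split at `ω = 1`: small energies are handled by `ω⁻¹`, large ones by `(ω + ½m²)²`. -/
theorem PosSymbols.weight_bounds (hs : PosSymbols ω m) (x : M) :
    1 ≤ (ω x)⁻¹ + totalSymbol ω m x ^ 2 ∧ ω x ^ 2 ≤ totalSymbol ω m x ^ 2 ∧
      ω x ≤ (ω x)⁻¹ + totalSymbol ω m x ^ 2 := by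
  have h0 := hs.pos x
  have h1 : ω x ^ 2 ≤ totalSymbol ω m x ^ 2 :=
    pow_le_pow_left₀ h0.le (omega_le_totalSymbol x) 2
  have h2 : 0 < (ω x)⁻¹ := inv_pos.2 h0
  rcases le_total (ω x) 1 with h | h
  · have h3 : 1 ≤ (ω x)⁻¹ := (one_le_inv₀ h0).2 h
    exact ⟨by nlinarith [sq_nonneg (totalSymbol ω m x)], h1,
      by nlinarith [sq_nonneg (totalSymbol ω m x)]⟩
  · exact ⟨by nlinarith, h1, by nlinarith⟩

/-- The extreme case is `(1 + ω)²/ω = ω⁻¹ + 2 + ω`. The exponent `p = 1` is the one needed for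
products of two field operators. -/
theorem InK.kn_ne_top (hs : PosSymbols ω m) {f : M → ℂ} (hf : InK μ ω m f) {p : ℕ} (hp : p ≤ 1) :
    kn μ ω p f ≠ ⊤ := by
  refine hf.lintegral_ne_top (C := 4) (by norm_num) fun x => ?_
  have h0 := hs.pos x
  obtain ⟨h1, h2, h3⟩ := hs.weight_bounds x
  have h4 : (1 + ω x) ^ (p + 1) / ω x ≤ (1 + ω x) ^ 2 / ω x :=
    div_le_div_of_nonneg_right (pow_le_pow_right₀ (by linarith) (by omega)) h0.le
  refine h4.trans ?_
  have h5 : (1 + ω x) ^ 2 / ω x = (ω x)⁻¹ + 2 + ω x := by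
    field_simp
    ring
  have h6 : (ω x)⁻¹ ≤ (ω x)⁻¹ + totalSymbol ω m x ^ 2 := by nlinarith [sq_nonneg (totalSymbol ω m x)]
  rw [h5]
  linarith

theorem InK.exists_mul (hs : PosSymbols ω m) {f : OneBoson μ} (hf : InK μ ω m f) {κ : M → ℝ}
    (hκ : Measurable κ) {C : ℝ} (hC : 0 ≤ C)
    (hw : ∀ x, κ x ^ 2 ≤ C * ((ω x)⁻¹ + totalSymbol ω m x ^ 2)) :
    ∃ g : OneBoson μ, g =ᵐ[μ] fun x => (κ x : ℂ) * f x := by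
  have hm : AEStronglyMeasurable (fun x => (κ x : ℂ) * f x) μ :=
    (measurable_ofReal.comp hκ).aestronglyMeasurable.mul (Lp.aestronglyMeasurable f)
  have h : MemLp (fun x => (κ x : ℂ) * f x) 2 μ := by
    refine memLp_two_of_lintegral hm ?_
    simpa only [norm_mul, mul_pow, norm_real, Real.norm_eq_abs, sq_abs] using
      hf.lintegral_ne_top hC hw
  exact ⟨h.toLp _, h.coeFn_toLp⟩

theorem InK.exists_omega_mul (hs : PosSymbols ω m) {f : OneBoson μ} (hf : InK μ ω m f) :
    ∃ g : OneBoson μ, (g =ᵐ[μ] fun x => (ω x : ℂ) * f x) ∧ kn μ ω 0 g ≠ ⊤ := by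
  obtain ⟨g, hg⟩ := hf.exists_mul hs hs.meas_omega (C := 1) zero_le_one fun x => by
    have := (hs.weight_bounds x).2.1
    have h2 : 0 < (ω x)⁻¹ := inv_pos.2 (hs.pos x)
    linarith
  refine ⟨g, hg, ?_⟩
  have : kn μ ω 0 g = ∫⁻ x, ENNReal.ofReal ((ω x * (1 + ω x)) * ‖f x‖ ^ 2) ∂μ := by
    refine lintegral_congr_ae ?_
    filter_upwards [hg] with x hx
    have h0 := (hs.pos x).ne'
    rw [hx, norm_mul, mul_pow, norm_real, Real.norm_eq_abs, sq_abs]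
    congr 1
    field_simp
    ring
  rw [this]
  refine hf.lintegral_ne_top (C := 2) (by norm_num) fun x => ?_
  obtain ⟨h1, h2, h3⟩ := hs.weight_bounds x
  have h4 : 0 < (ω x)⁻¹ := inv_pos.2 (hs.pos x)
  nlinarith

theorem InK.exists_m_mul (hs : PosSymbols ω m) {f : OneBoson μ} (hf : InK μ ω m f) (l : Fin ν) :
    ∃ g : OneBoson μ, g =ᵐ[μ] fun x => (m l x : ℂ) * f x := by
  refine hf.exists_mul hs (hs.meas_m l) (C := 2) (by norm_num) fun x => ?_
  obtain ⟨h1, -, -⟩ := hs.weight_bounds x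
  have h2 : m l x ^ 2 ≤ ∑ l, m l x ^ 2 :=
    Finset.single_le_sum (f := fun l => m l x ^ 2) (fun _ _ => sq_nonneg _) (Finset.mem_univ l)
  have h3 : m l x ^ 2 ≤ 2 * totalSymbol ω m x := by
    rw [totalSymbol]
    linarith [hs.pos x]
  have h4 : 0 < (ω x)⁻¹ := inv_pos.2 (hs.pos x)
  nlinarith [sq_nonneg (totalSymbol ω m x - 1)]

/-! ### Interaction terms on the domain of `M` -/

variable {ξ : EuclideanSpace ℝ (Fin ν)}

theorem PosSymbols.wsq_pw_ne_top (hs : PosSymbols ω m) {ψ : Fock μ}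
    (hψ : ψ ∈ (opM μ ω m).domain) {p : ℕ} (hp : p ≤ 2) : wsq (pw ω p) ψ ≠ ⊤ :=
  ne_top_of_le_ne_top (hs.wsq_intWeight_ne_top (ξ := 0) hψ)
    (wsq_mono ψ fun n k => hs.pw_le_intWeight 0 hp n k)

theorem PosSymbols.mem_ladder (hs : PosSymbols ω m) {f : OneBoson μ} (hf : InK μ ω m f)
    {ψ : Fock μ} (hψ : ψ ∈ (opM μ ω m).domain) : ψ ∈ ladderDomain f :=
  mem_ladderDomain hs.pos hs.meas_omega (hf.kn_ne_top hs zero_le_one)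
    (hs.wsq_pw_ne_top hψ one_le_two)

theorem PosSymbols.wsq_kin_le (hs : PosSymbols ω m) {ψ : Fock μ}
    (hψ : ψ ∈ (opM μ ω m).domain) (l : Fin ν) :
    wsq (pw ω 1) (ev (kin μ m ξ l) ψ) ≤ wsq (intWeight ω m ξ) ψ := by
  rw [wsq_of_wave_eq (wave_kin ((mem_opM_domain.1 hψ).1 l).1)]
  refine wsq_mono ψ fun n k => ?_
  have hΩ := sym_nonneg hs.pos n k
  have : (ξ l - sym (m l) n k) ^ 2 ≤ symX m ξ n k :=
    Finset.single_le_sum (f := fun l => (ξ l - sym (m l) n k) ^ 2)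
      (fun _ _ => sq_nonneg _) (Finset.mem_univ l)
  rw [norm_real, Real.norm_eq_abs, sq_abs, pw, pow_one, intWeight]
  nlinarith [mul_le_mul_of_nonneg_left this (by linarith : 0 ≤ 1 + sym ω n k)]

theorem PosSymbols.kin_mem_ladder (hs : PosSymbols ω m) {f : OneBoson μ} (hf : InK μ ω m f)
    {ψ : Fock μ} (hψ : ψ ∈ (opM μ ω m).domain) (l : Fin ν) :
    ev (kin μ m ξ l) ψ ∈ ladderDomain f :=
  mem_ladderDomain hs.pos hs.meas_omega (hf.kn_ne_top hs zero_le_one)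
    (ne_top_of_le_ne_top (hs.wsq_intWeight_ne_top hψ) (hs.wsq_kin_le hψ l))

/-- Applying `φ(f)` costs half a power of `1 + Ω`, and `ψ ∈ dom M` has a full power to spend, so a
second field operator can still act. -/
theorem PosSymbols.field_mem_ladder (hs : PosSymbols ω m) {f g : OneBoson μ} (hf : InK μ ω m f)
    (hg : InK μ ω m g) {ψ : Fock μ} (hψ : ψ ∈ (opM μ ω m).domain) :
    ev (field f) ψ ∈ ladderDomain g :=
  mem_ladderDomain hs.pos hs.meas_omega (hg.kn_ne_top hs zero_le_one)
    (ne_top_of_le_ne_top (ENNReal.mul_ne_top (ENNReal.mul_ne_top (by norm_num)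
      (hf.kn_ne_top hs le_rfl)) (hs.wsq_pw_ne_top hψ le_rfl))
      (wsq_field_le hs.pos hs.meas_omega 1 (hs.mem_ladder hf hψ)))

theorem pw_zero_eq : pw ω 0 = fun n (_ : Fin n → M) => (1 : ℝ) := by
  funext n k
  simp [pw]

theorem norm_field_le_wn (hs : PosSymbols ω m) {f : OneBoson μ} (hf : kn μ ω 0 f ≠ ⊤)
    {ψ : Fock μ} (hψ : wsq (pw ω 1) ψ ≠ ⊤) :
    ‖ev (field f) ψ‖ ≤ Real.sqrt (4 * kn μ ω 0 f).toReal * wn (pw ω 1) ψ := by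
  refine norm_le_mul_wn (ENNReal.mul_ne_top (by norm_num) hf) hψ ?_
  have := wsq_field_le hs.pos hs.meas_omega 0 (mem_ladderDomain hs.pos hs.meas_omega hf hψ)
  rwa [pw_zero_eq] at this

theorem wn_mono {w w' : ∀ n, (Fin n → M) → ℝ} {ψ : Fock μ} (h : wsq w ψ ≤ wsq w' ψ)
    (hψ : wsq w' ψ ≠ ⊤) : wn w ψ ≤ wn w' ψ :=
  Real.sqrt_le_sqrt (ENNReal.toReal_mono hψ h)

theorem PosSymbols.norm_field_le (hs : PosSymbols ω m) {f : OneBoson μ} (hf : InK μ ω m f) :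
    ∃ c : ℝ, 0 ≤ c ∧ ∀ ψ ∈ (opM μ ω m).domain, ‖ev (field f) ψ‖ ≤ c * wn (pw ω 1) ψ :=
  ⟨_, Real.sqrt_nonneg _, fun _ hψ =>
    norm_field_le_wn hs (hf.kn_ne_top hs zero_le_one) (hs.wsq_pw_ne_top hψ one_le_two)⟩

theorem PosSymbols.wn_pw_le (hs : PosSymbols ω m) (ξ : EuclideanSpace ℝ (Fin ν)) {ψ : Fock μ}
    (hψ : ψ ∈ (opM μ ω m).domain) : wn (pw ω 1) ψ ≤ wn (intWeight ω m ξ) ψ :=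
  wn_mono (wsq_mono ψ fun n k => hs.pw_le_intWeight ξ one_le_two n k)
    (hs.wsq_intWeight_ne_top hψ)

theorem PosSymbols.norm_field_kin_le (hs : PosSymbols ω m) {f : OneBoson μ} (hf : InK μ ω m f)
    (ξ : EuclideanSpace ℝ (Fin ν)) (l : Fin ν) :
    ∃ c : ℝ, 0 ≤ c ∧ ∀ ψ ∈ (opM μ ω m).domain,
      ‖ev (field f) (ev (kin μ m ξ l) ψ)‖ ≤ c * wn (intWeight ω m ξ) ψ := by
  refine ⟨Real.sqrt (4 * kn μ ω 0 f).toReal, Real.sqrt_nonneg _, fun ψ hψ => ?_⟩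
  have h1 := hs.wsq_kin_le (ξ := ξ) hψ l
  have h2 := hs.wsq_intWeight_ne_top (ξ := ξ) hψ
  refine (norm_field_le_wn hs (hf.kn_ne_top hs zero_le_one) (ne_top_of_le_ne_top h2 h1)).trans ?_
  refine mul_le_mul_of_nonneg_left ?_ (Real.sqrt_nonneg _)
  exact Real.sqrt_le_sqrt (ENNReal.toReal_mono h2 h1)

theorem PosSymbols.norm_field_field_le (hs : PosSymbols ω m) {f g : OneBoson μ}
    (hf : InK μ ω m f) (hg : InK μ ω m g) (ξ : EuclideanSpace ℝ (Fin ν)) :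
    ∃ c : ℝ, 0 ≤ c ∧ ∀ ψ ∈ (opM μ ω m).domain,
      ‖ev (field g) (ev (field f) ψ)‖ ≤ c * wn (intWeight ω m ξ) ψ := by
  refine ⟨Real.sqrt ((4 * kn μ ω 0 g) * (4 * kn μ ω 1 f)).toReal, Real.sqrt_nonneg _,
    fun ψ hψ => ?_⟩
  have h2 := hs.wsq_intWeight_ne_top (ξ := ξ) hψ
  have h3 : wsq (pw ω 2) ψ ≤ wsq (intWeight ω m ξ) ψ :=
    wsq_mono ψ fun n k => hs.pw_le_intWeight ξ le_rfl n k
  refine norm_le_mul_wn (ENNReal.mul_ne_top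
    (ENNReal.mul_ne_top (by norm_num) (hg.kn_ne_top hs zero_le_one))
    (ENNReal.mul_ne_top (by norm_num) (hf.kn_ne_top hs le_rfl))) h2 ?_
  have h4 := wsq_field_le hs.pos hs.meas_omega 0 (hs.field_mem_ladder hf hg hψ)
  have h5 := wsq_field_le hs.pos hs.meas_omega 1 (hs.mem_ladder hf hψ)
  rw [pw_zero_eq] at h4
  refine h4.trans ?_
  rw [mul_assoc (4 * kn μ ω 0 g)]
  exact mul_le_mul_right (h5.trans (mul_le_mul_right h3 _)) _

/-! ### The kinetic part of the Hamiltonian -/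

theorem mem_domain_add {E : Type*} [AddCommGroup E] [Module ℂ E] {S T : E →ₗ.[ℂ] E} {x : E}
    (hS : x ∈ S.domain) (hT : x ∈ T.domain) : x ∈ (S + T).domain := ⟨hS, hT⟩

theorem mem_domain_sub {E : Type*} [AddCommGroup E] [Module ℂ E] {S T : E →ₗ.[ℂ] E} {x : E}
    (hS : x ∈ S.domain) (hT : x ∈ T.domain) : x ∈ (S - T).domain := ⟨hS, hT⟩

variable (m) in
/-- The operator `½ (ξ - dΓ(m))² - φ(g)·(ξ - dΓ(m)) + ½ φ(g)² - (i/2) φ(h)`. -/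
def hKin (g : Fin ν → OneBoson μ) (h : OneBoson μ) (ξ : EuclideanSpace ℝ (Fin ν)) :
    Fock μ →ₗ.[ℂ] Fock μ :=
  (1 / 2 : ℂ) • opDot (kin μ m ξ) (kin μ m ξ) - opDot (fun l => field (g l)) (kin μ m ξ)
    + (1 / 2 : ℂ) • opDot (fun l => field (g l)) (fun l => field (g l)) - (I / 2) • field h

variable {g : Fin ν → OneBoson μ} {h : OneBoson μ}

theorem PosSymbols.kinkin_mem {ψ : Fock μ} (hψ : ψ ∈ (opM μ ω m).domain) :
    ψ ∈ (opDot (kin μ m ξ) (kin μ m ξ)).domain :=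
  mem_domain_opDot.2 fun l => kin_kin_mem_iff.2 ((mem_opM_domain.1 hψ).1 l)

theorem PosSymbols.fieldkin_mem (hs : PosSymbols ω m) (hg : ∀ l, InK μ ω m (g l)) {ψ : Fock μ}
    (hψ : ψ ∈ (opM μ ω m).domain) :
    ∀ l, ψ ∈ (kin μ m ξ l).domain ∧ ev (kin μ m ξ l) ψ ∈ (field (g l)).domain := fun l =>
  ⟨mem_domain_kin.2 ((mem_opM_domain.1 hψ).1 l).1,
    ladderDomain_le_field _ (hs.kin_mem_ladder (hg l) hψ l)⟩

theorem PosSymbols.fieldfield_mem (hs : PosSymbols ω m) (hg : ∀ l, InK μ ω m (g l)) {ψ : Fock μ}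
    (hψ : ψ ∈ (opM μ ω m).domain) :
    ∀ l, ψ ∈ (field (g l)).domain ∧ ev (field (g l)) ψ ∈ (field (g l)).domain := fun l =>
  ⟨ladderDomain_le_field _ (hs.mem_ladder (hg l) hψ),
    ladderDomain_le_field _ (hs.field_mem_ladder (hg l) (hg l) hψ)⟩

theorem PosSymbols.hKin_mem (hs : PosSymbols ω m) (hg : ∀ l, InK μ ω m (g l))
    (hh : InK μ ω m h) {ψ : Fock μ} (hψ : ψ ∈ (opM μ ω m).domain) :
    ψ ∈ (hKin m g h ξ).domain :=
  ⟨⟨⟨kinkin_mem hψ, mem_domain_opDot.2 (hs.fieldkin_mem hg hψ)⟩,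
    mem_domain_opDot.2 (hs.fieldfield_mem hg hψ)⟩, ladderDomain_le_field _ (hs.mem_ladder hh hψ)⟩

theorem PosSymbols.ev_hKin (hs : PosSymbols ω m) (hg : ∀ l, InK μ ω m (g l))
    (hh : InK μ ω m h) {ψ : Fock μ} (hψ : ψ ∈ (opM μ ω m).domain) :
    ev (hKin m g h ξ) ψ = (1 / 2 : ℂ) • ∑ l, ev (kin μ m ξ l) (ev (kin μ m ξ l) ψ)
      - ∑ l, ev (field (g l)) (ev (kin μ m ξ l) ψ)
      + (1 / 2 : ℂ) • ∑ l, ev (field (g l)) (ev (field (g l)) ψ) - (I / 2) • ev (field h) ψ := by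
  have h1 : ∀ l, ψ ∈ (kin μ m ξ l).domain ∧ ev (kin μ m ξ l) ψ ∈ (kin μ m ξ l).domain :=
    fun l => kin_kin_mem_iff.2 ((mem_opM_domain.1 hψ).1 l)
  have h2 := hs.fieldkin_mem (ξ := ξ) hg hψ
  have h3 := hs.fieldfield_mem hg hψ
  have h4 := ladderDomain_le_field _ (hs.mem_ladder hh hψ)
  have m1 : ψ ∈ ((1 / 2 : ℂ) • opDot (kin μ m ξ) (kin μ m ξ)).domain := mem_domain_opDot.2 h1
  have m2 : ψ ∈ (opDot (fun l => field (g l)) (kin μ m ξ)).domain := mem_domain_opDot.2 h2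
  have m3 : ψ ∈ ((1 / 2 : ℂ) • opDot (fun l => field (g l)) (fun l => field (g l))).domain :=
    mem_domain_opDot.2 h3
  have m4 : ψ ∈ ((I / 2) • field h).domain := h4
  rw [hKin, ev_sub _ _ (mem_domain_add (mem_domain_sub m1 m2) m3) m4,
    ev_add _ _ (mem_domain_sub m1 m2) m3, ev_sub _ _ m1 m2,
    ev_smul _ _ (mem_domain_opDot.2 h1), ev_smul _ _ (mem_domain_opDot.2 h3), ev_smul _ _ h4,
    ev_opDot h1, ev_opDot h2, ev_opDot h3]

/-- The interaction terms are controlled by the weight `(1 + ω)|ξ - m|² + (1 + ω)²`. -/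
theorem PosSymbols.norm_hKin_sub_le (hs : PosSymbols ω m) (hg : ∀ l, InK μ ω m (g l))
    (hh : InK μ ω m h) (ξ : EuclideanSpace ℝ (Fin ν)) :
    ∃ c : ℝ, 0 ≤ c ∧ ∀ ψ ∈ (opM μ ω m).domain,
      ‖ev (hKin m g h ξ) ψ - (1 / 2 : ℂ) • ∑ l, ev (kin μ m ξ l) (ev (kin μ m ξ l) ψ)‖ ≤
        c * wn (intWeight ω m ξ) ψ := by
  choose c1 hc1 h1 using fun l => hs.norm_field_kin_le (hg l) ξ l
  choose c2 hc2 h2 using fun l => hs.norm_field_field_le (hg l) (hg l) ξ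
  obtain ⟨c3, hc3, h3⟩ := hs.norm_field_le hh
  refine ⟨∑ l, c1 l + ∑ l, c2 l + c3, ?_, fun ψ hψ => ?_⟩
  · have := Finset.sum_nonneg fun l (_ : l ∈ Finset.univ) => hc1 l
    have := Finset.sum_nonneg fun l (_ : l ∈ Finset.univ) => hc2 l
    positivity
  have hw := wn_nonneg (intWeight ω m ξ) ψ
  have e1 : ‖∑ l, ev (field (g l)) (ev (kin μ m ξ l) ψ)‖ ≤
      (∑ l, c1 l) * wn (intWeight ω m ξ) ψ := by
    rw [Finset.sum_mul]
    exact norm_sum_le_of_le _ fun l _ => h1 l ψ hψ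
  have e2 : ‖(1 / 2 : ℂ) • ∑ l, ev (field (g l)) (ev (field (g l)) ψ)‖ ≤
      (∑ l, c2 l) * wn (intWeight ω m ξ) ψ := by
    have e : ‖∑ l, ev (field (g l)) (ev (field (g l)) ψ)‖ ≤
        (∑ l, c2 l) * wn (intWeight ω m ξ) ψ := by
      rw [Finset.sum_mul]
      exact norm_sum_le_of_le _ fun l _ => h2 l ψ hψ
    rw [norm_smul]
    have : ‖(1 / 2 : ℂ)‖ ≤ 1 := by norm_num
    exact (mul_le_of_le_one_left (norm_nonneg _) this).trans e
  have e3 : ‖(I / 2) • ev (field h) ψ‖ ≤ c3 * wn (intWeight ω m ξ) ψ := by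
    rw [norm_smul]
    have : ‖(I / 2 : ℂ)‖ ≤ 1 := by
      rw [norm_div, norm_I]
      norm_num
    exact (mul_le_of_le_one_left (norm_nonneg _) this).trans ((h3 ψ hψ).trans
      (mul_le_mul_of_nonneg_left (hs.wn_pw_le ξ hψ) hc3))
  rw [hs.ev_hKin hg hh hψ]
  have : ∀ A B C D : Fock μ, A - B + C - D - A = -B + C - D := fun A B C D => by abel
  rw [this]
  refine (norm_sub_le _ _).trans ?_
  have e4 := norm_add_le (-∑ l, ev (field (g l)) (ev (kin μ m ξ l) ψ))
    ((1 / 2 : ℂ) • ∑ l, ev (field (g l)) (ev (field (g l)) ψ))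
  rw [norm_neg] at e4
  linarith

end Interaction

end FiberHam

end
-- Completing the square, and a lower bound from commutators
noncomputable section

namespace FiberHam

section Commutator

variable {M : Type*} [MeasurableSpace M] {μ : Measure M} [SigmaFinite μ] {ν : ℕ}
  {ω : M → ℝ} {m : Fin ν → M → ℝ}

open scoped ENNReal

/-! ### Vectors of bounded particle number and bounded energy -/

/-- Vectors supported where the particle number and the symbols `ω`, `m` are bounded. -/
def IsCpt (ω : M → ℝ) (m : Fin ν → M → ℝ) (ψ : Fock μ) : Prop :=
  ∃ R : ℝ, ∀ n, ∀ᵐ k ∂prodMeas μ n, ψ.wave n k ≠ 0 →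
    (n : ℝ) ≤ R ∧ sym ω n k ≤ R ∧ ∀ l, |sym (m l) n k| ≤ R

theorem IsCpt.of_wave_eq {ψ η : Fock μ} (hψ : IsCpt ω m ψ) {g : ∀ n, (Fin n → M) → ℂ}
    (h : ∀ n, η.wave n =ᵐ[prodMeas μ n] fun k => g n k * ψ.wave n k) : IsCpt ω m η := by
  obtain ⟨R, hR⟩ := hψ
  refine ⟨R, fun n => ?_⟩
  filter_upwards [hR n, h n] with k h1 h2 h3
  rw [h2] at h3
  exact h1 (right_ne_zero_of_mul h3)

theorem IsCpt.add {ψ η : Fock μ} (hψ : IsCpt ω m ψ) (hη : IsCpt ω m η) : IsCpt ω m (ψ + η) := by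
  obtain ⟨R, hR⟩ := hψ
  obtain ⟨R', hR'⟩ := hη
  refine ⟨max R R', fun n => ?_⟩
  filter_upwards [hR n, hR' n, wave_add ψ η n] with k h1 h2 h3 h4
  rw [h3] at h4
  by_cases h : ψ.wave n k = 0
  · obtain ⟨a, b, c⟩ := h2 (by simpa [h] using h4)
    exact ⟨a.trans (le_max_right _ _), b.trans (le_max_right _ _),
      fun l => (c l).trans (le_max_right _ _)⟩
  · obtain ⟨a, b, c⟩ := h1 h
    exact ⟨a.trans (le_max_left _ _), b.trans (le_max_left _ _),
      fun l => (c l).trans (le_max_left _ _)⟩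

theorem IsCpt.wsq_ne_top {ψ : Fock μ} (hψ : IsCpt ω m ψ) {w : ∀ n, (Fin n → M) → ℝ}
    (hw : ∀ R : ℝ, ∃ B : ℝ, ∀ n (k : Fin n → M), (n : ℝ) ≤ R → sym ω n k ≤ R →
      (∀ l, |sym (m l) n k| ≤ R) → w n k ≤ B) : wsq w ψ ≠ ⊤ := by
  obtain ⟨R, hR⟩ := hψ
  obtain ⟨B, hB⟩ := hw R
  have h1 : wsq (fun _ _ => |B| * 1) ψ ≠ ⊤ := by
    rw [wsq_const_mul (fun _ _ => 1) ψ (abs_nonneg B), ← ofReal_norm_sq]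
    exact ENNReal.mul_ne_top ENNReal.ofReal_ne_top ENNReal.ofReal_ne_top
  refine ne_top_of_le_ne_top h1 (ENNReal.tsum_le_tsum fun n => lintegral_mono_ae ?_)
  filter_upwards [hR n] with k hk
  refine ENNReal.ofReal_le_ofReal ?_
  by_cases h : ψ.wave n k = 0
  · simp [h]
  · obtain ⟨a, b, c⟩ := hk h
    exact mul_le_mul_of_nonneg_right (by rw [mul_one]; exact (hB n k a b c).trans (le_abs_self B))
      (sq_nonneg _)

theorem IsCpt.wsq_number_ne_top {ψ : Fock μ} (hψ : IsCpt ω m ψ) (p : ℕ) :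
    wsq (pw (fun _ : M => 1) p) ψ ≠ ⊤ := by
  refine hψ.wsq_ne_top fun R => ⟨(1 + R) ^ p, fun n k h1 _ _ => ?_⟩
  have : sym (fun _ : M => (1 : ℝ)) n k = n := by simp [sym]
  rw [pw, this]
  exact pow_le_pow_left₀ (by positivity) (by linarith) p

theorem IsCpt.mem_opM (hs : PosSymbols ω m) {ψ : Fock μ} (hψ : IsCpt ω m ψ) :
    ψ ∈ (opM μ ω m).domain := by
  rw [hs.mem_opM_domain_iff]
  refine hψ.wsq_ne_top fun R => ⟨(1 / 2 * ∑ _l : Fin ν, R ^ 2 + 1 * R) ^ 2, fun n k _ h2 h3 => ?_⟩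
  have hΩ := sym_nonneg hs.pos n k
  have hX := symX_nonneg m 0 n k
  have h4 : symX m 0 n k ≤ ∑ _l : Fin ν, R ^ 2 := by
    refine Finset.sum_le_sum fun l _ => ?_
    have h5 : ((0 : EuclideanSpace ℝ (Fin ν)) l - sym (m l) n k) ^ 2 = |sym (m l) n k| ^ 2 := by
      simp
    rw [h5]
    exact pow_le_pow_left₀ (abs_nonneg _) (h3 l) 2
  refine pow_le_pow_left₀ (by rw [symMa]; positivity) ?_ 2
  rw [symMa]
  gcongr

theorem IsCpt.dGamma_omega (hs : PosSymbols ω m) {ψ : Fock μ} (hψ : IsCpt ω m ψ) :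
    IsCpt ω m (ev (dGamma μ ω) ψ) :=
  hψ.of_wave_eq (wave_dGamma (mem_opM_domain.1 (hψ.mem_opM hs)).2)

theorem IsCpt.kin_apply (hs : PosSymbols ω m) {ψ : Fock μ} (hψ : IsCpt ω m ψ)
    (ξ : EuclideanSpace ℝ (Fin ν)) (l : Fin ν) : IsCpt ω m (ev (kin μ m ξ l) ψ) :=
  hψ.of_wave_eq (wave_kin ((mem_opM_domain.1 (hψ.mem_opM hs)).1 l).1)

theorem IsCpt.dGamma_m (hs : PosSymbols ω m) {ψ : Fock μ} (hψ : IsCpt ω m ψ)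
    (l : Fin ν) : IsCpt ω m (ev (dGamma μ (m l)) ψ) :=
  hψ.of_wave_eq (wave_dGamma ((mem_opM_domain.1 (hψ.mem_opM hs)).1 l).1)

/-- Taking `ω ≡ 1` turns the weight into `1 + N`, with `N` the particle number, and every `f ∈ L²`
becomes admissible. This is needed for `m_l G_l`, which is known to lie in `L²` but need not satisfy
the `ω⁻¹`-weighted condition. -/
theorem kn_number_ne_top (p : ℕ) (f : OneBoson μ) : kn μ (fun _ : M => 1) p f ≠ ⊤ := by
  have h : kn μ (fun _ : M => 1) p f =
      ENNReal.ofReal ((1 + 1) ^ (p + 1) / 1) * ∫⁻ x, ENNReal.ofReal (‖f x‖ ^ 2) ∂μ := by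
    rw [kn, ← lintegral_const_mul' _ _ ENNReal.ofReal_ne_top]
    exact lintegral_congr fun x => ENNReal.ofReal_mul (by positivity)
  rw [h, ← ofReal_norm_sq_Lp]
  exact ENNReal.mul_ne_top ENNReal.ofReal_ne_top ENNReal.ofReal_ne_top

theorem mem_ladderDomain_of_number {ψ : Fock μ} (hψ : wsq (pw (fun _ : M => 1) 1) ψ ≠ ⊤)
    (f : OneBoson μ) : ψ ∈ ladderDomain f :=
  mem_ladderDomain (fun _ => zero_lt_one) measurable_const (kn_number_ne_top 0 f) hψ

theorem IsCpt.mem_ladder {ψ : Fock μ} (hψ : IsCpt ω m ψ) (f : OneBoson μ) : ψ ∈ ladderDomain f :=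
  mem_ladderDomain_of_number (hψ.wsq_number_ne_top 1) f

theorem IsCpt.field_mem_ladder {ψ : Fock μ} (hψ : IsCpt ω m ψ) (f g : OneBoson μ) :
    ev (field f) ψ ∈ ladderDomain g :=
  mem_ladderDomain_of_number (ne_top_of_le_ne_top (ENNReal.mul_ne_top
    (ENNReal.mul_ne_top (by norm_num) (kn_number_ne_top 1 f)) (hψ.wsq_number_ne_top 2))
    (wsq_field_le (fun _ => zero_lt_one) measurable_const 1 (hψ.mem_ladder f))) g

/-! ### Commutators of field operators with second quantizations -/

/-- The operator `a†(f) - a(f)`. -/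
def antiField (f : OneBoson μ) (ψ : Fock μ) : Fock μ := ev (creation f) ψ - ev (annihilation f) ψ

theorem mem_graph_dGamma_field {κ : M → ℝ} {f g : OneBoson μ}
    (hg : g =ᵐ[μ] fun x => (κ x : ℂ) * f x) {ψ : Fock μ} (h1 : ψ ∈ (dGamma μ κ).domain)
    (h2 : ψ ∈ ladderDomain f) (h3 : ev (dGamma μ κ) ψ ∈ ladderDomain f)
    (h4 : ψ ∈ ladderDomain g) :
    (ev (field f) ψ, ev (field f) (ev (dGamma μ κ) ψ) + antiField g ψ) ∈ (dGamma μ κ).graph := by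
  have := Submodule.add_mem _ (mem_graph_dGamma_creation hg h1 h2.1 h3.1 h4.1)
    (mem_graph_dGamma_annihilation hg h1 h2.2 h3.2 h4.2)
  rw [Prod.mk_add_mk] at this
  rw [ev_field h2, ev_field h3, antiField]
  convert this using 2
  abel

/-- Applied to `i m · G`, this identifies `-(i/2) φ(i m · G)` with `½ ∑ (a†(m_l G_l) - a(m_l G_l))`,
half the sum of the commutators of `dΓ(m_l)` with `φ(G_l)`. -/
theorem ev_field_of_ae_eq {g : Fin ν → OneBoson μ} {h : OneBoson μ}
    (hh : h =ᵐ[μ] fun x => I * ∑ i, g i x) {ψ : Fock μ} (hψ : ∀ f : OneBoson μ, ψ ∈ ladderDomain f) :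
    ev (field h) ψ = I • ∑ i, antiField (g i) ψ := by
  rw [ev_field (hψ h), ev_eq_of_mem_graph (mem_graph_creation_sum I hh fun i => (hψ (g i)).1),
    ev_eq_of_mem_graph (mem_graph_annihilation_sum I hh fun i => (hψ (g i)).2), conj_I]
  simp only [antiField, Finset.sum_sub_distrib, smul_sub, neg_smul]
  abel

theorem norm_antiField_le (hs : PosSymbols ω m) {f : OneBoson μ} (hf : kn μ ω 0 f ≠ ⊤)
    {ψ : Fock μ} (hψ : wsq (pw ω 1) ψ ≠ ⊤) :
    ‖antiField f ψ‖ ≤ 2 * Real.sqrt (kn μ ω 0 f).toReal * wn (pw ω 1) ψ := by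
  have hl := mem_ladderDomain hs.pos hs.meas_omega hf hψ
  have h1 : ‖ev (creation f) ψ‖ ≤ Real.sqrt (kn μ ω 0 f).toReal * wn (pw ω 1) ψ := by
    refine norm_le_mul_wn hf hψ ?_
    have := wsq_creation_le hs.pos hs.meas_omega 0 hl.1
    rwa [pw_zero_eq] at this
  have h2 : ‖ev (annihilation f) ψ‖ ≤ Real.sqrt (kn μ ω 0 f).toReal * wn (pw ω 1) ψ := by
    refine norm_le_mul_wn hf hψ ?_
    have := wsq_annihilation_le hs.pos hs.meas_omega 0 hl.2
    rwa [pw_zero_eq] at this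
  have := norm_sub_le (ev (creation f) ψ) (ev (annihilation f) ψ)
  rw [antiField]
  linarith

/-! ### The velocity operators -/

variable (m) in
/-- The velocity operator `ξ - dΓ(mₗ) - φ(gₗ)`. -/
def vel (g : Fin ν → OneBoson μ) (ξ : EuclideanSpace ℝ (Fin ν)) (l : Fin ν) (ψ : Fock μ) :
    Fock μ :=
  ev (kin μ m ξ l) ψ - ev (field (g l)) ψ

variable {g : Fin ν → OneBoson μ} {h : OneBoson μ} {ξ : EuclideanSpace ℝ (Fin ν)}

theorem inner_vel {l : Fin ν} {φ ψ : Fock μ} (h1 : φ ∈ (dGamma μ (m l)).domain)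
    (h2 : φ ∈ ladderDomain (g l)) (h3 : ψ ∈ (dGamma μ (m l)).domain)
    (h4 : ψ ∈ ladderDomain (g l)) :
    inner ℂ (vel m g ξ l φ) ψ = inner ℂ φ (vel m g ξ l ψ) := by
  rw [vel, vel, ev_kin h1, ev_kin h3]
  simp only [inner_sub_left, inner_sub_right, inner_smul_left, inner_smul_right, conj_ofReal,
    inner_dGamma h1 h3, inner_field h2 h4]

theorem IsCpt.field_m (hs : PosSymbols ω m) (hg : ∀ l, InK μ ω m (g l)) {gm : Fin ν → OneBoson μ}
    (hgm : ∀ l, gm l =ᵐ[μ] fun x => (m l x : ℂ) * g l x) {ψ : Fock μ} (hψ : IsCpt ω m ψ)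
    (l : Fin ν) :
    (ev (field (g l)) ψ, ev (field (g l)) (ev (dGamma μ (m l)) ψ) + antiField (gm l) ψ) ∈
      (dGamma μ (m l)).graph :=
  mem_graph_dGamma_field (hgm l) ((mem_opM_domain.1 (hψ.mem_opM hs)).1 l).1 (hψ.mem_ladder _)
    ((hψ.dGamma_m hs l).mem_ladder _) (hψ.mem_ladder _)

/-- The field can create particles at unbounded energy, so `v_l ψ` may leave the class `IsCpt`; only
what a second application of `v_l` requires is recorded. -/
theorem IsCpt.vel_mem (hs : PosSymbols ω m) (hg : ∀ l, InK μ ω m (g l)) {ψ : Fock μ}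
    (hψ : IsCpt ω m ψ) (l : Fin ν) :
    vel m g ξ l ψ ∈ (dGamma μ (m l)).domain ∧ ∀ f : OneBoson μ, vel m g ξ l ψ ∈ ladderDomain f := by
  choose gm hgm using fun l => (hg l).exists_m_mul hs l
  refine ⟨Submodule.sub_mem _ ?_ ?_, fun f => Submodule.sub_mem _ ?_ ?_⟩
  · exact ((mem_opM_domain.1 ((hψ.kin_apply hs ξ l).mem_opM hs)).1 l).1
  · exact LinearPMap.mem_domain_of_mem_graph (hψ.field_m hs hg hgm l)
  · exact (hψ.kin_apply hs ξ l).mem_ladder f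
  · exact hψ.field_mem_ladder _ _

/-- Completion of the square. In `(kin - φ)²` the product `kin φ` is reordered to `φ kin`; the
resulting commutators `a†(m_l g_l) - a(m_l g_l)` sum to the term linear in `h = i m · g`. Symmetry
and positivity are both read off from this form. -/
theorem IsCpt.hKin_eq (hs : PosSymbols ω m) (hg : ∀ l, InK μ ω m (g l)) (hh : InK μ ω m h)
    (hhe : h =ᵐ[μ] imDot m g) {ψ : Fock μ} (hψ : IsCpt ω m ψ) :
    ev (hKin m g h ξ) ψ = (1 / 2 : ℂ) • ∑ l, vel m g ξ l (vel m g ξ l ψ) := by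
  choose gm hgm using fun l => (hg l).exists_m_mul hs l
  have hψM := hψ.mem_opM hs
  have hhe' : h =ᵐ[μ] fun x => I * ∑ i, gm i x := by
    filter_upwards [hhe, ae_all_iff.2 hgm] with x h1 h2
    rw [h1, imDot]
    simp only [h2]
  have e1 : ∀ l, vel m g ξ l (vel m g ξ l ψ) =
      ev (kin μ m ξ l) (ev (kin μ m ξ l) ψ) - (2 : ℂ) • ev (field (g l)) (ev (kin μ m ξ l) ψ) +
        ev (field (g l)) (ev (field (g l)) ψ) + antiField (gm l) ψ := by
    intro l
    have d1 : ψ ∈ (dGamma μ (m l)).domain := ((mem_opM_domain.1 hψM).1 l).1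
    have d2 : ev (kin μ m ξ l) ψ ∈ (dGamma μ (m l)).domain :=
      ((mem_opM_domain.1 ((hψ.kin_apply hs ξ l).mem_opM hs)).1 l).1
    have gr := hψ.field_m hs hg hgm l
    have d3 : ev (field (g l)) ψ ∈ (dGamma μ (m l)).domain :=
      LinearPMap.mem_domain_of_mem_graph gr
    have f1 : ev (kin μ m ξ l) ψ ∈ (field (g l)).domain :=
      ladderDomain_le_field _ ((hψ.kin_apply hs ξ l).mem_ladder _)
    have f2 : ev (field (g l)) ψ ∈ (field (g l)).domain :=
      ladderDomain_le_field _ (hψ.field_mem_ladder _ _)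
    have f3 : ψ ∈ (field (g l)).domain := ladderDomain_le_field _ (hψ.mem_ladder _)
    have f4 : ev (dGamma μ (m l)) ψ ∈ (field (g l)).domain :=
      ladderDomain_le_field _ ((hψ.dGamma_m hs l).mem_ladder _)
    have k1 : ev (kin μ m ξ l) (ev (field (g l)) ψ) =
        ev (field (g l)) (ev (kin μ m ξ l) ψ) - antiField (gm l) ψ := by
      rw [ev_kin d3, ev_eq_of_mem_graph gr, ev_kin d1,
        ev_map_sub _ (Submodule.smul_mem _ _ f3) f4, ev_map_smul _ _ f3]
      abel
    rw [vel, vel, ev_map_sub _ (mem_domain_kin.2 d2) (mem_domain_kin.2 d3), ev_map_sub _ f1 f2, k1,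
      two_smul]
    abel
  rw [hs.ev_hKin hg hh hψM]
  simp only [e1, Finset.sum_add_distrib, Finset.sum_sub_distrib, ← Finset.smul_sum]
  rw [ev_field_of_ae_eq hhe' hψ.mem_ladder, smul_smul]
  have hI : I / 2 * I = -(1 / 2) := by
    rw [div_mul_eq_mul_div, I_mul_I]
    ring
  rw [hI, smul_add, smul_add, smul_sub, smul_smul]
  norm_num

theorem IsCpt.inner_hKin (hs : PosSymbols ω m) (hg : ∀ l, InK μ ω m (g l)) (hh : InK μ ω m h)
    (hhe : h =ᵐ[μ] imDot m g) {φ ψ : Fock μ} (hφ : IsCpt ω m φ) (hψ : IsCpt ω m ψ) :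
    inner ℂ (ev (hKin m g h ξ) φ) ψ = inner ℂ φ (ev (hKin m g h ξ) ψ) := by
  rw [hφ.hKin_eq hs hg hh hhe, hψ.hKin_eq hs hg hh hhe, inner_smul_left, inner_smul_right,
    sum_inner, inner_sum]
  have : (starRingEnd ℂ) (1 / 2 : ℂ) = 1 / 2 := by
    rw [show (1 / 2 : ℂ) = ((1 / 2 : ℝ) : ℂ) by norm_num, conj_ofReal]
  rw [this]
  congr 1
  refine Finset.sum_congr rfl fun l _ => ?_
  have a1 := hφ.vel_mem (ξ := ξ) hs hg l
  have a2 := hψ.vel_mem (ξ := ξ) hs hg l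
  rw [inner_vel a1.1 (a1.2 _) ((mem_opM_domain.1 (hψ.mem_opM hs)).1 l).1 (hψ.mem_ladder _),
    inner_vel ((mem_opM_domain.1 (hφ.mem_opM hs)).1 l).1 (hφ.mem_ladder _) a2.1 (a2.2 _)]

/-- `dΓ(m_l)` and `dΓ(ω)` commute, so only the field part of `v_l` contributes to the commutator
with `Ω`. -/
theorem IsCpt.vel_omega (hs : PosSymbols ω m) {l : Fin ν} {go : OneBoson μ}
    (hgo : go =ᵐ[μ] fun x => (ω x : ℂ) * g l x) {ψ : Fock μ} (hψ : IsCpt ω m ψ) :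
    vel m g ξ l ψ ∈ (dGamma μ ω).domain ∧
      vel m g ξ l (ev (dGamma μ ω) ψ) = ev (dGamma μ ω) (vel m g ξ l ψ) + antiField go ψ := by
  have hψM := hψ.mem_opM hs
  have d1 : ψ ∈ (dGamma μ ω).domain := (mem_opM_domain.1 hψM).2
  have d2 : ev (kin μ m ξ l) ψ ∈ (dGamma μ ω).domain :=
    (mem_opM_domain.1 ((hψ.kin_apply hs ξ l).mem_opM hs)).2
  have gr := mem_graph_dGamma_field hgo d1 (hψ.mem_ladder _)
    ((hψ.dGamma_omega hs).mem_ladder _) (hψ.mem_ladder _)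
  have d3 : ev (field (g l)) ψ ∈ (dGamma μ ω).domain := LinearPMap.mem_domain_of_mem_graph gr
  refine ⟨Submodule.sub_mem _ d2 d3, ?_⟩
  have k1 : ev (kin μ m ξ l) (ev (dGamma μ ω) ψ) = ev (dGamma μ ω) (ev (kin μ m ξ l) ψ) := by
    refine wave_ext fun n => ?_
    have d4 := ((mem_opM_domain.1 ((hψ.dGamma_omega hs).mem_opM hs)).1 l).1
    filter_upwards [wave_kin (ξ := ξ) d4 n, wave_dGamma d1 n, wave_dGamma d2 n,
      wave_kin (ξ := ξ) ((mem_opM_domain.1 hψM).1 l).1 n] with k h1 h2 h3 h4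
    rw [h1, h2, h3, h4]
    ring
  rw [vel, vel, ev_map_sub _ d2 d3, ev_eq_of_mem_graph gr, k1]
  abel

/-- A lower bound on `Re ⟨H₀ ψ, (1 + dΓ(ω))ψ⟩` on the core. -/
theorem IsCpt.re_inner_hKin_ge (hs : PosSymbols ω m) (hg : ∀ l, InK μ ω m (g l))
    (hh : InK μ ω m h) (hhe : h =ᵐ[μ] imDot m g) (ξ : EuclideanSpace ℝ (Fin ν)) :
    ∃ C : ℝ, 0 ≤ C ∧ ∀ ψ : Fock μ, IsCpt ω m ψ →
      -(C * wn (pw ω 1) ψ ^ 2) ≤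
        (inner ℂ (ev (hKin m g h ξ) ψ) (ψ + ev (dGamma μ ω) ψ)).re := by
  choose go hgo hkn using fun l => (hg l).exists_omega_mul hs
  set c : Fin ν → ℝ := fun l => 2 * Real.sqrt (kn μ ω 0 (go l)).toReal with hc
  refine ⟨1 / 2 * ∑ l, c l ^ 2, by positivity, fun ψ hψ => ?_⟩
  have hψM := hψ.mem_opM hs
  have hψΩ := hψ.dGamma_omega hs
  have hT := hψ.add hψΩ
  have hl : ∀ l, -(c l ^ 2 * wn (pw ω 1) ψ ^ 2) ≤
      (inner ℂ (vel m g ξ l (vel m g ξ l ψ)) (ψ + ev (dGamma μ ω) ψ)).re := by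
    intro l
    have a1 := hψ.vel_mem (ξ := ξ) hs hg l
    obtain ⟨b1, b2⟩ := hψ.vel_omega (ξ := ξ) hs (hgo l)
    -- After moving one `v_l` to the right, `⟨v_l ψ, v_l (1 + Ω)ψ⟩` equals `‖v_l ψ‖² + ⟨v_l ψ, Ω v_l
    -- ψ⟩` plus the pairing of `v_l ψ` with the commutator. The first two terms are nonnegative, and
    -- the last is absorbed by `‖v_l ψ‖²`.
    rw [inner_vel a1.1 (a1.2 _) ((mem_opM_domain.1 (hT.mem_opM hs)).1 l).1 (hT.mem_ladder _)]
    have e1 : vel m g ξ l (ψ + ev (dGamma μ ω) ψ) =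
        vel m g ξ l ψ + vel m g ξ l (ev (dGamma μ ω) ψ) := by
      rw [vel, vel, vel, ev_map_add _ (mem_domain_kin.2 ((mem_opM_domain.1 hψM).1 l).1)
        (mem_domain_kin.2 ((mem_opM_domain.1 (hψΩ.mem_opM hs)).1 l).1),
        ev_map_add _ (ladderDomain_le_field _ (hψ.mem_ladder _))
          (ladderDomain_le_field _ (hψΩ.mem_ladder _))]
      abel
    rw [e1, b2, inner_add_right, inner_add_right, add_re, add_re]
    have p1 : (inner ℂ (vel m g ξ l ψ) (vel m g ξ l ψ)).re = ‖vel m g ξ l ψ‖ ^ 2 :=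
      inner_self_eq_norm_sq (𝕜 := ℂ) _
    have p2 := re_inner_nonneg_of_wave (wave_dGamma b1) (fun n k => sym_nonneg hs.pos n k)
    have p3 := (abs_le.1 ((abs_re_le_norm _).trans
      (norm_inner_le_norm (𝕜 := ℂ) (vel m g ξ l ψ) (antiField (go l) ψ)))).1
    have p4 := norm_antiField_le hs (hkn l) (hs.wsq_pw_ne_top hψM one_le_two)
    have p5 : ‖antiField (go l) ψ‖ ^ 2 ≤ c l ^ 2 * wn (pw ω 1) ψ ^ 2 := by
      rw [← mul_pow]
      exact pow_le_pow_left₀ (norm_nonneg _) p4 2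
    rw [p1]
    nlinarith [sq_nonneg (‖vel m g ξ l ψ‖ - ‖antiField (go l) ψ‖), sq_nonneg (‖vel m g ξ l ψ‖)]
  rw [hψ.hKin_eq hs hg hh hhe, inner_smul_left, sum_inner]
  have h2 : (starRingEnd ℂ) (1 / 2 : ℂ) = ((1 / 2 : ℝ) : ℂ) := by
    rw [show (1 / 2 : ℂ) = ((1 / 2 : ℝ) : ℂ) by norm_num, conj_ofReal]
  rw [h2, re_ofReal_mul, re_sum]
  have h3 := Finset.sum_le_sum fun l (_ : l ∈ Finset.univ) => hl l
  rw [Finset.sum_neg_distrib, ← Finset.sum_mul] at h3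
  linarith

/-! ### Density of the vectors of bounded energy -/

open Filter Topology in
-- The approximants are `ψ` multiplied by the indicator of `n ≤ j`, `Ω ≤ j`, `|m_l| ≤ j`. These sets
-- exhaust configuration space and are permutation invariant, so the approximants remain symmetric.
theorem PosSymbols.exists_cpt_seq (hs : PosSymbols ω m) {ψ : Fock μ}
    (hψ : ψ ∈ (opM μ ω m).domain) : ∃ u : ℕ → Fock μ, (∀ j, IsCpt ω m (u j)) ∧
      Tendsto (fun j => ‖u j - ψ‖) atTop (𝓝 0) ∧
      Tendsto (fun j => ‖ev (opMsc μ ω m 1 0) (u j - ψ)‖) atTop (𝓝 0) := by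
  classical
  let P : ℕ → ∀ n, (Fin n → M) → Prop := fun j n k =>
    (n : ℝ) ≤ j ∧ sym ω n k ≤ j ∧ ∀ l, |sym (m l) n k| ≤ j
  have hPm : ∀ j n, MeasurableSet {k : Fin n → M | P j n k} := by
    intro j n
    refine (MeasurableSet.const _).inter ((measurableSet_le (measurable_sym hs.meas_omega n)
      measurable_const).inter ?_)
    change MeasurableSet {k : Fin n → M | ∀ l, |sym (m l) n k| ≤ j}
    rw [Set.setOf_forall]
    exact MeasurableSet.iInter fun l =>
      measurableSet_le (measurable_sym (hs.meas_m l) n).norm measurable_const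
  have hPp : ∀ j n (π : Equiv.Perm (Fin n)) (k : Fin n → M),
      P j n (fun i => k (π i)) ↔ P j n k := by
    intro j n π k
    simp only [P, sym_perm]
  have hex : ∀ j, ∃ η : Fock μ, ∀ n, η.wave n =ᵐ[prodMeas μ n]
      fun k => (if P j n k then 1 else 0) * ψ.wave n k := by
    intro j
    refine exists_mul (fun n => Measurable.ite (hPm j n) measurable_const measurable_const)
      (fun n π k => ?_) ?_
    · simp only [hPp]
    · refine ne_top_of_le_ne_top ?_ (wsq_mono (w' := fun _ _ => 1) ψ fun n k => ?_)
      · rw [← ofReal_norm_sq]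
        exact ENNReal.ofReal_ne_top
      · split_ifs <;> norm_num
  choose u hu using hex
  have hcpt : ∀ j, IsCpt ω m (u j) := by
    refine fun j => ⟨j, fun n => ?_⟩
    filter_upwards [hu j n] with k hk hne
    rw [hk] at hne
    by_contra hc
    exact hne (by rw [if_neg (show ¬ P j n k from hc), zero_mul])
  have hdiff : ∀ j n, (u j - ψ).wave n =ᵐ[prodMeas μ n]
      fun k => (if P j n k then 0 else -1) * ψ.wave n k := by
    intro j n
    filter_upwards [hu j n, wave_sub (u j) ψ n] with k h1 h2
    rw [h2, h1]
    split_ifs <;> ring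
  -- Dominated convergence twice, in each sector and then over the particle number. It is used for
  -- the weights `1` and `(symMa ω m 1 0)²`, which give the two parts of the graph norm.
  have key : ∀ w : ∀ n, (Fin n → M) → ℝ, (∀ n, Measurable (w n)) → wsq w ψ ≠ ⊤ →
      Tendsto (fun j => (wsq w (u j - ψ)).toReal) atTop (𝓝 0) := by
    intro w hwm hw
    set t : ℕ → ℕ → ℝ≥0∞ := fun j n => ∫⁻ k, ENNReal.ofReal
      (w n k * ‖(if P j n k then 0 else -1 : ℂ)‖ ^ 2 * ‖ψ.wave n k‖ ^ 2) ∂prodMeas μ n with ht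
    set b : ℕ → ℝ≥0∞ := fun n => ∫⁻ k, ENNReal.ofReal (w n k * ‖ψ.wave n k‖ ^ 2) ∂prodMeas μ n
      with hb
    have hbt : ∀ n, b n ≠ ⊤ := fun n => ENNReal.ne_top_of_tsum_ne_top hw n
    have hpt : ∀ j n (k : Fin n → M), ENNReal.ofReal
        (w n k * ‖(if P j n k then 0 else -1 : ℂ)‖ ^ 2 * ‖ψ.wave n k‖ ^ 2) ≤
          ENNReal.ofReal (w n k * ‖ψ.wave n k‖ ^ 2) := by
      intro j n k
      split_ifs <;> simp
    have htb : ∀ j n, t j n ≤ b n := fun j n => lintegral_mono fun k => hpt j n k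
    have hsum : ∀ j, (wsq w (u j - ψ)).toReal = ∑' n, (t j n).toReal := by
      intro j
      rw [wsq_of_wave_eq (hdiff j), wsq,
        ENNReal.tsum_toReal_eq fun n => ne_top_of_le_ne_top (hbt n) (htb j n)]
    simp only [hsum]
    have h0 : (0 : ℝ) = ∑' _n : ℕ, (0 : ℝ) := by simp
    rw [h0]
    refine tendsto_tsum_of_dominated_convergence (bound := fun n => (b n).toReal)
      (ENNReal.summable_toReal hw) (fun n => ?_) (Eventually.of_forall fun j n => ?_)
    · have : Tendsto (fun j => t j n) atTop (𝓝 (∫⁻ _k : Fin n → M, 0 ∂prodMeas μ n)) := by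
        refine tendsto_lintegral_of_dominated_convergence' _ (fun j => ?_)
          (fun j => Eventually.of_forall fun k => hpt j n k) (hbt n)
          (Eventually.of_forall fun k => ?_)
        · refine (((hwm n).mul ((Measurable.ite (hPm j n) measurable_const
            measurable_const).norm.pow_const 2)).aemeasurable.mul
            ((wave_aesm ψ n).norm.aemeasurable.pow_const 2)).ennreal_ofReal
        · obtain ⟨R, hR⟩ := exists_nat_ge
            (max (n : ℝ) (max (sym ω n k) (∑ l, |sym (m l) n k|)))
          refine tendsto_const_nhds.congr' ?_
          filter_upwards [eventually_ge_atTop R] with j hj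
          have hRj : (R : ℝ) ≤ j := by exact_mod_cast hj
          have : P j n k := by
            refine ⟨((le_max_left _ _).trans hR).trans hRj,
              (((le_max_left _ _).trans (le_max_right _ _)).trans hR).trans hRj, fun l => ?_⟩
            refine le_trans (Finset.single_le_sum (f := fun l => |sym (m l) n k|)
              (fun _ _ => abs_nonneg _) (Finset.mem_univ l)) ?_
            exact (((le_max_right _ _).trans (le_max_right _ _)).trans hR).trans hRj
          simp [this]
      rw [lintegral_zero] at this
      exact (ENNReal.tendsto_toReal ENNReal.zero_ne_top).comp this
    · rw [Real.norm_of_nonneg ENNReal.toReal_nonneg]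
      exact ENNReal.toReal_mono (hbt n) (htb j n)
  have hsq : ∀ v : ℕ → Fock μ, Tendsto (fun j => ‖v j‖ ^ 2) atTop (𝓝 0) →
      Tendsto (fun j => ‖v j‖) atTop (𝓝 0) := by
    intro v hv
    have := hv.sqrt
    simpa only [Real.sqrt_sq (norm_nonneg _), Real.sqrt_zero] using this
  refine ⟨u, hcpt, hsq _ ?_, hsq _ ?_⟩
  · have h1 := key (fun _ _ => 1) (fun _ => measurable_const) (by
      rw [← ofReal_norm_sq]
      exact ENNReal.ofReal_ne_top)
    simpa only [← ofReal_norm_sq, ENNReal.toReal_ofReal (sq_nonneg _)] using h1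
  · have h1 := key (fun n k => symMa ω m 1 0 n k ^ 2)
      (fun n => (hs.measurable_symMa 1 0 n).pow_const 2) (hs.mem_opM_domain_iff.1 hψ)
    have h2 : ∀ j, ENNReal.ofReal (‖ev (opMsc μ ω m 1 0) (u j - ψ)‖ ^ 2) =
        wsq (fun n k => symMa ω m 1 0 n k ^ 2) (u j - ψ) := fun j => by
      rw [ofReal_norm_sq_of_wave_eq
        (wave_opMsc (Submodule.sub_mem _ ((hcpt j).mem_opM hs) hψ))]
      simp only [norm_real, Real.norm_eq_abs, sq_abs]
    simpa only [← h2, ENNReal.toReal_ofReal (sq_nonneg _)] using h1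

end Commutator

end FiberHam

end
noncomputable section

namespace FiberHam

/-! ### Perturbation of symmetric operators -/

section AbstractPerturbation

variable {E : Type*} [NormedAddCommGroup E] [InnerProductSpace ℂ E]

/-- The restriction of a partially defined operator to a subspace of its domain. -/
def evL (A : E →ₗ.[ℂ] E) {D : Submodule ℂ E} (h : D ≤ A.domain) : D →ₗ[ℂ] E where
  toFun x := ev A x
  map_add' x y := ev_map_add A (h x.2) (h y.2)
  map_smul' c x := ev_map_smul A c (h x.2)

theorem evL_apply (A : E →ₗ.[ℂ] E) {D : Submodule ℂ E} (h : D ≤ A.domain) (x : D) :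
    evL A h x = ev A x := rfl

variable {D : Submodule ℂ E}

/-- Symmetry of an operator with domain `D`. -/
def SymmOn (A : D →ₗ[ℂ] E) : Prop := ∀ x y : D, inner ℂ (A x) (y : E) = inner ℂ (x : E) (A y)

/-- Surjectivity of `A + iκ`. -/
def SurjAt (A : D →ₗ[ℂ] E) (κ : ℝ) : Prop := Function.Surjective (A + (κ * I : ℂ) • D.subtype)

theorem SymmOn.add {A B : D →ₗ[ℂ] E} (hA : SymmOn A) (hB : SymmOn B) : SymmOn (A + B) :=
  fun x y => by
    rw [LinearMap.add_apply, LinearMap.add_apply, inner_add_left, inner_add_right, hA, hB]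

theorem SymmOn.smul {A : D →ₗ[ℂ] E} (hA : SymmOn A) (t : ℝ) : SymmOn ((t : ℂ) • A) :=
  fun x y => by
    rw [LinearMap.smul_apply, LinearMap.smul_apply, inner_smul_left, inner_smul_right, hA,
      conj_ofReal]

theorem SymmOn.norm_sq {A : D →ₗ[ℂ] E} (hA : SymmOn A) (κ : ℝ) (x : D) :
    ‖A x + (κ * I : ℂ) • (x : E)‖ ^ 2 = ‖A x‖ ^ 2 + κ ^ 2 * ‖x‖ ^ 2 := by
  have h : (inner ℂ (A x) (x : E)).im = 0 := by
    have h1 := hA x x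
    rw [← inner_conj_symm (x : E) (A x)] at h1
    exact conj_eq_iff_im.1 h1.symm
  have h2 : (RCLike.re (inner ℂ (A x) ((κ * I : ℂ) • (x : E))) : ℝ) = 0 := by
    rw [inner_smul_right]
    change ((κ * I : ℂ) * inner ℂ (A x) (x : E)).re = 0
    simp [mul_re, h]
  rw [norm_add_sq (𝕜 := ℂ), h2, norm_smul]
  simp only [norm_mul, norm_real, norm_I, Real.norm_eq_abs, mul_one, mul_pow, sq_abs]
  simp

theorem SymmOn.norm_le {A : D →ₗ[ℂ] E} (hA : SymmOn A) (κ : ℝ) (x : D) :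
    ‖A x‖ ≤ ‖A x + (κ * I : ℂ) • (x : E)‖ ∧ |κ| * ‖x‖ ≤ ‖A x + (κ * I : ℂ) • (x : E)‖ := by
  have h := hA.norm_sq κ x
  constructor
  · refine abs_le_of_sq_le_sq' ?_ (norm_nonneg _) |>.2
    nlinarith [mul_nonneg (sq_nonneg κ) (sq_nonneg ‖x‖)]
  · refine abs_le_of_sq_le_sq' ?_ (norm_nonneg _) |>.2
    rw [mul_pow, sq_abs]
    nlinarith [sq_nonneg ‖A x‖]

/-- An operator that dominates `Ω ≥ 0` up to small perturbations controls `1 + Ω`. -/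
theorem norm_le_of_re_inner_ge {K Ω R : D →ₗ[ℂ] E} {c : ℝ} (hc : 0 ≤ c)
    (hΩ : ∀ x, 0 ≤ (inner ℂ (Ω x) (x : E)).re)
    (hK : ∀ x : D, -(1 / 4 * ‖(x : E) + Ω x‖ ^ 2 + c * ‖x‖ ^ 2) ≤
      (inner ℂ (K x) ((x : E) + Ω x)).re)
    (hR : ∀ x : D, ‖R x‖ ≤ 1 / 4 * ‖(x : E) + Ω x‖ + c * ‖x‖) {b : ℝ} (hb : 1 ≤ b) (x : D) :
    ‖(x : E) + Ω x‖ ≤ (4 * c + 4) * (‖K x + (b : ℂ) • Ω x + R x‖ + ‖x‖) := by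
  set t := ‖(x : E) + Ω x‖ with ht
  set p := ‖x‖
  have ht0 : 0 ≤ t := norm_nonneg _
  have hp0 : 0 ≤ p := norm_nonneg _
  have hh0 := norm_nonneg (K x + (b : ℂ) • Ω x + R x)
  have h1 : (inner ℂ (K x + (b : ℂ) • Ω x + R x) ((x : E) + Ω x)).re ≤
      ‖K x + (b : ℂ) • Ω x + R x‖ * t :=
    (re_le_norm _).trans (norm_inner_le_norm (𝕜 := ℂ) _ _)
  set h := ‖K x + (b : ℂ) • Ω x + R x‖
  rw [inner_add_left, inner_add_left, inner_smul_left, conj_ofReal, add_re, add_re,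
    re_ofReal_mul] at h1
  have h2 := (abs_le.1 ((abs_re_le_norm _).trans
    (norm_inner_le_norm (𝕜 := ℂ) (R x) ((x : E) + Ω x)))).1
  have h3 : (inner ℂ (Ω x) ((x : E) + Ω x)).re = t ^ 2 - (inner ℂ (x : E) ((x : E) + Ω x)).re := by
    have h4 : (inner ℂ ((x : E) + Ω x) ((x : E) + Ω x)).re = t ^ 2 :=
      inner_self_eq_norm_sq (𝕜 := ℂ) _
    rw [inner_add_left, add_re] at h4
    linarith
  have h5 : (inner ℂ (x : E) ((x : E) + Ω x)).re ≤ p * t :=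
    (re_le_norm _).trans (norm_inner_le_norm (𝕜 := ℂ) _ _)
  have h6 : 0 ≤ (inner ℂ (Ω x) ((x : E) + Ω x)).re := by
    have h7 : (inner ℂ (Ω x) (Ω x)).re = ‖Ω x‖ ^ 2 := inner_self_eq_norm_sq (𝕜 := ℂ) _
    rw [inner_add_right, add_re, h7]
    have := hΩ x
    positivity
  -- The pairing `⟨Ωx, (1 + Ω)x⟩` is nonnegative, so a coefficient `b ≥ 1` can only help; hence the
  -- uniformity in `b`.
  have h8 : t ^ 2 - p * t ≤ b * (inner ℂ (Ω x) ((x : E) + Ω x)).re := by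
    nlinarith [mul_nonneg (sub_nonneg.2 hb) h6]
  have h9 := hK x
  have h10 := mul_le_mul_of_nonneg_right (hR x) ht0
  -- The estimates so far amount to `½t² ≤ ht + pt + cpt + cp²`. For `t ≤ p` the claim is immediate;
  -- otherwise `p² ≤ pt` and one factor `t` cancels.
  rcases le_or_gt t p with htp | htp
  · nlinarith [mul_nonneg hc hh0, mul_nonneg hc hp0]
  · have hpos : 0 < t := lt_of_le_of_lt hp0 htp
    have h11 : p ^ 2 ≤ p * t := by nlinarith
    have h12 : c * p ^ 2 ≤ c * (p * t) := mul_le_mul_of_nonneg_left h11 hc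
    have h13 : t * t ≤ (4 * c + 4) * (h + p) * t := by
      nlinarith [mul_nonneg (mul_nonneg hc hh0) ht0, mul_nonneg (mul_nonneg hc hp0) ht0,
        mul_nonneg hh0 ht0, mul_nonneg hp0 ht0]
    exact le_of_mul_le_mul_right h13 hpos

/-- The a priori bound of `M + (a - 1) Ω` by `H = M + W`. -/
theorem norm_le_of_relative_bound {Mo Ω W : D →ₗ[ℂ] E} {a c C : ℝ} (ha : 1 ≤ a)
    (hW : ∀ x, ‖W x‖ ≤ 1 / 2 * ‖Mo x + ((a - 1 : ℝ) : ℂ) • Ω x‖ + c * ‖x‖)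
    (hT : ∀ x : D, ‖(x : E) + Ω x‖ ≤ C * (‖(Mo + W) x‖ + ‖x‖)) (x : D) :
    ‖Mo x‖ ≤ (2 + 2 * |c| + 2 * (a - 1) * (|C| + 1)) * (‖(Mo + W) x‖ + ‖x‖) := by
  have h0 := norm_nonneg ((Mo + W) x)
  have hx := norm_nonneg x
  have h1 : ‖Ω x‖ ≤ (|C| + 1) * (‖(Mo + W) x‖ + ‖x‖) := by
    have : Ω x = ((x : E) + Ω x) - x := by abel
    rw [this]
    refine (norm_sub_le _ _).trans ?_
    have h2 := hT x
    have h3 : C * (‖(Mo + W) x‖ + ‖x‖) ≤ |C| * (‖(Mo + W) x‖ + ‖x‖) :=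
      mul_le_mul_of_nonneg_right (le_abs_self C) (by positivity)
    have h4 : ‖(x : E)‖ = ‖x‖ := rfl
    rw [h4]
    linarith
  have h2 : ‖((a - 1 : ℝ) : ℂ) • Ω x‖ ≤ (a - 1) * ((|C| + 1) * (‖(Mo + W) x‖ + ‖x‖)) := by
    rw [norm_smul, norm_real, Real.norm_of_nonneg (by linarith)]
    exact mul_le_mul_of_nonneg_left h1 (by linarith)
  have h3 : ‖Mo x + ((a - 1 : ℝ) : ℂ) • Ω x‖ ≤ ‖Mo x‖ + ‖((a - 1 : ℝ) : ℂ) • Ω x‖ :=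
    norm_add_le _ _
  -- `W` contributes at most `½‖Mo x‖` plus terms already bounded by the graph norm of `Mo + W`;
  -- absorbing this half on the left causes the factors `2` in the constant.
  have h4 : ‖Mo x‖ ≤ ‖(Mo + W) x‖ + ‖W x‖ := by
    have : Mo x = (Mo + W) x - W x := by simp
    rw [this]
    exact norm_sub_le _ _
  have h5 := hW x
  have h6 : c * ‖x‖ ≤ |c| * ‖x‖ := mul_le_mul_of_nonneg_right (le_abs_self c) hx
  have h7 : 0 ≤ |c| * ‖(Mo + W) x‖ := by positivity
  have h8 := (norm_nonneg _).trans h2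
  linarith

/-- Surjectivity of `M + W ± iκ` from that of `M + (a - 1) Ω ± iκ`. -/
theorem surjective_of_relative_bound [CompleteSpace E] {Mo Ω W : D →ₗ[ℂ] E} {a c C κ : ℝ}
    (ha : 1 ≤ a) (hM : SymmOn Mo) (hΩ : SymmOn Ω) (hWs : SymmOn W)
    (hW : ∀ x, ‖W x‖ ≤ 1 / 2 * ‖Mo x + ((a - 1 : ℝ) : ℂ) • Ω x‖ + c * ‖x‖)
    (hT : ∀ b : ℝ, 1 ≤ b → ∀ x : D,
      ‖(x : E) + Ω x‖ ≤ C * (‖Mo x + ((b - 1 : ℝ) : ℂ) • Ω x + W x‖ + ‖x‖))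
    (hκ : 4 * |c| + 1 ≤ |κ|)
    (hs : SurjAt (Mo + ((a - 1 : ℝ) : ℂ) • Ω) κ) : SurjAt (Mo + W) κ := by
  have hc0 := abs_nonneg c
  have hκ0 : 0 < |κ| := by linarith
  have hne : ∀ {A : D →ₗ[ℂ] E}, SymmOn A → ∀ x, A x + (κ * I : ℂ) • (x : E) = 0 → x = 0 := by
    intro A hA x hx
    have := (hA.norm_le κ x).2
    rw [hx, norm_zero] at this
    exact norm_le_zero_iff.1 (nonpos_of_mul_nonpos_right this hκ0)
  have hMa : SymmOn (Mo + ((a - 1 : ℝ) : ℂ) • Ω) := hM.add (hΩ.smul _)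
  -- Kato–Rellich at the coefficient `a`: the bound `3/4` is `1/2` from the relative bound plus
  -- `1/4` from `c ≤ |κ|/4`.
  have step : Function.Surjective
      ((Mo + ((a - 1 : ℝ) : ℂ) • Ω + (κ * I : ℂ) • D.subtype) + W) := by
    refine surjective_add_of_small _ W hs (θ := 3 / 4) (by norm_num) (fun x => ?_)
      (fun x hx => hne hMa x hx)
    obtain ⟨h1, h2⟩ := hMa.norm_le κ x
    have h3 := hW x
    change ‖W x‖ ≤ 3 / 4 * ‖(Mo + ((a - 1 : ℝ) : ℂ) • Ω) x + (κ * I : ℂ) • (x : E)‖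
    change ‖W x‖ ≤ 1 / 2 * ‖(Mo + ((a - 1 : ℝ) : ℂ) • Ω) x‖ + c * ‖x‖ at h3
    have h4 : c * ‖x‖ ≤ 1 / 4 * (|κ| * ‖x‖) := by
      have : c ≤ 1 / 4 * |κ| := by linarith [le_abs_self c]
      nlinarith [norm_nonneg x]
    linarith
  -- The path lowers the coefficient of `Ω` from `a` to `1` while `W` stays fixed. It runs through
  -- the values `b = a - s(a - 1) ≥ 1`, for which the a priori bound holds with one constant.
  have hfin := surjective_add_of_path
    ((Mo + ((a - 1 : ℝ) : ℂ) • Ω + (κ * I : ℂ) • D.subtype) + W)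
    (((1 - a : ℝ) : ℂ) • Ω) step (C := (a - 1) * (|C| * (1 + |κ|⁻¹) + |κ|⁻¹)) ?_ ?_
  · change Function.Surjective (Mo + W + (κ * I : ℂ) • D.subtype)
    convert hfin using 2
    ext x
    simp only [LinearMap.add_apply, LinearMap.smul_apply]
    push_cast
    module
  all_goals
    intro s hs0 hs1 x
    have hb : (1 : ℝ) ≤ a - s * (a - 1) := by nlinarith
    have hH : SymmOn (Mo + ((a - s * (a - 1) - 1 : ℝ) : ℂ) • Ω + W) := (hM.add (hΩ.smul _)).add hWs
    have heq : (Mo + ((a - 1 : ℝ) : ℂ) • Ω + (κ * I : ℂ) • D.subtype + W) x +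
        (s : ℂ) • (((1 - a : ℝ) : ℂ) • Ω) x =
        (Mo + ((a - s * (a - 1) - 1 : ℝ) : ℂ) • Ω + W) x + (κ * I : ℂ) • (x : E) := by
      simp only [LinearMap.add_apply, LinearMap.smul_apply, Submodule.subtype_apply]
      push_cast
      module
    rw [heq]
  · obtain ⟨h1, h2⟩ := hH.norm_le κ x
    set N := ‖(Mo + ((a - s * (a - 1) - 1 : ℝ) : ℂ) • Ω + W) x + (κ * I : ℂ) • (x : E)‖
    have h2' : ‖x‖ ≤ |κ|⁻¹ * N := by
      rw [inv_mul_eq_div, le_div_iff₀ hκ0]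
      linarith
    have h3 := hT _ hb x
    change _ ≤ C * (‖(Mo + ((a - s * (a - 1) - 1 : ℝ) : ℂ) • Ω + W) x‖ + ‖x‖) at h3
    have h4 : ‖Ω x‖ ≤ ‖(x : E) + Ω x‖ + ‖x‖ := by
      have : Ω x = ((x : E) + Ω x) - x := by abel
      calc ‖Ω x‖ = ‖((x : E) + Ω x) - x‖ := by rw [← this]
        _ ≤ _ := norm_sub_le _ _
    rw [LinearMap.smul_apply, norm_smul, norm_real, Real.norm_eq_abs, abs_sub_comm,
      abs_of_nonneg (by linarith : 0 ≤ a - 1), mul_assoc]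
    refine mul_le_mul_of_nonneg_left ?_ (by linarith)
    have h5 : C * (‖(Mo + ((a - s * (a - 1) - 1 : ℝ) : ℂ) • Ω + W) x‖ + ‖x‖) ≤
        |C| * (N + |κ|⁻¹ * N) := by
      refine (mul_le_mul_of_nonneg_right (le_abs_self C) (by positivity)).trans ?_
      exact mul_le_mul_of_nonneg_left (add_le_add h1 h2') (abs_nonneg C)
    nlinarith
  · exact hne hH x

theorem isSelfAdjoint_of_surjective_evL [CompleteSpace E] {A : E →ₗ.[ℂ] E}
    (hsymm : SymmOn (evL A le_rfl)) {κ : ℝ} (hκ : κ ≠ 0)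
    (hp : SurjAt (evL A le_rfl) κ) (hm : SurjAt (evL A le_rfl) (-κ)) :
    IsSelfAdjoint A := by
  refine isSelfAdjoint_of_surjective ?_ (fun x hx y hy => hsymm ⟨x, hx⟩ ⟨y, hy⟩) (κ := κ)
    (fun y => ?_) (fun y => ?_)
  -- Density of the domain comes from surjectivity. If `y ⊥ dom A` and `(A + iκ)x = y`, then `‖(A +
  -- 2iκ)x‖²` is `‖y‖² + κ²‖x‖²` by orthogonality and `‖Ax‖² + 4κ²‖x‖²` by symmetry; comparison with
  -- `‖y‖² = ‖Ax‖² + κ²‖x‖²` gives `x = 0`.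
  · refine Submodule.dense_iff_topologicalClosure_eq_top.2 ?_
    rw [Submodule.topologicalClosure_eq_top_iff, Submodule.eq_bot_iff]
    intro y hy
    obtain ⟨x, hx⟩ := hp y
    have h0 : inner ℂ (x : E) y = 0 := (Submodule.mem_orthogonal _ _).1 hy _ x.2
    have h1 := hsymm.norm_sq κ x
    have h2 := hsymm.norm_sq (2 * κ) x
    change ‖(evL A le_rfl + (κ * I : ℂ) • A.domain.subtype) x‖ ^ 2 = _ at h1
    have h3 : evL A le_rfl x + ((2 * κ : ℝ) * I : ℂ) • (x : E) = y + (κ * I : ℂ) • (x : E) := by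
      rw [← hx]
      simp only [LinearMap.add_apply, LinearMap.smul_apply, Submodule.subtype_apply]
      push_cast
      module
    have h4 : ‖y + (κ * I : ℂ) • (x : E)‖ ^ 2 = ‖y‖ ^ 2 + κ ^ 2 * ‖x‖ ^ 2 := by
      have h5 : inner ℂ y (x : E) = 0 := by rw [← inner_conj_symm, h0, map_zero]
      rw [norm_add_sq (𝕜 := ℂ), inner_smul_right, h5, norm_smul]
      simp [mul_pow]
    rw [h3, h4] at h2
    rw [hx] at h1
    have h6 : κ ^ 2 * ‖x‖ ^ 2 = 0 := by linarith
    have h7 : x = 0 := by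
      have := (mul_eq_zero.1 h6).resolve_left (pow_ne_zero 2 hκ)
      simpa using this
    rw [← hx, h7, map_zero]
  · obtain ⟨x, hx⟩ := hp y
    exact ⟨x, x.2, hx⟩
  · obtain ⟨x, hx⟩ := hm y
    refine ⟨x, x.2, ?_⟩
    rw [← hx]
    simp only [LinearMap.add_apply, LinearMap.smul_apply, Submodule.subtype_apply, evL_apply]
    push_cast
    module

end AbstractPerturbation

end FiberHam

end
-- From bounded-energy vectors to the domain of `M`, and from Fock space to the fiber space
noncomputable section

namespace FiberHam

section Scalar

variable {M : Type*} [MeasurableSpace M] {μ : Measure M} [SigmaFinite μ] {ν : ℕ}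
  {ω : M → ℝ} {m : Fin ν → M → ℝ} {g : Fin ν → OneBoson μ} {h : OneBoson μ}
  {ξ : EuclideanSpace ℝ (Fin ν)}

/-! ### The scalar operator on the domain of `M` -/

theorem PosSymbols.wn_intWeight_le (hs : PosSymbols ω m) (ξ : EuclideanSpace ℝ (Fin ν))
    {ψ : Fock μ} (hψ : ψ ∈ (opM μ ω m).domain) :
    wn (intWeight ω m ξ) ψ ≤ 2 * ‖ev (opMsc μ ω m 1 ξ) ψ‖ + 2 * ‖ψ‖ :=
  wn_le_of_wave_eq (hs.measurable_symMa 1 ξ) (wave_opMsc hψ) (by norm_num) (by norm_num)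
    (hs.intWeight_le_one ξ)

theorem mem_dGamma_of_mem_opM {ψ : Fock μ} (hψ : ψ ∈ (opM μ ω m).domain) :
    ψ ∈ (dGamma μ ω).domain := (mem_opM_domain.1 hψ).2

theorem PosSymbols.norm_dGamma_le (hs : PosSymbols ω m) (ξ : EuclideanSpace ℝ (Fin ν))
    {ψ : Fock μ} (hψ : ψ ∈ (opM μ ω m).domain) :
    ‖ev (dGamma μ ω) ψ‖ ≤ ‖ev (opMsc μ ω m 1 ξ) ψ‖ := by
  have h1 := wn_le_of_wave_eq (w := fun n k => sym ω n k ^ 2) (hs.measurable_symMa 1 ξ)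
    (wave_opMsc hψ) zero_le_one le_rfl (fun n k => by
      have hΩ := sym_nonneg hs.pos n k
      have hX := symX_nonneg m ξ n k
      rw [one_pow, one_mul, zero_pow two_ne_zero, add_zero]
      refine pow_le_pow_left₀ hΩ ?_ 2
      rw [symMa]
      linarith)
  have h2 := ofReal_norm_sq_of_wave_eq (wave_dGamma (mem_dGamma_of_mem_opM hψ))
  simp only [norm_real, Real.norm_eq_abs, sq_abs] at h2
  rw [wn, ← h2, ENNReal.toReal_ofReal (sq_nonneg _), Real.sqrt_sq (norm_nonneg _)] at h1
  linarith

/-- Continuity in the graph norm of `M_1(0)`, which lets identities and inequalities pass to the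
limit along cut-offs. -/
theorem PosSymbols.norm_hKin_le (hs : PosSymbols ω m) (hg : ∀ l, InK μ ω m (g l))
    (hh : InK μ ω m h) (ξ : EuclideanSpace ℝ (Fin ν)) :
    ∃ c : ℝ, 0 ≤ c ∧ ∀ ψ ∈ (opM μ ω m).domain,
      ‖ev (hKin m g h ξ) ψ‖ ≤ c * (‖ev (opMsc μ ω m 1 0) ψ‖ + ‖ψ‖) := by
  obtain ⟨c₁, hc₁, h₁⟩ := hs.norm_hKin_sub_le hg hh ξ
  obtain ⟨c₂, hc₂, h₂⟩ := hs.norm_opMsc_le (μ := μ) le_rfl le_rfl ξ 0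
  refine ⟨(2 * c₁ + 2) * (c₂ + 1), by positivity, fun ψ hψ => ?_⟩
  have e1 := h₁ ψ hψ
  have e2 := h₂ ψ hψ
  have e3 := hs.wn_intWeight_le ξ hψ
  have e4 := hs.norm_dGamma_le ξ hψ
  have e5 := ev_opMsc (a := 1) (ξ := ξ) hψ
  set A := (1 / 2 : ℂ) • ∑ l, ev (kin μ m ξ l) (ev (kin μ m ξ l) ψ)
  have e6 : ev (hKin m g h ξ) ψ = (ev (hKin m g h ξ) ψ - A) +
      (ev (opMsc μ ω m 1 ξ) ψ - ev (dGamma μ ω) ψ) := by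
    rw [e5]
    push_cast
    module
  have e7 : ‖ev (hKin m g h ξ) ψ‖ ≤ ‖ev (hKin m g h ξ) ψ - A‖ +
      (‖ev (opMsc μ ω m 1 ξ) ψ‖ + ‖ev (dGamma μ ω) ψ‖) := by
    conv_lhs => rw [e6]
    exact (norm_add_le _ _).trans (add_le_add le_rfl (norm_sub_le _ _))
  have e8 := mul_le_mul_of_nonneg_left e3 hc₁
  have e9 : (2 * c₁ + 2) * ‖ev (opMsc μ ω m 1 ξ) ψ‖ ≤
    (2 * c₁ + 2) * (c₂ * (‖ev (opMsc μ ω m 1 0) ψ‖ + ‖ψ‖)) :=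
    mul_le_mul_of_nonneg_left e2 (by positivity)
  have e10 := norm_nonneg (ev (opMsc μ ω m 1 0) ψ)
  have e11 := norm_nonneg ψ
  nlinarith [mul_nonneg hc₁ e10, mul_nonneg hc₁ e11]

open Filter Topology in
theorem tendsto_ev_of_norm_le {A : Fock μ →ₗ.[ℂ] Fock μ}
    (hA : (opM μ ω m).domain ≤ A.domain) {c : ℝ}
    (hc : ∀ ψ ∈ (opM μ ω m).domain, ‖ev A ψ‖ ≤ c * (‖ev (opMsc μ ω m 1 0) ψ‖ + ‖ψ‖))
    {u : ℕ → Fock μ} {ψ : Fock μ} (hu : ∀ j, u j ∈ (opM μ ω m).domain)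
    (hψ : ψ ∈ (opM μ ω m).domain) (h1 : Tendsto (fun j => ‖u j - ψ‖) atTop (𝓝 0))
    (h2 : Tendsto (fun j => ‖ev (opMsc μ ω m 1 0) (u j - ψ)‖) atTop (𝓝 0)) :
    Tendsto (fun j => ev A (u j)) atTop (𝓝 (ev A ψ)) := by
  rw [tendsto_iff_norm_sub_tendsto_zero]
  refine squeeze_zero (fun _ => norm_nonneg _) (fun j => ?_)
    (by simpa using (h2.add h1).const_mul c)
  rw [← ev_map_sub A (hA (hu j)) (hA hψ)]
  exact hc _ (Submodule.sub_mem _ (hu j) hψ)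

open Filter Topology in
theorem PosSymbols.inner_hKin (hs : PosSymbols ω m) (hg : ∀ l, InK μ ω m (g l))
    (hh : InK μ ω m h) (hhe : h =ᵐ[μ] imDot m g) {φ ψ : Fock μ}
    (hφ : φ ∈ (opM μ ω m).domain) (hψ : ψ ∈ (opM μ ω m).domain) :
    inner ℂ (ev (hKin m g h ξ) φ) ψ = inner ℂ φ (ev (hKin m g h ξ) ψ) := by
  obtain ⟨c, -, hc⟩ := hs.norm_hKin_le hg hh ξ
  obtain ⟨u, hu, hu1, hu2⟩ := hs.exists_cpt_seq hφ
  obtain ⟨v, hv, hv1, hv2⟩ := hs.exists_cpt_seq hψ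
  have hle : (opM μ ω m).domain ≤ (hKin m g h ξ).domain := fun _ => hs.hKin_mem hg hh
  have t1 := tendsto_ev_of_norm_le hle hc (fun j => (hu j).mem_opM hs) hφ hu1 hu2
  have t2 := tendsto_ev_of_norm_le hle hc (fun j => (hv j).mem_opM hs) hψ hv1 hv2
  have t3 := tendsto_iff_norm_sub_tendsto_zero.2 hu1
  have t4 := tendsto_iff_norm_sub_tendsto_zero.2 hv1
  refine tendsto_nhds_unique (t1.inner (𝕜 := ℂ) t4) ?_
  refine (t3.inner (𝕜 := ℂ) t2).congr fun j => ?_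
  exact ((hu j).inner_hKin hs hg hh hhe (hv j)).symm

/-- With `s = 1 + Ω`, the difference `δ²s² + 1/(4δ²) - s` is the square `(δs - 1/(2δ))²`: the half
power of `1 + Ω` is small relative to the full power. -/
theorem wn_pw_le_eps (hs : PosSymbols ω m) {δ : ℝ} (hδ : 0 < δ) {ψ : Fock μ}
    (hψ : ψ ∈ (opM μ ω m).domain) :
    wn (pw ω 1) ψ ≤ δ * ‖ψ + ev (dGamma μ ω) ψ‖ + 1 / (2 * δ) * ‖ψ‖ := by
  refine wn_le_of_wave_eq (g := fun n k => 1 + sym ω n k)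
    (fun n => (measurable_sym hs.meas_omega n).const_add 1) (fun n => ?_) hδ.le (by positivity)
    (fun n k => ?_)
  · filter_upwards [wave_add ψ (ev (dGamma μ ω) ψ) n,
      wave_dGamma (mem_dGamma_of_mem_opM hψ) n] with k h1 h2
    rw [h1, h2]
    push_cast
    ring
  · rw [pw, pow_one]
    have : δ ^ 2 * (1 + sym ω n k) ^ 2 + (1 / (2 * δ)) ^ 2 - (1 + sym ω n k) =
        (δ * (1 + sym ω n k) - 1 / (2 * δ)) ^ 2 := by
      field_simp
      ring
    nlinarith [sq_nonneg (δ * (1 + sym ω n k) - 1 / (2 * δ))]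

open Filter Topology in
-- The error in the commutator bound involves only the half power of `1 + Ω`, so interpolation
-- reduces it to a quarter of `‖(1 + Ω)ψ‖²`. Both sides are continuous in the graph norm of `M`,
-- hence the extension to the domain.
theorem PosSymbols.re_inner_hKin_ge (hs : PosSymbols ω m) (hg : ∀ l, InK μ ω m (g l))
    (hh : InK μ ω m h) (hhe : h =ᵐ[μ] imDot m g) (ξ : EuclideanSpace ℝ (Fin ν)) :
    ∃ c : ℝ, 0 ≤ c ∧ ∀ ψ ∈ (opM μ ω m).domain,
      -(1 / 4 * ‖ψ + ev (dGamma μ ω) ψ‖ ^ 2 + c * ‖ψ‖ ^ 2) ≤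
        (inner ℂ (ev (hKin m g h ξ) ψ) (ψ + ev (dGamma μ ω) ψ)).re := by
  obtain ⟨C, hC, hCb⟩ := IsCpt.re_inner_hKin_ge hs hg hh hhe ξ
  obtain ⟨c, -, hc⟩ := hs.norm_hKin_le hg hh ξ
  have hD : 0 < 8 * (C + 1) := by positivity
  -- Chosen so that `2Cδ² ≤ 1/4`.
  set δ := Real.sqrt (1 / (8 * (C + 1))) with hδ
  have hδ0 : 0 < δ := Real.sqrt_pos.2 (by positivity)
  have hδ2 : δ ^ 2 = 1 / (8 * (C + 1)) := Real.sq_sqrt (by positivity)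
  refine ⟨2 * C * (1 / (2 * δ)) ^ 2, by positivity, fun ψ hψ => ?_⟩
  have key : ∀ ψ : Fock μ, IsCpt ω m ψ →
      -(1 / 4 * ‖ψ + ev (dGamma μ ω) ψ‖ ^ 2 + 2 * C * (1 / (2 * δ)) ^ 2 * ‖ψ‖ ^ 2) ≤
        (inner ℂ (ev (hKin m g h ξ) ψ) (ψ + ev (dGamma μ ω) ψ)).re := by
    intro ψ hψ
    refine le_trans ?_ (hCb ψ hψ)
    have h1 := wn_pw_le_eps hs hδ0 (hψ.mem_opM hs)
    have h2 := pow_le_pow_left₀ (wn_nonneg _ _) h1 2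
    have h3 : C * δ ^ 2 ≤ 1 / 8 := by
      rw [hδ2, mul_one_div, div_le_div_iff₀ hD (by norm_num)]
      linarith
    have h4 := mul_le_mul_of_nonneg_left h2 hC
    set t := ‖ψ + ev (dGamma μ ω) ψ‖
    set p := ‖ψ‖
    have h5 : C * (δ * t + 1 / (2 * δ) * p) ^ 2 ≤
        2 * (C * δ ^ 2) * t ^ 2 + 2 * C * (1 / (2 * δ)) ^ 2 * p ^ 2 := by
      nlinarith [mul_nonneg hC (sq_nonneg (δ * t - 1 / (2 * δ) * p))]
    nlinarith [sq_nonneg t]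
  obtain ⟨u, hu, hu1, hu2⟩ := hs.exists_cpt_seq hψ
  have hle : (opM μ ω m).domain ≤ (hKin m g h ξ).domain := fun _ => hs.hKin_mem hg hh
  have t1 := tendsto_ev_of_norm_le hle hc (fun j => (hu j).mem_opM hs) hψ hu1 hu2
  have t2 : Tendsto (fun j => ev (dGamma μ ω) (u j)) atTop (𝓝 (ev (dGamma μ ω) ψ)) :=
    tendsto_ev_of_norm_le (fun _ => mem_dGamma_of_mem_opM) (c := 1) (fun ψ hψ => by
      have := hs.norm_dGamma_le 0 hψ
      have := norm_nonneg ψ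
      linarith) (fun j => (hu j).mem_opM hs) hψ hu1 hu2
  have t3 := tendsto_iff_norm_sub_tendsto_zero.2 hu1
  refine le_of_tendsto_of_tendsto
    ((((t3.add t2).norm.pow 2).const_mul (1 / 4)).add ((t3.norm.pow 2).const_mul _)).neg
    (continuous_re.continuousAt.tendsto.comp (t1.inner (𝕜 := ℂ) (t3.add t2)))
    (Eventually.of_forall fun j => key (u j) (hu j))

end Scalar

/-! ### Operators on the fiber space -/

section Fiber

variable {M : Type*} [MeasurableSpace M] {μ : Measure M} [SigmaFinite μ] {ν S L : ℕ}

theorem ev_tensorOp (A : Matrix (Fin L) (Fin L) ℂ) (T : Fock μ →ₗ.[ℂ] Fock μ)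
    {Ψ : FiberSpace μ L} (hΨ : ∀ j, Ψ j ∈ T.domain) (i : Fin L) :
    ev (tensorOp A T) Ψ i = ∑ j, A i j • ev T (Ψ j) := by
  rw [ev_of_mem (tensorOp A T) (x := Ψ) hΨ]
  change ∑ j, A i j • T ⟨Ψ j, hΨ j⟩ = _
  exact Finset.sum_congr rfl fun j _ => by rw [ev_of_mem T (hΨ j)]

theorem ev_tensorOp_one (T : Fock μ →ₗ.[ℂ] Fock μ) {Ψ : FiberSpace μ L}
    (hΨ : ∀ j, Ψ j ∈ T.domain) (i : Fin L) : ev (tensorOp 1 T) Ψ i = ev T (Ψ i) := by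
  rw [ev_tensorOp _ _ hΨ, Finset.sum_eq_single i]
  · simp
  · intro j _ hj
    simp [Matrix.one_apply_ne hj.symm]
  · simp

theorem norm_fiber_le (Ψ : FiberSpace μ L) : ‖Ψ‖ ≤ ∑ i, ‖Ψ i‖ := by
  rw [PiLp.norm_eq_of_L2]
  refine Real.sqrt_le_iff.2 ⟨Finset.sum_nonneg fun _ _ => norm_nonneg _, ?_⟩
  exact Finset.sum_sq_le_sq_sum_of_nonneg fun _ _ => norm_nonneg _

theorem norm_tensorOp_le (A : Matrix (Fin L) (Fin L) ℂ) : ∃ C : ℝ, 0 ≤ C ∧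
    ∀ (T : Fock μ →ₗ.[ℂ] Fock μ) (Ψ : FiberSpace μ L), (∀ j, Ψ j ∈ T.domain) →
      ‖ev (tensorOp A T) Ψ‖ ≤ C * ∑ j, ‖ev T (Ψ j)‖ := by
  refine ⟨∑ i, ∑ j, ‖A i j‖, Finset.sum_nonneg fun _ _ => Finset.sum_nonneg fun _ _ =>
    norm_nonneg _, fun T Ψ hΨ => ?_⟩
  refine (norm_fiber_le _).trans ?_
  rw [Finset.sum_mul]
  refine Finset.sum_le_sum fun i _ => ?_
  rw [ev_tensorOp A T hΨ]
  refine (norm_sum_le _ _).trans ?_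
  rw [Finset.sum_mul]
  refine Finset.sum_le_sum fun j _ => ?_
  rw [norm_smul]
  exact mul_le_mul_of_nonneg_left (Finset.single_le_sum (f := fun j => ‖ev T (Ψ j)‖)
    (fun _ _ => norm_nonneg _) (Finset.mem_univ j)) (norm_nonneg _)

theorem inner_tensorOp {A : Matrix (Fin L) (Fin L) ℂ} (hA : A.IsHermitian)
    {T : Fock μ →ₗ.[ℂ] Fock μ} {D : Submodule ℂ (Fock μ)} (hD : D ≤ T.domain)
    (hT : ∀ φ ∈ D, ∀ ψ ∈ D, inner ℂ (ev T φ) ψ = inner ℂ φ (ev T ψ))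
    {Φ Ψ : FiberSpace μ L} (hΦ : ∀ i, Φ i ∈ D) (hΨ : ∀ i, Ψ i ∈ D) :
    inner ℂ (ev (tensorOp A T) Φ) Ψ = inner ℂ Φ (ev (tensorOp A T) Ψ) := by
  rw [PiLp.inner_apply, PiLp.inner_apply]
  simp only [ev_tensorOp A T fun i => hD (hΦ i), ev_tensorOp A T fun i => hD (hΨ i), sum_inner,
    inner_sum, inner_smul_left, inner_smul_right]
  rw [Finset.sum_comm]
  refine Finset.sum_congr rfl fun i _ => Finset.sum_congr rfl fun j _ => ?_
  rw [hT _ (hΦ i) _ (hΨ j)]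
  congr 1
  exact hA.apply i j

variable {ω : M → ℝ} {m : Fin ν → M → ℝ}
  {G : EuclideanSpace ℝ (Fin ν) → Fin ν → OneBoson μ}
  {F : EuclideanSpace ℝ (Fin ν) → Fin S → OneBoson μ}
  {σ : Fin S → Matrix (Fin L) (Fin L) ℂ} {ξ x : EuclideanSpace ℝ (Fin ν)}

theorem opMa_domain (a : ℝ) (ξ : EuclideanSpace ℝ (Fin ν)) :
    (opMa μ L ω m a ξ).domain = domHat μ L ω m :=
  congrArg (tensorDomain (μ := μ) L) (opMsc_domain a ξ)

theorem ev_opMa {a : ℝ} {Ψ : FiberSpace μ L} (hΨ : Ψ ∈ domHat μ L ω m) (i : Fin L) :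
    ev (opMa μ L ω m a ξ) Ψ i = ev (opMsc μ ω m a ξ) (Ψ i) :=
  ev_tensorOp_one (opMsc μ ω m a ξ) (fun j => by rw [opMsc_domain]; exact hΨ j) i

/-- The form factors of the Hamiltonian at `x` belong to `𝔨`. -/
structure FormFactors (μ : Measure M) [SigmaFinite μ] (ω : M → ℝ) (m : Fin ν → M → ℝ)
    (G : EuclideanSpace ℝ (Fin ν) → Fin ν → OneBoson μ)
    (F : EuclideanSpace ℝ (Fin ν) → Fin S → OneBoson μ)
    (x : EuclideanSpace ℝ (Fin ν)) : Prop where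
  symbols : PosSymbols ω m
  inK_G : ∀ l, InK μ ω m (G x l)
  inK_div : InK μ ω m (divG G x)
  inK_F : ∀ j, InK μ ω m (F x j)
  inK_imDot : InK μ ω m (toL2 μ (imDot m (G x)))
  imDot_eq : toL2 μ (imDot m (G x)) =ᵐ[μ] imDot m (G x)

/-- The regrouping separates `-(i/2) φ(q_x)`, the one term that can destroy symmetry, from the part
that is a sum of squares. -/
theorem FormFactors.mem_scalarHam (hf : FormFactors μ ω m G F x)
    {ψ : Fock μ} (hψ : ψ ∈ (opM μ ω m).domain) :
    ψ ∈ (scalarHam ω m G 0 ξ x).domain ∧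
    ev (scalarHam ω m G 0 ξ x) ψ =
      ev (hKin m (G x) (toL2 μ (imDot m (G x))) ξ) ψ + ev (dGamma μ ω) ψ
        - (I / 2) • ev (field (divG G x)) ψ := by
  have hs := hf.symbols
  have h1 := PosSymbols.kinkin_mem (ξ := ξ) hψ
  have h2 := mem_domain_opDot.2 (hs.fieldkin_mem (ξ := ξ) hf.inK_G hψ)
  have h3 := mem_domain_opDot.2 (hs.fieldfield_mem hf.inK_G hψ)
  have h4 := ladderDomain_le_field _ (hs.mem_ladder hf.inK_div hψ)
  have h5 := ladderDomain_le_field _ (hs.mem_ladder hf.inK_imDot hψ)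
  have h6 := mem_dGamma_of_mem_opM hψ
  have a1 : ψ ∈ ((1 / 2 : ℂ) • opDot (kin μ m ξ) (kin μ m ξ)).domain := h1
  have a2 : ψ ∈ ((1 / 2 : ℂ) • opDot (kin μ m ξ) (kin μ m ξ)
    - opDot (fun l => field (G x l)) (kin μ m ξ)).domain := mem_domain_sub a1 h2
  have a3' : ψ ∈ ((1 / 2 : ℂ) •
    opDot (fun l => field (G x l)) (fun l => field (G x l))).domain := h3
  have a3 := mem_domain_add a2 a3'
  have a4' : ψ ∈ ((I / 2) • field (divG G x)).domain := h4
  have a4 := mem_domain_sub a3 a4'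
  have a5' : ψ ∈ ((I / 2) • field (toL2 μ (imDot m (G x)))).domain := h5
  have a5 := mem_domain_sub a4 a5'
  have a6 := mem_domain_add a5 h6
  have a7' := mem_domain_opScalar (((0 : EuclideanSpace ℝ (Fin ν) → ℝ) x : ℝ) : ℂ) ψ
  have a7 := mem_domain_add a6 a7'
  refine ⟨⟨hψ, a7⟩, ?_⟩
  rw [scalarHam, ev_domRestrict _ hψ a7, ev_add _ _ a6 a7', ev_add _ _ a5 h6, ev_sub _ _ a4 a5',
    ev_sub _ _ a3 a4', ev_add _ _ a2 a3', ev_sub _ _ a1 h2, ev_smul _ _ h1, ev_smul _ _ h3,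
    ev_smul _ _ h4, ev_smul _ _ h5, ev_opScalar, hKin]
  have b3 := mem_domain_sub a3 a5'
  rw [ev_sub _ _ a3 a5', ev_add _ _ a2 a3', ev_sub _ _ a1 h2, ev_smul _ _ h1, ev_smul _ _ h3,
    ev_smul _ _ h5]
  simp only [Pi.zero_apply, ofReal_zero, zero_smul, add_zero]
  abel

theorem FormFactors.mem_fiberHam (hf : FormFactors μ ω m G F x)
    {Ψ : FiberSpace μ L} (hΨ : Ψ ∈ domHat μ L ω m) :
    Ψ ∈ (fiberHam ω m G F σ 0 ξ x).domain ∧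
    ev (fiberHam ω m G F σ 0 ξ x) Ψ =
      ev (tensorOp 1 (hKin m (G x) (toL2 μ (imDot m (G x))) ξ)) Ψ +
        ev (tensorOp 1 (dGamma μ ω)) Ψ + (-(I / 2) • ev (tensorOp 1 (field (divG G x))) Ψ -
        ∑ j, ev (tensorOp (σ j) (field (F x j))) Ψ) := by
  have hs := hf.symbols
  have h1 : Ψ ∈ (tensorOp (1 : Matrix (Fin L) (Fin L) ℂ) (scalarHam ω m G 0 ξ x)).domain :=
    fun i => (hf.mem_scalarHam (hΨ i)).1
  have h2 : ∀ j ∈ Finset.univ, Ψ ∈ (tensorOp (σ j) (field (F x j))).domain :=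
    fun j _ i => ladderDomain_le_field _ (hs.mem_ladder (hf.inK_F j) (hΨ i))
  have h3 := (mem_domain_sum Finset.univ fun j => tensorOp (σ j) (field (F x j))).2 h2
  have h4 := mem_domain_sub h1 h3
  refine ⟨⟨hΨ, h4⟩, ?_⟩
  rw [fiberHam, ev_domRestrict _ hΨ h4, ev_sub _ _ h1 h3, ev_sum _ _ h2]
  rw [← add_sub_assoc]
  congr 1
  ext1 i
  simp only [PiLp.add_apply, PiLp.smul_apply]
  rw [ev_tensorOp_one _ h1, ev_tensorOp_one _ fun j => hs.hKin_mem hf.inK_G hf.inK_imDot (hΨ j),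
    ev_tensorOp_one _ fun j => mem_dGamma_of_mem_opM (hΨ j),
    ev_tensorOp_one _ fun j => ladderDomain_le_field _ (hs.mem_ladder hf.inK_div (hΨ j)),
    (hf.mem_scalarHam (hΨ i)).2, neg_smul, sub_eq_add_neg]

theorem FormFactors.fiberHam_domain (hf : FormFactors μ ω m G F x) :
    (fiberHam ω m G F σ 0 ξ x).domain = domHat μ L ω m :=
  le_antisymm (fun _ h => h.1) fun _ h => (hf.mem_fiberHam h).1

/-- The terms of the Hamiltonian that are linear in the field, without derivatives. -/
theorem FormFactors.norm_linear_le (hf : FormFactors μ ω m G F x)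
    (σ : Fin S → Matrix (Fin L) (Fin L) ℂ) :
    ∃ C : ℝ, 0 ≤ C ∧ ∀ Ψ ∈ domHat μ L ω m,
    ‖-(I / 2) • ev (tensorOp 1 (field (divG G x))) Ψ -
        ∑ j, ev (tensorOp (σ j) (field (F x j))) Ψ‖ ≤ C * ∑ i, wn (pw ω 1) (Ψ i) := by
  have hs := hf.symbols
  have key : ∀ (A : Matrix (Fin L) (Fin L) ℂ) {f : OneBoson μ}, InK μ ω m f →
      ∃ C : ℝ, 0 ≤ C ∧ ∀ Ψ ∈ domHat μ L ω m,
        ‖ev (tensorOp A (field f)) Ψ‖ ≤ C * ∑ i, wn (pw ω 1) (Ψ i) := by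
    intro A f hf
    obtain ⟨C, hC, h1⟩ := norm_tensorOp_le (μ := μ) A
    obtain ⟨c, hc, h2⟩ := hs.norm_field_le hf
    refine ⟨C * c, by positivity, fun Ψ hΨ => ?_⟩
    refine (h1 (field f) Ψ fun j => ladderDomain_le_field _ (hs.mem_ladder hf (hΨ j))).trans ?_
    rw [mul_assoc, Finset.mul_sum Finset.univ (fun i => wn (pw ω 1) (Ψ i)) c]
    exact mul_le_mul_of_nonneg_left (Finset.sum_le_sum fun i _ => h2 _ (hΨ i)) hC
  obtain ⟨C, hC, h1⟩ := key 1 hf.inK_div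
  choose c hc h2 using fun j => key (σ j) (hf.inK_F j)
  refine ⟨C + ∑ j, c j, add_nonneg hC (Finset.sum_nonneg fun j _ => hc j), fun Ψ hΨ => ?_⟩
  refine (norm_sub_le _ _).trans ?_
  rw [add_mul, Finset.sum_mul]
  refine add_le_add ?_ ((norm_sum_le _ _).trans (Finset.sum_le_sum fun j _ => h2 j Ψ hΨ))
  rw [norm_smul]
  have h3 : ‖-(I / 2)‖ ≤ 1 := by
    rw [norm_neg, norm_div, norm_I]
    norm_num
  calc _ ≤ 1 * ‖ev (tensorOp 1 (field (divG G x))) Ψ‖ :=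
        mul_le_mul_of_nonneg_right h3 (norm_nonneg _)
    _ ≤ _ := by rw [one_mul]; exact h1 Ψ hΨ

theorem FormFactors.norm_fiberHam_sub_le (hf : FormFactors μ ω m G F x)
    (σ : Fin S → Matrix (Fin L) (Fin L) ℂ)
    (ξ : EuclideanSpace ℝ (Fin ν)) :
    ∃ C : ℝ, 0 ≤ C ∧ ∀ Ψ ∈ domHat μ L ω m,
    ‖ev (fiberHam ω m G F σ 0 ξ x) Ψ - ev (opMa μ L ω m 1 ξ) Ψ‖ ≤
      C * ∑ i, wn (intWeight ω m ξ) (Ψ i) := by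
  have hs := hf.symbols
  obtain ⟨C, hC, h1⟩ := hf.norm_linear_le σ
  obtain ⟨c, hc, h2⟩ := hs.norm_hKin_sub_le hf.inK_G hf.inK_imDot ξ
  refine ⟨c + C, by positivity, fun Ψ hΨ => ?_⟩
  rw [(hf.mem_fiberHam hΨ).2]
  set R := -(I / 2) • ev (tensorOp 1 (field (divG G x))) Ψ -
        ∑ j, ev (tensorOp (σ j) (field (F x j))) Ψ with hR
  have e1 := h1 Ψ hΨ
  rw [← hR] at e1
  rw [add_sub_right_comm, add_mul]
  refine (norm_add_le _ _).trans (add_le_add ?_ (e1.trans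
    (mul_le_mul_of_nonneg_left (Finset.sum_le_sum fun i _ => hs.wn_pw_le ξ (hΨ i)) hC)))
  refine (norm_fiber_le _).trans ?_
  rw [Finset.mul_sum]
  refine Finset.sum_le_sum fun i _ => ?_
  simp only [PiLp.add_apply, PiLp.sub_apply]
  rw [ev_opMa hΨ, ev_tensorOp_one _ fun j => hs.hKin_mem hf.inK_G hf.inK_imDot (hΨ j),
    ev_tensorOp_one _ fun j => mem_dGamma_of_mem_opM (hΨ j), ev_opMsc (hΨ i)]
  have e2 : ∀ u v w : Fock μ, u + v - (w + ((1 : ℝ) : ℂ) • v) = u - w := fun u v w => by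
    rw [ofReal_one, one_smul]
    abel
  rw [e2]
  exact h2 (Ψ i) (hΨ i)

/-- The relative bound with arbitrarily small constant. -/
theorem FormFactors.relative_bound (hf : FormFactors μ ω m G F x)
    (σ : Fin S → Matrix (Fin L) (Fin L) ℂ)
    (ξ : EuclideanSpace ℝ (Fin ν)) {ε : ℝ} (hε : 0 < ε) : ∃ a : ℝ, 1 ≤ a ∧ ∃ c : ℝ, 0 ≤ c ∧
    ∀ Ψ ∈ domHat μ L ω m,
    ‖ev (fiberHam ω m G F σ 0 ξ x) Ψ - ev (opMa μ L ω m 1 ξ) Ψ‖ ≤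
      ε * ‖ev (opMa μ L ω m a ξ) Ψ‖ + c * ‖Ψ‖ := by
  have hs := hf.symbols
  obtain ⟨C, hC, h1⟩ := hf.norm_fiberHam_sub_le σ ξ
  have hCL : 0 < C * L + 1 := by positivity
  -- Summing over the `L` spin components multiplies the bound by `CL`, hence the division of `ε`;
  -- the added `1` covers `CL = 0`.
  obtain ⟨a, ha, c, hc, h2⟩ := hs.intWeight_le ξ (div_pos hε hCL)
  refine ⟨a, ha, C * L * c, by positivity, fun Ψ hΨ => (h1 Ψ hΨ).trans ?_⟩
  have h3 : ∀ i, wn (intWeight ω m ξ) (Ψ i) ≤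
      ε / (C * L + 1) * ‖ev (opMa μ L ω m a ξ) Ψ‖ + c * ‖Ψ‖ := by
    intro i
    refine (wn_le_of_wave_eq (hs.measurable_symMa a ξ) (wave_opMsc (hΨ i)) (by positivity) hc
      h2).trans ?_
    rw [← ev_opMa hΨ]
    gcongr
    · exact PiLp.norm_apply_le _ i
    · exact PiLp.norm_apply_le _ i
  have h4 := mul_le_mul_of_nonneg_left (Finset.sum_le_sum fun i (_ : i ∈ Finset.univ) => h3 i) hC
  refine h4.trans ?_
  rw [Finset.sum_const, Finset.card_univ, Fintype.card_fin, nsmul_eq_mul, mul_add, mul_add]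
  have h5 : C * L * (ε / (C * L + 1)) ≤ ε := by
    rw [mul_div_assoc', div_le_iff₀ hCL]
    nlinarith
  have h6 := mul_le_mul_of_nonneg_right h5 (norm_nonneg (ev (opMa μ L ω m a ξ) Ψ))
  nlinarith

theorem FormFactors.norm_fiberHam_le (hf : FormFactors μ ω m G F x)
    (σ : Fin S → Matrix (Fin L) (Fin L) ℂ)
    (ξ : EuclideanSpace ℝ (Fin ν)) : ∃ c : ℝ, 0 ≤ c ∧ ∀ Ψ ∈ domHat μ L ω m,
    ‖ev (fiberHam ω m G F σ 0 ξ x) Ψ‖ ≤ c * (‖ev (opMa μ L ω m 1 ξ) Ψ‖ + ‖Ψ‖) := by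
  have hs := hf.symbols
  obtain ⟨C, hC, h1⟩ := hf.norm_fiberHam_sub_le σ ξ
  refine ⟨C * L * 2 + 1, by positivity, fun Ψ hΨ => ?_⟩
  have h3 : ∀ i, wn (intWeight ω m ξ) (Ψ i) ≤ 2 * (‖ev (opMa μ L ω m 1 ξ) Ψ‖ + ‖Ψ‖) := by
    intro i
    refine (hs.wn_intWeight_le ξ (hΨ i)).trans ?_
    rw [← ev_opMa hΨ]
    have := PiLp.norm_apply_le (ev (opMa μ L ω m 1 ξ) Ψ) i
    have := PiLp.norm_apply_le Ψ i
    linarith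
  have h4 := mul_le_mul_of_nonneg_left (Finset.sum_le_sum fun i (_ : i ∈ Finset.univ) => h3 i) hC
  rw [Finset.sum_const, Finset.card_univ, Fintype.card_fin, nsmul_eq_mul] at h4
  have h5 := norm_le_norm_sub_add (ev (fiberHam ω m G F σ 0 ξ x) Ψ) (ev (opMa μ L ω m 1 ξ) Ψ)
  have h6 := h1 Ψ hΨ
  have := norm_nonneg Ψ
  nlinarith

theorem PosSymbols.norm_opMa_le (hs : PosSymbols ω m) (ξ η : EuclideanSpace ℝ (Fin ν)) :
    ∃ c : ℝ, 0 ≤ c ∧ ∀ Ψ ∈ domHat μ L ω m,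
      ‖ev (opMa μ L ω m 1 ξ) Ψ‖ ≤ c * (‖ev (opMa μ L ω m 1 η) Ψ‖ + ‖Ψ‖) := by
  obtain ⟨c, hc, h⟩ := hs.norm_opMsc_le (μ := μ) le_rfl le_rfl ξ η
  refine ⟨L * c, by positivity, fun Ψ hΨ => (norm_fiber_le _).trans ?_⟩
  have h3 : ∀ i, ‖ev (opMa μ L ω m 1 ξ) Ψ i‖ ≤ c * (‖ev (opMa μ L ω m 1 η) Ψ‖ + ‖Ψ‖) := by
    intro i
    rw [ev_opMa hΨ]
    refine (h _ (hΨ i)).trans (mul_le_mul_of_nonneg_left ?_ hc)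
    rw [← ev_opMa hΨ]
    exact add_le_add (PiLp.norm_apply_le _ i) (PiLp.norm_apply_le _ i)
  refine (Finset.sum_le_sum fun i _ => h3 i).trans ?_
  simp [mul_assoc]

end Fiber

end FiberHam

end
-- Closedness, transfer of cores and self-adjointness of the fiber Hamiltonian
noncomputable section

namespace FiberHam

section FiberClosed

variable {M : Type*} [MeasurableSpace M] {μ : Measure M} [SigmaFinite μ] {ν S L : ℕ}
  {ω : M → ℝ} {m : Fin ν → M → ℝ}
  {G : EuclideanSpace ℝ (Fin ν) → Fin ν → OneBoson μ}
  {F : EuclideanSpace ℝ (Fin ν) → Fin S → OneBoson μ}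
  {σ : Fin S → Matrix (Fin L) (Fin L) ℂ} {ξ x : EuclideanSpace ℝ (Fin ν)}

theorem isSelfAdjoint_of_domain_eq {E : Type*} [NormedAddCommGroup E] [InnerProductSpace ℂ E]
    [CompleteSpace E] {A : E →ₗ.[ℂ] E} {D : Submodule ℂ E} (hd : A.domain = D)
    (hsymm : SymmOn (evL A hd.ge)) {κ : ℝ} (hκ : κ ≠ 0)
    (hp : SurjAt (evL A hd.ge) κ) (hm : SurjAt (evL A hd.ge) (-κ)) :
    IsSelfAdjoint A := by
  subst hd
  exact isSelfAdjoint_of_surjective_evL hsymm hκ hp hm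

/-! ### Self-adjointness of `M_a(ξ)` -/

/-- The preimage is `η` multiplied by the bounded function `1/(symbol + iκ)`. It lies in the common
domain because the symbols of `M_1(0)` and `M_a(ξ)` are comparable. -/
theorem PosSymbols.surjective_opMsc (hs : PosSymbols ω m) {a : ℝ} (ha : 1 ≤ a)
    (ξ : EuclideanSpace ℝ (Fin ν)) {κ : ℝ} (hκ : κ ≠ 0) (η : Fock μ) :
    ∃ ψ ∈ (opM μ ω m).domain, ev (opMsc μ ω m a ξ) ψ + (κ * I : ℂ) • ψ = η := by
  have hκ2 : 0 < κ ^ 2 := by positivity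
  have hsq : ∀ n (k : Fin n → M),
      ‖((symMa ω m a ξ n k : ℂ) + κ * I)⁻¹‖ ^ 2 = (symMa ω m a ξ n k ^ 2 + κ ^ 2)⁻¹ := by
    intro n k
    rw [norm_inv, inv_pow, ← normSq_eq_norm_sq, normSq_add_mul_I]
  obtain ⟨ψ, hψ⟩ := exists_mul (ψ := η) (g := fun n k => ((symMa ω m a ξ n k : ℂ) + κ * I)⁻¹)
    (fun n => ((measurable_ofReal.comp (hs.measurable_symMa a ξ n)).add_const _).inv)
    (fun n π k => by rw [symMa_perm]) (by
      refine ne_top_of_le_ne_top (b := wsq (fun _ _ => (κ ^ 2)⁻¹ * 1) η) ?_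
        (wsq_mono η fun n k => ?_)
      · rw [wsq_const_mul (fun _ _ => 1) η (by positivity), ← ofReal_norm_sq]
        exact ENNReal.mul_ne_top ENNReal.ofReal_ne_top ENNReal.ofReal_ne_top
      · rw [hsq, mul_one]
        exact inv_anti₀ hκ2 (by nlinarith [sq_nonneg (symMa ω m a ξ n k)]))
  have hmem : ψ ∈ (opM μ ω m).domain := by
    rw [hs.mem_opM_domain_iff, wsq_of_wave_eq hψ]
    obtain ⟨c, hc, h⟩ := hs.symMa_le le_rfl ha 0 ξ
    refine ne_top_of_le_ne_top (b := wsq (fun _ _ => (c ^ 2 + c ^ 2 * (κ ^ 2)⁻¹) * 1) η) ?_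
      (wsq_mono η fun n k => ?_)
    · rw [wsq_const_mul (fun _ _ => 1) η (by positivity), ← ofReal_norm_sq]
      exact ENNReal.mul_ne_top ENNReal.ofReal_ne_top ENNReal.ofReal_ne_top
    · rw [hsq, mul_one, ← div_eq_mul_inv, div_le_iff₀ (by positivity)]
      refine (h n k).trans ?_
      have : (c ^ 2 + c ^ 2 * (κ ^ 2)⁻¹) * (symMa ω m a ξ n k ^ 2 + κ ^ 2) =
          c ^ 2 * symMa ω m a ξ n k ^ 2 + c ^ 2 +
            (c ^ 2 * κ ^ 2 + c ^ 2 * (κ ^ 2)⁻¹ * symMa ω m a ξ n k ^ 2) := by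
        field_simp
        ring
      rw [this]
      have : 0 ≤ c ^ 2 * κ ^ 2 + c ^ 2 * (κ ^ 2)⁻¹ * symMa ω m a ξ n k ^ 2 := by positivity
      linarith
  refine ⟨ψ, hmem, wave_ext fun n => ?_⟩
  filter_upwards [wave_add (ev (opMsc μ ω m a ξ) ψ) ((κ * I : ℂ) • ψ) n,
    wave_smul (κ * I : ℂ) ψ n, wave_opMsc hmem n, hψ n] with k h1 h2 h3 h4
  rw [h1, h2, h3, h4]
  have hne : (symMa ω m a ξ n k : ℂ) + κ * I ≠ 0 := by
    intro h0
    have := congrArg im h0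
    simp at this
    exact hκ this
  field_simp

theorem inner_opMsc {a : ℝ} {φ ψ : Fock μ} (hφ : φ ∈ (opM μ ω m).domain)
    (hψ : ψ ∈ (opM μ ω m).domain) :
    inner ℂ (ev (opMsc μ ω m a ξ) φ) ψ = inner ℂ φ (ev (opMsc μ ω m a ξ) ψ) := by
  refine inner_congr_wave fun n => ?_
  filter_upwards [wave_opMsc (a := a) (ξ := ξ) hφ n, wave_opMsc (a := a) (ξ := ξ) hψ n]
    with k h1 h2
  rw [h1, h2, map_mul, conj_ofReal]
  ring

theorem symmOn_opMa (a : ℝ) (ξ : EuclideanSpace ℝ (Fin ν)) :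
    SymmOn (evL (opMa μ L ω m a ξ) (opMa_domain a ξ).ge) := fun Φ Ψ =>
  inner_tensorOp (T := opMsc μ ω m a ξ) Matrix.isHermitian_one (opMsc_domain a ξ).ge
    (fun _ hφ _ hψ => inner_opMsc hφ hψ) Φ.2 Ψ.2

theorem PosSymbols.surjective_opMa (hs : PosSymbols ω m) {a : ℝ} (ha : 1 ≤ a)
    (ξ : EuclideanSpace ℝ (Fin ν)) {κ : ℝ} (hκ : κ ≠ 0) :
    SurjAt (evL (opMa μ L ω m a ξ) (opMa_domain (L := L) (μ := μ) a ξ).ge) κ := by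
  intro Φ
  choose ψ hψ h using fun i => hs.surjective_opMsc ha ξ hκ (Φ i)
  have hmem : (WithLp.toLp 2 ψ : FiberSpace μ L) ∈ domHat μ L ω m := hψ
  refine ⟨⟨WithLp.toLp 2 ψ, hmem⟩, ?_⟩
  ext1 i
  rw [LinearMap.add_apply, LinearMap.smul_apply, PiLp.add_apply, PiLp.smul_apply, evL_apply,
    ev_opMa hmem]
  exact h i

theorem PosSymbols.isSelfAdjoint_opMa (hs : PosSymbols ω m) {a : ℝ} (ha : 1 ≤ a)
    (ξ : EuclideanSpace ℝ (Fin ν)) : IsSelfAdjoint (opMa μ L ω m a ξ) :=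
  isSelfAdjoint_of_domain_eq (opMa_domain a ξ) (symmOn_opMa a ξ) one_ne_zero
    (hs.surjective_opMa ha ξ one_ne_zero) (hs.surjective_opMa ha ξ (neg_ne_zero.2 one_ne_zero))

/-! ### The a priori estimate for the Hamiltonian -/

theorem domHat_le_dGamma :
    domHat μ L ω m ≤ (tensorOp (1 : Matrix (Fin L) (Fin L) ℂ) (dGamma μ ω)).domain :=
  fun _ hΨ i => mem_dGamma_of_mem_opM (hΨ i)

variable (μ L ω m) in
/-- The operator `1 ⊗ dΓ(ω)` on `D̂`. -/
def dGammaFiber : domHat μ L ω m →ₗ[ℂ] FiberSpace μ L :=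
  evL (tensorOp 1 (dGamma μ ω)) domHat_le_dGamma

theorem dGammaFiber_apply (Ψ : domHat μ L ω m) (i : Fin L) :
    dGammaFiber μ L ω m Ψ i = ev (dGamma μ ω) (Ψ.1 i) :=
  ev_tensorOp_one _ (fun j => mem_dGamma_of_mem_opM (Ψ.2 j)) i

theorem symmOn_dGammaFiber : SymmOn (dGammaFiber μ L ω m) := fun Φ Ψ =>
  inner_tensorOp (T := dGamma μ ω) Matrix.isHermitian_one (fun _ => mem_dGamma_of_mem_opM)
    (fun _ hφ _ hψ => inner_dGamma (mem_dGamma_of_mem_opM hφ) (mem_dGamma_of_mem_opM hψ)) Φ.2 Ψ.2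

theorem PosSymbols.re_inner_dGammaFiber (hs : PosSymbols ω m) (Ψ : domHat μ L ω m) :
    0 ≤ (inner ℂ (dGammaFiber μ L ω m Ψ) (Ψ : FiberSpace μ L)).re := by
  rw [symmOn_dGammaFiber Ψ Ψ, PiLp.inner_apply, re_sum]
  refine Finset.sum_nonneg fun i _ => ?_
  rw [dGammaFiber_apply]
  exact re_inner_nonneg_of_wave (wave_dGamma (mem_dGamma_of_mem_opM (Ψ.2 i)))
    (fun n k => sym_nonneg hs.pos n k)

theorem evL_opMa_eq (a : ℝ) (ξ : EuclideanSpace ℝ (Fin ν)) :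
    evL (opMa μ L ω m a ξ) (opMa_domain a ξ).ge =
      evL (opMa μ L ω m 1 ξ) (opMa_domain 1 ξ).ge + ((a - 1 : ℝ) : ℂ) • dGammaFiber μ L ω m := by
  ext1 Ψ
  ext1 i
  rw [LinearMap.add_apply, LinearMap.smul_apply, PiLp.add_apply, PiLp.smul_apply, evL_apply,
    evL_apply, ev_opMa Ψ.2, ev_opMa Ψ.2, dGammaFiber_apply, ev_opMsc (Ψ.2 i), ev_opMsc (Ψ.2 i)]
  push_cast
  module

set_option maxHeartbeats 1000000 in
-- The operator `H + (b - 1)Ω` is `K + bΩ + R`, with `K` the sum of squares and `R` linear in the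
-- field. `K` is almost nonnegative against `1 + Ω`, and `R` needs only half a power of it, so `bΩ`
-- dominates. The constant does not depend on `b`, as the continuity method demands.
theorem FormFactors.norm_dGammaFiber_le (hf : FormFactors μ ω m G F x)
    (σ : Fin S → Matrix (Fin L) (Fin L) ℂ) (ξ : EuclideanSpace ℝ (Fin ν)) :
    ∃ C : ℝ, ∀ b : ℝ, 1 ≤ b → ∀ Ψ : domHat μ L ω m,
      ‖(Ψ : FiberSpace μ L) + dGammaFiber μ L ω m Ψ‖ ≤
        C * (‖ev (fiberHam ω m G F σ 0 ξ x) Ψ +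
          ((b - 1 : ℝ) : ℂ) • dGammaFiber μ L ω m Ψ‖ + ‖Ψ‖) := by
  have hs := hf.symbols
  obtain ⟨c₁, hc₁, h₁⟩ := hs.re_inner_hKin_ge hf.inK_G hf.inK_imDot hf.imDot_eq ξ
  obtain ⟨C, hC, h₂⟩ := hf.norm_linear_le σ
  have hK : domHat μ L ω m ≤ (tensorOp (1 : Matrix (Fin L) (Fin L) ℂ)
      (hKin m (G x) (toL2 μ (imDot m (G x))) ξ)).domain :=
    fun _ hΨ i => hs.hKin_mem hf.inK_G hf.inK_imDot (hΨ i)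
  have hH : domHat μ L ω m ≤ (fiberHam ω m G F σ 0 ξ x).domain := hf.fiberHam_domain.ge
  set K := evL _ hK with hKdef
  set Ω := dGammaFiber μ L ω m with hΩdef
  set R := evL _ hH - K - Ω with hRdef
  have hT : ∀ (Ψ : domHat μ L ω m) i, ((Ψ : FiberSpace μ L) + Ω Ψ) i =
      Ψ.1 i + ev (dGamma μ ω) (Ψ.1 i) := fun Ψ i => by
    rw [PiLp.add_apply, hΩdef, dGammaFiber_apply]
  have hR : ∀ Ψ : domHat μ L ω m, ‖R Ψ‖ ≤ C * ∑ i, wn (pw ω 1) (Ψ.1 i) := by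
    intro Ψ
    convert h₂ Ψ Ψ.2 using 2
    rw [hRdef, LinearMap.sub_apply, LinearMap.sub_apply, evL_apply, hKdef, evL_apply,
      (hf.mem_fiberHam Ψ.2).2, hΩdef, dGammaFiber, evL_apply]
    abel
  -- Makes `CLδ ≤ 1/4`, the share of `‖(1 + Ω)Ψ‖` that `norm_le_of_re_inner_ge` allows for `R`.
  set δ := 1 / (4 * (C * L + 1)) with hδ
  have hδ0 : 0 < δ := by positivity
  set c := c₁ + C * L * (1 / (2 * δ)) with hc
  have hc0 : 0 ≤ c := by positivity
  refine ⟨4 * c + 4, fun b hb Ψ => ?_⟩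
  have main := norm_le_of_re_inner_ge (K := K) (Ω := Ω) (R := R) hc0
    (fun Ψ => hs.re_inner_dGammaFiber Ψ) (fun Ψ => ?_) (fun Ψ => ?_) hb Ψ
  · have e : K Ψ + (b : ℂ) • Ω Ψ + R Ψ =
        ev (fiberHam ω m G F σ 0 ξ x) Ψ + ((b - 1 : ℝ) : ℂ) • Ω Ψ := by
      rw [hRdef, LinearMap.sub_apply, LinearMap.sub_apply, evL_apply _ hH, ofReal_sub, ofReal_one,
        sub_smul, one_smul]
      abel
    rw [e] at main
    exact main
  · rw [PiLp.inner_apply, re_sum, PiLp.norm_sq_eq_of_L2]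
    have e1 : ‖Ψ‖ ^ 2 = ∑ i, ‖Ψ.1 i‖ ^ 2 := PiLp.norm_sq_eq_of_L2 _ Ψ.1
    rw [e1, Finset.mul_sum, Finset.mul_sum, ← Finset.sum_add_distrib, ← Finset.sum_neg_distrib]
    refine Finset.sum_le_sum fun i _ => ?_
    rw [hT, hKdef, evL_apply,
      ev_tensorOp_one _ fun j => hs.hKin_mem hf.inK_G hf.inK_imDot (Ψ.2 j)]
    refine le_trans ?_ (h₁ _ (Ψ.2 i))
    have e2 : 0 ≤ C * L * (1 / (2 * δ)) := by positivity
    have e3 := mul_nonneg e2 (sq_nonneg ‖Ψ.1 i‖)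
    rw [hc]
    linarith
  · refine (hR Ψ).trans ?_
    have e1 : ∀ i, wn (pw ω 1) (Ψ.1 i) ≤
        δ * ‖(Ψ : FiberSpace μ L) + Ω Ψ‖ + 1 / (2 * δ) * ‖Ψ‖ := by
      intro i
      refine (wn_pw_le_eps hs hδ0 (Ψ.2 i)).trans ?_
      rw [← hT]
      gcongr
      · exact PiLp.norm_apply_le _ i
      · exact PiLp.norm_apply_le Ψ.1 i
    have e2 := mul_le_mul_of_nonneg_left
      (Finset.sum_le_sum fun i (_ : i ∈ Finset.univ) => e1 i) hC
    rw [Finset.sum_const, Finset.card_univ, Fintype.card_fin, nsmul_eq_mul, mul_add, mul_add] at e2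
    have e3 : C * L * δ ≤ 1 / 4 := by
      rw [hδ, mul_one_div, div_le_div_iff₀ (by positivity) (by norm_num)]
      linarith
    have e4 := mul_le_mul_of_nonneg_right e3 (norm_nonneg ((Ψ : FiberSpace μ L) + Ω Ψ))
    have e5 := mul_nonneg hc₁ (norm_nonneg Ψ)
    rw [hc]
    nlinarith

/-- The reverse comparison of graph norms. The relative bound is used at `ε = 1/2`; the surplus `(a
- 1)Ω` in `M_a` is paid for by the a priori bound at `b = 1`. -/
theorem FormFactors.norm_opMa_le (hf : FormFactors μ ω m G F x)
    (σ : Fin S → Matrix (Fin L) (Fin L) ℂ) (ξ : EuclideanSpace ℝ (Fin ν)) :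
    ∃ c : ℝ, 0 ≤ c ∧ ∀ Ψ ∈ domHat μ L ω m,
      ‖ev (opMa μ L ω m 1 ξ) Ψ‖ ≤ c * (‖ev (fiberHam ω m G F σ 0 ξ x) Ψ‖ + ‖Ψ‖) := by
  obtain ⟨C, hC⟩ := hf.norm_dGammaFiber_le σ ξ
  obtain ⟨a, ha, c, hc, h⟩ := hf.relative_bound σ ξ one_half_pos
  refine ⟨2 + 2 * |c| + 2 * (a - 1) * (|C| + 1), ?_, fun Ψ hΨ => ?_⟩
  · have : 0 ≤ a - 1 := by linarith
    positivity
  have hH : domHat μ L ω m ≤ (fiberHam ω m G F σ 0 ξ x).domain := hf.fiberHam_domain.ge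
  set Mo := evL (opMa μ L ω m 1 ξ) (opMa_domain 1 ξ).ge with hMo
  have e0 : Mo + (evL _ hH - Mo) = evL _ hH := by abel
  have := norm_le_of_relative_bound (Mo := Mo) (Ω := dGammaFiber μ L ω m) (W := evL _ hH - Mo)
    (c := c) (C := C) ha (fun Ψ => ?_) (fun Ψ => ?_) ⟨Ψ, hΨ⟩
  · rw [e0] at this
    exact this
  · have e1 := h Ψ Ψ.2
    have e2 := LinearMap.congr_fun (evL_opMa_eq (μ := μ) (L := L) (ω := ω) (m := m) a ξ) Ψ
    rw [evL_apply] at e2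
    rw [e2] at e1
    exact e1
  · rw [e0]
    have e1 := hC 1 le_rfl Ψ
    simp only [sub_self, ofReal_zero, zero_smul, add_zero] at e1
    exact e1

theorem FormFactors.isClosed_fiberHam (hf : FormFactors μ ω m G F x) :
    (fiberHam ω m G F σ 0 ξ x).IsClosed := by
  have hs := hf.symbols
  obtain ⟨c₁, hc₁, h₁⟩ := hf.norm_fiberHam_le σ ξ
  obtain ⟨c₂, hc₂, h₂⟩ := hf.norm_opMa_le σ ξ
  refine isClosed_of_graphNorm_equiv (A := opMa μ L ω m 1 ξ)
    ((opMa_domain 1 ξ).trans hf.fiberHam_domain.symm)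
    (hs.isSelfAdjoint_opMa le_rfl ξ).isClosed (c := c₁ + c₂) (fun Ψ hΨ => ?_) (fun Ψ hΨ => ?_)
  · rw [opMa_domain] at hΨ
    exact (h₁ Ψ hΨ).trans (mul_le_mul_of_nonneg_right (by linarith) (by positivity))
  · rw [opMa_domain] at hΨ
    exact (h₂ Ψ hΨ).trans (mul_le_mul_of_nonneg_right (by linarith) (by positivity))

/-- Cores are compared through `M_1(0)`, whose graph norm dominates that of `M_1(ξ)` and hence that
of `H`. -/
theorem FormFactors.hasCore_fiberHam (hf : FormFactors μ ω m G F x)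
    {D : Submodule ℂ (FiberSpace μ L)} (hD : (opMa μ L ω m 1 0).HasCore D) :
    (fiberHam ω m G F σ 0 ξ x).HasCore D := by
  have hs := hf.symbols
  obtain ⟨c₁, hc₁, h₁⟩ := hf.norm_fiberHam_le σ ξ
  obtain ⟨c₂, hc₂, h₂⟩ := hs.norm_opMa_le (μ := μ) (L := L) ξ 0
  refine hasCore_of_graphNorm_le (c := c₁ * (c₂ + 1))
    ((opMa_domain 1 0).trans hf.fiberHam_domain.symm)
    (hs.isSelfAdjoint_opMa le_rfl 0).isClosed hf.isClosed_fiberHam (fun Ψ hΨ => ?_) hD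
  rw [opMa_domain] at hΨ
  refine (h₁ Ψ hΨ).trans ?_
  rw [mul_assoc]
  refine mul_le_mul_of_nonneg_left ?_ hc₁
  have := h₂ Ψ hΨ
  have := norm_nonneg (ev (opMa μ L ω m 1 0) Ψ)
  linarith

/-- When `q_x = 0` every remaining term is symmetric: the sum of squares, `Ω`, and Hermitian
matrices tensored with field operators. That `φ(0)` vanishes on the domain is checked from the
ladder formulas. -/
theorem FormFactors.symmOn_fiberHam (hf : FormFactors μ ω m G F x)
    (hσ : ∀ j, (σ j).IsHermitian) (hdiv : divG G x = 0) :
    SymmOn (evL (fiberHam ω m G F σ 0 ξ x) (hf.fiberHam_domain (L := L)).ge) := by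
  have hs := hf.symbols
  intro Φ Ψ
  have hfield : ∀ {f : OneBoson μ}, InK μ ω m f → (opM μ ω m).domain ≤ (field f).domain :=
    fun hf _ hψ => ladderDomain_le_field _ (hs.mem_ladder hf hψ)
  have hsym : ∀ {A : Matrix (Fin L) (Fin L) ℂ} {f : OneBoson μ}, A.IsHermitian → InK μ ω m f →
      inner ℂ (ev (tensorOp A (field f)) Φ.1) Ψ.1 = inner ℂ Φ.1 (ev (tensorOp A (field f)) Ψ.1) :=
    fun hA hf => inner_tensorOp hA (hfield hf)
      (fun _ hφ _ hψ => inner_field (hs.mem_ladder hf hφ) (hs.mem_ladder hf hψ)) Φ.2 Ψ.2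
  have hzero : ∀ Ψ : domHat μ L ω m,
      ev (tensorOp (1 : Matrix (Fin L) (Fin L) ℂ) (field (divG G x))) Ψ.1 = 0 := by
    intro Ψ
    have hmem : ∀ i, Ψ.1 i ∈ ladderDomain (0 : OneBoson μ) :=
      fun i => hdiv ▸ hs.mem_ladder hf.inK_div (Ψ.2 i)
    rw [hdiv]
    ext1 i
    rw [ev_tensorOp_one _ fun j => ladderDomain_le_field _ (hmem j)]
    have e1 : ev (creation (0 : OneBoson μ)) (Ψ.1 i) = 0 := by
      refine ev_eq_of_mem_graph (mem_graph_creation.2 ⟨wave_zero 0, fun n => ?_⟩)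
      filter_upwards [wave_zero (μ := μ) (n + 1), ae_coord (Lp.coeFn_zero ℂ 2 μ) (n + 1)]
        with k h1 h2
      have h3 : ∀ l, (0 : OneBoson μ) (k l) = 0 := h2
      simp only [h1, h3, zero_mul, Finset.sum_const_zero, mul_zero]
    have e2 : ev (annihilation (0 : OneBoson μ)) (Ψ.1 i) = 0 := by
      refine ev_eq_of_mem_graph (mem_graph_annihilation.2 fun n => ?_)
      filter_upwards [wave_zero (μ := μ) n] with k h1
      rw [h1, integral_eq_zero_of_ae, mul_zero]
      filter_upwards [Lp.coeFn_zero ℂ 2 μ] with y hy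
      have h3 : (0 : OneBoson μ) y = 0 := hy
      simp only [h3, map_zero, zero_mul, Pi.zero_apply]
    rw [ev_field (hmem i), e1, e2, add_zero]
    rfl
  have hform : ∀ Ψ : domHat μ L ω m, ev (fiberHam ω m G F σ 0 ξ x) Ψ.1 =
      ev (tensorOp 1 (hKin m (G x) (toL2 μ (imDot m (G x))) ξ)) Ψ.1 + dGammaFiber μ L ω m Ψ -
        ∑ j, ev (tensorOp (σ j) (field (F x j))) Ψ.1 := by
    intro Ψ
    rw [(hf.mem_fiberHam Ψ.2).2, hzero, smul_zero, zero_sub, ← sub_eq_add_neg]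
    rfl
  rw [evL_apply, evL_apply, hform, hform, inner_sub_left, inner_sub_right, inner_add_left,
    inner_add_right, sum_inner, inner_sum, symmOn_dGammaFiber Φ Ψ,
    inner_tensorOp Matrix.isHermitian_one (fun _ => hs.hKin_mem hf.inK_G hf.inK_imDot)
      (fun _ hφ _ hψ => hs.inner_hKin hf.inK_G hf.inK_imDot hf.imDot_eq hφ hψ) Φ.2 Ψ.2]
  congr 1
  exact Finset.sum_congr rfl fun j _ => hsym (hσ j) (hf.inK_F j)

/-- The threshold `4|c| + 1` on `|κ|` makes the `c‖ψ‖` part of the relative bound small against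
`|κ|‖ψ‖`; both signs of `κ` are needed. -/
theorem FormFactors.isSelfAdjoint_fiberHam (hf : FormFactors μ ω m G F x)
    (hσ : ∀ j, (σ j).IsHermitian) (hdiv : divG G x = 0) :
    IsSelfAdjoint (fiberHam ω m G F σ 0 ξ x) := by
  have hs := hf.symbols
  have hsymm := hf.symmOn_fiberHam (σ := σ) (ξ := ξ) hσ hdiv
  obtain ⟨C, hC⟩ := hf.norm_dGammaFiber_le σ ξ
  obtain ⟨a, ha, c, hc, h⟩ := hf.relative_bound σ ξ one_half_pos
  set Hf := evL (fiberHam ω m G F σ 0 ξ x) (hf.fiberHam_domain (L := L)).ge with hHf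
  set Mo := evL (opMa μ L ω m 1 ξ) (opMa_domain 1 ξ).ge with hMo
  have e0 : Mo + (Hf - Mo) = Hf := by abel
  have hMs : SymmOn Mo := symmOn_opMa 1 ξ
  have hW : SymmOn (Hf - Mo) := fun Φ Ψ => by
    rw [LinearMap.sub_apply, LinearMap.sub_apply, inner_sub_left, inner_sub_right, hsymm, hMs]
  have key : ∀ κ : ℝ, 4 * |c| + 1 ≤ |κ| →
      SurjAt Hf κ := by
    intro κ hκ
    have hκ0 : κ ≠ 0 := by
      rintro rfl
      rw [abs_zero] at hκ
      linarith [abs_nonneg c]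
    have := surjective_of_relative_bound (Mo := Mo) (Ω := dGammaFiber μ L ω m) (W := Hf - Mo)
      (c := c) (C := C) (κ := κ) ha hMs symmOn_dGammaFiber hW (fun Ψ => ?_) (fun b hb Ψ => ?_) hκ
      (by rw [← evL_opMa_eq]; exact hs.surjective_opMa ha ξ hκ0)
    · rw [e0] at this
      exact this
    · have e1 := h Ψ Ψ.2
      have e2 := LinearMap.congr_fun (evL_opMa_eq (μ := μ) (L := L) (ω := ω) (m := m) a ξ) Ψ
      rw [evL_apply] at e2
      rw [e2] at e1
      exact e1
    · have e1 := hC b hb Ψ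
      have e2 : Mo Ψ + ((b - 1 : ℝ) : ℂ) • dGammaFiber μ L ω m Ψ + (Hf - Mo) Ψ =
          ev (fiberHam ω m G F σ 0 ξ x) Ψ + ((b - 1 : ℝ) : ℂ) • dGammaFiber μ L ω m Ψ := by
        rw [LinearMap.sub_apply, hHf, evL_apply]
        abel
      rw [e2]
      exact e1
  refine isSelfAdjoint_of_domain_eq hf.fiberHam_domain hsymm (κ := 4 * |c| + 1) (by positivity)
    (key _ (le_abs_self _)) (key _ ?_)
  rw [abs_neg]
  exact le_abs_self _

end FiberClosed

end FiberHam

end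
-- Exponential vectors in the domain of `M`, and polarization of tensor powers
noncomputable section

namespace FiberHam

section Core

variable {M : Type*} [MeasurableSpace M] {μ : Measure M} [SigmaFinite μ] {ν L : ℕ}
  {ω : M → ℝ} {m : Fin ν → M → ℝ}

open scoped ENNReal

/-! ### Products of one-boson functions -/

/-- Membership in `𝔡 = dom(ω + ½ m²)`. -/
def InD (μ : Measure M) (ω : M → ℝ) (m : Fin ν → M → ℝ) (f : M → ℂ) : Prop :=
  MemLp (fun k => (totalSymbol ω m k : ℂ) * f k) 2 μ

theorem PosSymbols.totalSymbol_pos (hs : PosSymbols ω m) (k : M) : 0 < totalSymbol ω m k :=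
  add_pos_of_pos_of_nonneg (hs.pos k)
    (mul_nonneg (by norm_num) (Finset.sum_nonneg fun _ _ => sq_nonneg _))

theorem PosSymbols.measurable_totalSymbol (hs : PosSymbols ω m) :
    Measurable (totalSymbol ω m) :=
  hs.meas_omega.add (Measurable.const_mul
    (Finset.measurable_sum _ fun l _ => (hs.meas_m l).pow_const 2) _)

/-- Induction on `n`, with `(s + t)² ≤ 2s² + 2t²` causing the factor `2` per particle. A product
majorant of the additive symbol keeps product vectors within reach of one-boson estimates. -/
theorem PosSymbols.one_add_symMa_le (hs : PosSymbols ω m) (n : ℕ) (k : Fin n → M) :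
    1 + symMa ω m 1 0 n k ≤ ∏ i, 2 * (1 + totalSymbol ω m (k i)) := by
  induction n with
  | zero => simp [symMa, symX, sym]
  | succ n ih =>
    have h := ih fun i => k i.succ
    rw [Fin.prod_univ_succ]
    have hτ := hs.totalSymbol_pos (k 0)
    set P := ∏ i : Fin n, 2 * (1 + totalSymbol ω m (k i.succ))
    have hΩ := sym_nonneg hs.pos n fun i => k i.succ
    have hX := symX_nonneg m 0 n fun i => k i.succ
    have e1 : sym ω (n + 1) k = ω (k 0) + sym ω n fun i => k i.succ := Fin.sum_univ_succ _
    have e2 : symX m 0 (n + 1) k ≤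
        2 * ∑ l, m l (k 0) ^ 2 + 2 * symX m 0 n fun i => k i.succ := by
      rw [symX, symX, Finset.mul_sum, Finset.mul_sum, ← Finset.sum_add_distrib]
      refine Finset.sum_le_sum fun l _ => ?_
      have e3 : sym (m l) (n + 1) k = m l (k 0) + sym (m l) n fun i => k i.succ :=
        Fin.sum_univ_succ _
      rw [e3]
      change ((0 : ℝ) - _) ^ 2 ≤ _ + 2 * ((0 : ℝ) - _) ^ 2
      nlinarith [sq_nonneg (m l (k 0) - sym (m l) n fun i => k i.succ)]
    have e4 : totalSymbol ω m (k 0) = ω (k 0) + 1 / 2 * ∑ l, m l (k 0) ^ 2 := rfl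
    rw [symMa] at h ⊢
    rw [e1]
    have hω := hs.pos (k 0)
    set X := symX m 0 n fun i => k i.succ
    set Ω := sym ω n fun i => k i.succ
    set Q := ∑ l, m l (k 0) ^ 2
    have hP : 1 ≤ P := by linarith
    nlinarith [mul_le_mul_of_nonneg_left hP hτ.le]

theorem PosSymbols.symMa_nonneg (hs : PosSymbols ω m) (n : ℕ) (k : Fin n → M) :
    0 ≤ symMa ω m 1 0 n k := by
  have hΩ := sym_nonneg hs.pos n k
  have hX := symX_nonneg m 0 n k
  rw [symMa]
  positivity

theorem memLp_prod {n : ℕ} {h : Fin n → M → ℂ} (hh : ∀ i, MemLp (h i) 2 μ) :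
    MemLp (fun k : Fin n → M => ∏ i, h i (k i)) 2 (prodMeas μ n) := by
  have hm : AEStronglyMeasurable (fun k : Fin n → M => ∏ i, h i (k i)) (prodMeas μ n) :=
    Finset.aestronglyMeasurable_fun_prod _ fun i _ => aesm_coord (hh i).1 n i
  refine (memLp_two_iff_integrable_sq_norm hm).2 ?_
  have := Integrable.fintype_prod (ι := Fin n) (𝕜 := ℝ) (f := fun i k => ‖h i k‖ ^ 2)
    (μ := fun _ => μ) (fun i => (memLp_two_iff_integrable_sq_norm (hh i).1).1 (hh i))
  simpa only [norm_prod, Finset.prod_pow] using this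

theorem InD.memLp_weight {f : OneBoson μ} (hf : InD μ ω m f) :
    MemLp (fun k => ((2 * (1 + totalSymbol ω m k) : ℝ) : ℂ) * f k) 2 μ := by
  have := ((Lp.memLp f).add hf).const_mul (2 : ℂ)
  refine this.ae_eq (Filter.Eventually.of_forall fun k => ?_)
  simp only [Pi.add_apply]
  push_cast
  ring

theorem wave_expVec (h : OneBoson μ) (n : ℕ) :
    (expVec h).wave n =ᵐ[prodMeas μ n]
      fun k => (((Real.sqrt (n.factorial))⁻¹ : ℂ) * I ^ n) * ∏ i, h (k i) := by
  have h1 : (expVec h).wave n =ᵐ[prodMeas μ n] fun k => (((Real.sqrt (n.factorial))⁻¹ : ℂ) * I ^ n) *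
      ((memLp_tensorPow h n).toLp _ : Lp ℂ 2 (prodMeas μ n)) k := Lp.coeFn_smul _ _
  filter_upwards [h1, (memLp_tensorPow h n).coeFn_toLp] with k h1 h2
  rw [h1, h2]

/-- By the product majorant, `‖Mζ(h)‖ ≤ ‖ζ(g)‖` with `g = 2(1 + ω + ½m²)h`, which lies in `L²`
because `h ∈ 𝔡`. -/
theorem PosSymbols.expVec_mem (hs : PosSymbols ω m) {h : OneBoson μ} (hh : InD μ ω m h) :
    expVec h ∈ (opM μ ω m).domain := by
  rw [hs.mem_opM_domain_iff]
  set g := hh.memLp_weight.toLp _ with hg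
  refine ne_top_of_le_ne_top (b := wsq (fun _ _ => 1) (expVec g)) ?_ ?_
  · rw [← ofReal_norm_sq]
    exact ENNReal.ofReal_ne_top
  · refine ENNReal.tsum_le_tsum fun n => lintegral_mono_ae ?_
    filter_upwards [wave_expVec h n, wave_expVec g n, ae_coord hh.memLp_weight.coeFn_toLp n]
      with k h1 h2 h3
    refine ENNReal.ofReal_le_ofReal ?_
    have h4 : ∀ i, g (k i) = ((2 * (1 + totalSymbol ω m (k i)) : ℝ) : ℂ) * h (k i) := h3
    rw [h1, h2, one_mul, Finset.prod_congr rfl fun i _ => h4 i, Finset.prod_mul_distrib]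
    have h5 : symMa ω m 1 0 n k ≤ ‖∏ i, ((2 * (1 + totalSymbol ω m (k i)) : ℝ) : ℂ)‖ := by
      rw [norm_prod]
      refine le_trans (by linarith) ((hs.one_add_symMa_le n k).trans (le_of_eq ?_))
      refine Finset.prod_congr rfl fun i _ => ?_
      have := hs.totalSymbol_pos (k i)
      rw [norm_real, Real.norm_of_nonneg (by positivity)]
    have h6 := pow_le_pow_left₀ (hs.symMa_nonneg n k) h5 2
    generalize ((Real.sqrt (n.factorial))⁻¹ : ℂ) * I ^ n = c
    generalize ∏ i, h (k i) = p
    rw [norm_mul, norm_mul, norm_mul, mul_pow, mul_pow, mul_pow]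
    have h7 := mul_le_mul_of_nonneg_right h6 (by positivity : 0 ≤ ‖c‖ ^ 2 * ‖p‖ ^ 2)
    linarith

/-! ### The functionals `h₁ ⊗ ⋯ ⊗ hₙ ↦ ⟨φ, (M + 1) h₁ ⊗ ⋯ ⊗ hₙ⟩` -/

variable (ω m) in
/-- The pairing of `φ` with `(M + 1) h₁ ⊗ ⋯ ⊗ hₙ`. -/
def pairing (φ : Fock μ) {n : ℕ} (h : Fin n → OneBoson μ) : ℂ :=
  ∫ k, (starRingEnd ℂ) (φ.wave n k) * ((1 + symMa ω m 1 0 n k : ℝ) : ℂ) * ∏ i, h i (k i)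
    ∂prodMeas μ n

theorem PosSymbols.integrable_pairing (hs : PosSymbols ω m) (φ : Fock μ) {n : ℕ}
    {h : Fin n → OneBoson μ} (hh : ∀ i, InD μ ω m (h i)) :
    Integrable (fun k => (starRingEnd ℂ) (φ.wave n k) * ((1 + symMa ω m 1 0 n k : ℝ) : ℂ) *
      ∏ i, h i (k i)) (prodMeas μ n) := by
  have h1 : MemLp (fun k : Fin n → M => ((1 + symMa ω m 1 0 n k : ℝ) : ℂ) * ∏ i, h i (k i)) 2
      (prodMeas μ n) := by
    refine (memLp_prod fun i => (hh i).memLp_weight).of_le ?_ (Filter.Eventually.of_forall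
      fun k => ?_)
    · exact (measurable_ofReal.comp
        ((hs.measurable_symMa 1 0 n).const_add 1)).aestronglyMeasurable.mul
        (memLp_prod fun i => Lp.memLp (h i)).1
    · rw [Finset.prod_mul_distrib, norm_mul, norm_mul]
      refine mul_le_mul_of_nonneg_right ?_ (norm_nonneg _)
      have := hs.symMa_nonneg n k
      rw [norm_real, Real.norm_of_nonneg (by positivity), norm_prod]
      refine (hs.one_add_symMa_le n k).trans (le_of_eq ?_)
      refine Finset.prod_congr rfl fun i _ => ?_
      have := hs.totalSymbol_pos (k i)
      rw [norm_real, Real.norm_of_nonneg (by positivity)]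
  have h2 : MemLp (fun k => (starRingEnd ℂ) (φ.wave n k)) 2 (prodMeas μ n) :=
    (memLp_wave φ n).star
  simpa only [mul_assoc] using! h2.integrable_mul h1

theorem coeFn_sum {ι : Type*} (s : Finset ι) (h : ι → OneBoson μ) :
    (∑ j ∈ s, h j : OneBoson μ) =ᵐ[μ] fun x => ∑ j ∈ s, h j x := by
  classical
  induction s using Finset.induction_on with
  | empty =>
    simp only [Finset.sum_empty]
    exact Lp.coeFn_zero _ _ _
  | insert a s ha ih =>
    rw [Finset.sum_insert ha]
    filter_upwards [Lp.coeFn_add (h a) (∑ j ∈ s, h j), ih] with x h1 h2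
    rw [h1, Pi.add_apply, h2, Finset.sum_insert ha]

theorem PosSymbols.pairing_sum (hs : PosSymbols ω m) (φ : Fock μ) {n : ℕ} {ι : Type*}
    [DecidableEq ι] (t : Finset ι) {h : Fin n → ι → OneBoson μ}
    (hh : ∀ i j, InD μ ω m (h i j)) :
    pairing ω m φ (fun i => ∑ j ∈ t, h i j) =
      ∑ p ∈ Fintype.piFinset fun _ : Fin n => t, pairing ω m φ fun i => h i (p i) := by
  simp only [pairing]
  rw [← integral_finsetSum _ fun p _ => hs.integrable_pairing φ fun i => hh i (p i)]
  refine integral_congr_ae ?_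
  have h1 : ∀ᵐ k ∂prodMeas μ n, ∀ i, (∑ j ∈ t, h i j : OneBoson μ) (k i) = ∑ j ∈ t, h i j (k i) :=
    ae_all_iff.2 fun i => by
      filter_upwards [ae_coord (coeFn_sum t (h i)) n] with k hk using hk i
  filter_upwards [h1] with k hk
  rw [Finset.prod_congr rfl fun i _ => hk i, Finset.prod_univ_sum, Finset.mul_sum]

theorem pairing_smul (φ : Fock μ) {n : ℕ} (c : Fin n → ℂ) (h : Fin n → OneBoson μ) :
    pairing ω m φ (fun i => c i • h i) = (∏ i, c i) * pairing ω m φ h := by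
  simp only [pairing]
  rw [← integral_const_mul]
  refine integral_congr_ae ?_
  have h1 : ∀ᵐ k ∂prodMeas μ n, ∀ i, (c i • h i : OneBoson μ) (k i) = c i * h i (k i) :=
    ae_all_iff.2 fun i => by
      filter_upwards [ae_coord (Lp.coeFn_smul (c i) (h i)) n] with k hk using hk i
  filter_upwards [h1] with k hk
  rw [Finset.prod_congr rfl fun i _ => hk i, Finset.prod_mul_distrib]
  ring

theorem pairing_perm (φ : Fock μ) {n : ℕ} (π : Equiv.Perm (Fin n)) (h : Fin n → OneBoson μ) :
    pairing ω m φ (fun i => h (π i)) = pairing ω m φ h := by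
  simp only [pairing]
  rw [← integral_perm n π]
  refine integral_congr_ae ?_
  filter_upwards [wave_symm φ n π] with k hk
  rw [← hk, symMa_perm, Equiv.prod_comp π fun i => h i (k i)]

/-- The alternating sum over all sets that contain the image of `f`. -/
theorem sum_neg_one_pow_card_eq_zero {n : ℕ} {f : Fin n → Fin n} (hf : ¬ Function.Surjective f) :
    ∑ s : Finset (Fin n), (if ∀ i, f i ∈ s then (-1 : ℂ) ^ s.card else 0) = 0 := by
  classical
  obtain ⟨j, hj⟩ := not_forall.1 hf
  have hj' : ∀ i, f i ≠ j := fun i hi => hj ⟨i, hi⟩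
  refine Finset.sum_involution (fun s _ => if j ∈ s then s.erase j else insert j s) ?_ ?_ ?_ ?_
  · intro s _
    by_cases hs : j ∈ s
    · have h1 : (∀ i, f i ∈ s.erase j) ↔ ∀ i, f i ∈ s := by simp [hj']
      rw [if_pos hs]
      simp only [h1]
      split_ifs
      · rw [← Finset.card_erase_add_one hs, pow_succ]
        ring
      · simp
    · have h1 : (∀ i, f i ∈ insert j s) ↔ ∀ i, f i ∈ s := by simp [hj']
      rw [if_neg hs]
      simp only [h1]
      split_ifs
      · rw [Finset.card_insert_of_notMem hs, pow_succ]
        ring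
      · simp
  · intro s _ _ h
    by_cases hs : j ∈ s
    · rw [if_pos hs] at h
      have hs' := hs
      rw [← h] at hs'
      exact Finset.notMem_erase j s hs'
    · rw [if_neg hs] at h
      exact hs (h ▸ Finset.mem_insert_self j s)
  · intros
    exact Finset.mem_univ _
  · intro s _
    by_cases hs : j ∈ s
    · simp [hs, Finset.insert_erase]
    · simp [hs]

theorem sum_neg_one_pow_card_eq {n : ℕ} {f : Fin n → Fin n} (hf : Function.Surjective f) :
    ∑ s : Finset (Fin n), (if ∀ i, f i ∈ s then (-1 : ℂ) ^ s.card else 0) = (-1) ^ n := by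
  classical
  have h1 : ∀ s : Finset (Fin n), (∀ i, f i ∈ s) ↔ s = Finset.univ := by
    intro s
    rw [Finset.eq_univ_iff_forall]
    exact hf.forall.symm
  simp [h1]

/-- Polarization. -/
theorem PosSymbols.pairing_eq_zero (hs : PosSymbols ω m) (φ : Fock μ) {n : ℕ}
    {h : Fin n → OneBoson μ} (hh : ∀ i, InD μ ω m (h i))
    (h0 : ∀ s : Finset (Fin n), pairing ω m φ (fun _ : Fin n => ∑ j ∈ s, h j) = 0) :
    pairing ω m φ h = 0 := by
  classical
  -- Inclusion–exclusion: expanding the diagonal value at `∑_{j ∈ s} h_j` and summing with signs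
  -- `(-1)^{|s|}` cancels every index map `p` that is not onto. The surjective ones are
  -- permutations, and each contributes `(-1)ⁿ` times the same value.
  have h1 : ∑ s : Finset (Fin n), (-1 : ℂ) ^ s.card *
      ∑ p ∈ Fintype.piFinset fun _ : Fin n => s, pairing ω m φ (fun i => h (p i)) = 0 := by
    refine Finset.sum_eq_zero fun s _ => ?_
    rw [← hs.pairing_sum φ s fun _ j => hh j, h0, mul_zero]
  have h2 : ∀ s : Finset (Fin n), (-1 : ℂ) ^ s.card *
      ∑ p ∈ Fintype.piFinset fun _ : Fin n => s, pairing ω m φ (fun i => h (p i)) =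
      ∑ p : Fin n → Fin n, (if ∀ i, p i ∈ s then (-1 : ℂ) ^ s.card else 0) *
        pairing ω m φ (fun i => h (p i)) := by
    intro s
    rw [Finset.mul_sum]
    simp only [ite_mul, zero_mul]
    rw [← Finset.sum_filter]
    refine Finset.sum_congr ?_ fun _ _ => rfl
    ext p
    simp [Fintype.mem_piFinset]
  simp only [h2] at h1
  rw [Finset.sum_comm] at h1
  simp only [← Finset.sum_mul] at h1
  have h3 : ∀ p : Fin n → Fin n,
      (∑ s : Finset (Fin n), (if ∀ i, p i ∈ s then (-1 : ℂ) ^ s.card else 0)) *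
        pairing ω m φ (fun i => h (p i)) =
      if Function.Surjective p then (-1) ^ n * pairing ω m φ h else 0 := by
    intro p
    split_ifs with hp
    · rw [sum_neg_one_pow_card_eq hp]
      congr 1
      exact pairing_perm φ (Equiv.ofBijective p (Finite.injective_iff_surjective.2 hp |>.bijective_of_finite)) h
    · rw [sum_neg_one_pow_card_eq_zero hp, zero_mul]
  simp only [h3] at h1
  rw [← Finset.sum_filter, Finset.sum_const, nsmul_eq_mul] at h1
  have h4 : ((Finset.univ.filter fun p : Fin n → Fin n => Function.Surjective p).card : ℂ) ≠ 0 := by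
    rw [Nat.cast_ne_zero]
    exact Finset.card_ne_zero_of_mem (Finset.mem_filter.2 ⟨Finset.mem_univ id, Function.surjective_id⟩)
  have h5 := (mul_eq_zero.1 h1).resolve_left h4
  exact (mul_eq_zero.1 h5).resolve_left (pow_ne_zero n (by norm_num))

open Filter Topology in
/-- The coefficients of a power series that vanishes on the real line. -/
theorem coeff_eq_zero_of_hasSum {a : ℕ → ℂ} (h : ∀ t : ℝ, HasSum (fun n => (t : ℂ) ^ n * a n) 0)
    (n : ℕ) : a n = 0 := by
  let p : FormalMultilinearSeries ℝ ℝ ℂ := fun n => ContinuousMultilinearMap.mkPiRing ℝ (Fin n) (a n)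
  have hp : HasFPowerSeriesAt (0 : ℝ → ℂ) p 0 := by
    rw [hasFPowerSeriesAt_iff]
    refine Eventually.of_forall fun t => ?_
    have hc : ∀ n, t ^ n • p.coeff n = (t : ℂ) ^ n * a n := by
      intro n
      rw [real_smul, ofReal_pow]
      simp [p, FormalMultilinearSeries.coeff]
    simp only [hc]
    exact h t
  have := congrArg (fun q : FormalMultilinearSeries ℝ ℝ ℂ => q.coeff n) hp.eq_zero
  simpa [p, FormalMultilinearSeries.coeff] using this

end Core

end FiberHam

end
noncomputable section

namespace FiberHam

section Conjugation

variable {M : Type*} [MeasurableSpace M] {μ : Measure M} [SigmaFinite μ] {ν L : ℕ}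
  {ω : M → ℝ} {m : Fin ν → M → ℝ}

open Filter Topology
open scoped ENNReal

/-! ### The conjugation leaves `𝔡` invariant -/

/-- Fatou. Equality of the norms of `b_j f` and `b_j f'` bounds the integrals of `|b_j f'|²` by that
of `|β f|²`, uniformly in `j`. -/
theorem memLp_mul_of_tendsto {f f' : OneBoson μ} {β : M → ℝ} {b : ℕ → M → ℝ}
    (hβ : Measurable β) (hb : ∀ j, Measurable (b j)) (hle : ∀ j k, |b j k| ≤ |β k|)
    (hlim : ∀ k, Tendsto (fun j => b j k) atTop (𝓝 (β k)))
    (hf : MemLp (fun k => (β k : ℂ) * f k) 2 μ)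
    (hn : ∀ j, ∃ g g' : OneBoson μ, (g =ᵐ[μ] fun k => (b j k : ℂ) * f k) ∧
      (g' =ᵐ[μ] fun k => (b j k : ℂ) * f' k) ∧ ‖g'‖ = ‖g‖) :
    MemLp (fun k => (β k : ℂ) * f' k) 2 μ := by
  refine memLp_two_of_lintegral
    ((measurable_ofReal.comp hβ).aestronglyMeasurable.mul (Lp.aestronglyMeasurable f')) ?_
  have hK : ∫⁻ k, ENNReal.ofReal (‖(β k : ℂ) * f k‖ ^ 2) ∂μ ≠ ⊤ := by
    have h1 := ofReal_norm_sq_Lp (hf.toLp _)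
    have h2 : ∫⁻ k, ENNReal.ofReal (‖hf.toLp _ k‖ ^ 2) ∂μ =
        ∫⁻ k, ENNReal.ofReal (‖(β k : ℂ) * f k‖ ^ 2) ∂μ := lintegral_congr_ae (by
      filter_upwards [hf.coeFn_toLp] with k hk
      rw [hk])
    rw [← h2, ← h1]
    exact ENNReal.ofReal_ne_top
  refine ne_top_of_le_ne_top hK ?_
  have hj : ∀ j, ∫⁻ k, ENNReal.ofReal (‖(b j k : ℂ) * f' k‖ ^ 2) ∂μ ≤
      ∫⁻ k, ENNReal.ofReal (‖(β k : ℂ) * f k‖ ^ 2) ∂μ := by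
    intro j
    obtain ⟨g, g', h1, h2, h3⟩ := hn j
    have e1 : ∫⁻ k, ENNReal.ofReal (‖(b j k : ℂ) * f' k‖ ^ 2) ∂μ = ENNReal.ofReal (‖g'‖ ^ 2) := by
      rw [ofReal_norm_sq_Lp]
      exact lintegral_congr_ae (by filter_upwards [h2] with k hk; rw [hk])
    rw [e1, h3, ofReal_norm_sq_Lp]
    refine lintegral_mono_ae ?_
    filter_upwards [h1] with k hk
    rw [hk, norm_mul, norm_mul, norm_real, norm_real]
    refine ENNReal.ofReal_le_ofReal (pow_le_pow_left₀ (by positivity) ?_ 2)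
    exact mul_le_mul_of_nonneg_right (hle j k) (norm_nonneg _)
  have e2 : ∀ k, ENNReal.ofReal (‖(β k : ℂ) * f' k‖ ^ 2) =
      liminf (fun j => ENNReal.ofReal (‖(b j k : ℂ) * f' k‖ ^ 2)) atTop := by
    intro k
    refine (Tendsto.liminf_eq ?_).symm
    refine (ENNReal.continuous_ofReal.tendsto _).comp ?_
    exact (((continuous_ofReal.tendsto _).comp (hlim k)).mul_const _).norm.pow 2
  simp only [e2]
  refine (lintegral_liminf_le' fun j => ?_).trans ?_
  · exact (((measurable_ofReal.comp (hb j)).aestronglyMeasurable.mul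
      (Lp.aestronglyMeasurable f')).norm.aemeasurable.pow_const 2).ennreal_ofReal
  · refine (liminf_le_liminf (Eventually.of_forall hj)).trans ?_
    rw [liminf_const]

/-- The commutation of `C` with multiplication by `exp(-tω + i m · x)`. -/
def CommutesExp (ω : M → ℝ) (m : Fin ν → M → ℝ)
    (C : OneBoson μ →ₛₗᵢ[starRingEnd ℂ] OneBoson μ) : Prop :=
  ∀ (t : ℝ) (x : EuclideanSpace ℝ (Fin ν)), 0 ≤ t → ∀ f g : OneBoson μ,
    (g =ᵐ[μ] fun k => exp (-(t * ω k : ℝ) + I * (∑ l, m l k * x l : ℝ)) * f k) →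
    (C g =ᵐ[μ] fun k => exp (-(t * ω k : ℝ) + I * (∑ l, m l k * x l : ℝ)) * C f k)

variable {C : OneBoson μ →ₛₗᵢ[starRingEnd ℂ] OneBoson μ}

theorem PosSymbols.exists_exp_mul (hs : PosSymbols ω m) (hC : CommutesExp ω m C) {t : ℝ}
    (ht : 0 ≤ t) (x : EuclideanSpace ℝ (Fin ν)) (f : OneBoson μ) : ∃ g : OneBoson μ,
    (g =ᵐ[μ] fun k => exp (-(t * ω k : ℝ) + I * (∑ l, m l k * x l : ℝ)) * f k) ∧
    (C g =ᵐ[μ] fun k => exp (-(t * ω k : ℝ) + I * (∑ l, m l k * x l : ℝ)) * C f k) := by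
  have hm : Measurable fun k => exp (-(t * ω k : ℝ) + I * (∑ l, m l k * x l : ℝ)) := by
    refine measurable_exp.comp (Measurable.add ?_ ?_)
    · exact (measurable_ofReal.comp (hs.meas_omega.const_mul t)).neg
    · exact (measurable_ofReal.comp (Finset.measurable_sum _ fun l _ =>
        (hs.meas_m l).mul_const _)).const_mul I
  have hmem : MemLp (fun k => exp (-(t * ω k : ℝ) + I * (∑ l, m l k * x l : ℝ)) * f k) 2 μ := by
    refine (Lp.memLp f).of_le (hm.aestronglyMeasurable.mul (Lp.aestronglyMeasurable f))
      (Eventually.of_forall fun k => ?_)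
    rw [norm_mul, norm_exp]
    refine mul_le_of_le_one_left (norm_nonneg _) (Real.exp_le_one_iff.2 ?_)
    have : (-(t * ω k : ℝ) + I * (∑ l, m l k * x l : ℝ) : ℂ).re = -(t * ω k) := by
      simp only [add_re, neg_re, ofReal_re, mul_re, I_re, I_im, ofReal_im]
      ring
    rw [this]
    have := mul_nonneg ht (hs.pos k).le
    linarith
  exact ⟨hmem.toLp _, hmem.coeFn_toLp, hC t x ht f _ hmem.coeFn_toLp⟩

theorem tendsto_one_div_nat_ne : Tendsto (fun j : ℕ => (1 / (j + 1) : ℝ)) atTop (𝓝[≠] 0) :=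
  tendsto_nhdsWithin_iff.2 ⟨tendsto_one_div_add_atTop_nhds_zero_nat,
    Eventually.of_forall fun j => (by positivity : (1 / (j + 1) : ℝ) ≠ 0)⟩

/-- `ω` is the limit of the difference quotients `(1 - e^{-tω})/t ≤ ω`. These are real combinations
of functions whose multiplication commutes with the isometry `C`. -/
theorem PosSymbols.memLp_omega_mul (hs : PosSymbols ω m) (hC : CommutesExp ω m C)
    {f : OneBoson μ} (hf : MemLp (fun k => (ω k : ℂ) * f k) 2 μ) :
    MemLp (fun k => (ω k : ℂ) * C f k) 2 μ := by
  refine memLp_mul_of_tendsto (b := fun j k => (1 / (j + 1) : ℝ)⁻¹ *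
    (1 - Real.exp (-((1 / (j + 1)) * ω k)))) hs.meas_omega (fun j => ?_) (fun j k => ?_)
    (fun k => ?_) hf (fun j => ?_)
  · exact (measurable_const.sub
      (Real.measurable_exp.comp (hs.meas_omega.const_mul _).neg)).const_mul _
  · have hω := hs.pos k
    have ht : (0 : ℝ) < 1 / (j + 1) := by positivity
    set t : ℝ := 1 / (j + 1)
    have h1 := Real.add_one_le_exp (-(t * ω k))
    have h2 : Real.exp (-(t * ω k)) ≤ 1 := Real.exp_le_one_iff.2 (by
      have := mul_pos ht hω
      linarith)
    rw [abs_of_nonneg (mul_nonneg (inv_nonneg.2 ht.le) (by linarith)), abs_of_pos hω,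
      inv_mul_le_iff₀ ht]
    linarith
  · have hd : HasDerivAt (fun t : ℝ => 1 - Real.exp (-(t * ω k))) (ω k) 0 := by
      have h1 : HasDerivAt (fun t : ℝ => -(t * ω k)) (-(1 * ω k)) 0 :=
        ((hasDerivAt_id (0 : ℝ)).mul_const (ω k)).neg
      have h2 := (h1.exp).const_sub 1
      simpa using h2
    have := hd.tendsto_slope_zero.comp tendsto_one_div_nat_ne
    refine this.congr fun j => ?_
    simp
  · have ht : (0 : ℝ) < 1 / (j + 1) := by positivity
    set t : ℝ := 1 / (j + 1) with htd
    obtain ⟨e, he, heC⟩ := hs.exists_exp_mul hC ht.le 0 f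
    have hx : ∀ k, (-(t * ω k : ℝ) + I * (∑ l, m l k * (0 : EuclideanSpace ℝ (Fin ν)) l : ℝ) : ℂ)
        = ((-(t * ω k) : ℝ) : ℂ) := by
      intro k
      simp
    simp only [hx, ← ofReal_exp] at he heC
    refine ⟨((t⁻¹ : ℝ) : ℂ) • (f - e), ((t⁻¹ : ℝ) : ℂ) • (C f - C e), ?_, ?_, ?_⟩
    · filter_upwards [Lp.coeFn_smul ((t⁻¹ : ℝ) : ℂ) (f - e), Lp.coeFn_sub f e, he] with k h1 h2 h3
      rw [h1, Pi.smul_apply, h2, Pi.sub_apply, h3, smul_eq_mul]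
      push_cast
      ring
    · filter_upwards [Lp.coeFn_smul ((t⁻¹ : ℝ) : ℂ) (C f - C e), Lp.coeFn_sub (C f) (C e), heC]
        with k h1 h2 h3
      rw [h1, Pi.smul_apply, h2, Pi.sub_apply, h3, smul_eq_mul]
      push_cast
      ring
    · rw [← map_sub, norm_smul, norm_smul, C.norm_map]

/-- The approximation is `(sin(tm)/t)² = (2 - e^{2itm} - e^{-2itm})/(2t)²`. A second difference has
real coefficients, so the antilinear `C` commutes with it. -/
theorem PosSymbols.memLp_m_sq_mul (hs : PosSymbols ω m) (hC : CommutesExp ω m C) (l : Fin ν)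
    {f : OneBoson μ} (hf : MemLp (fun k => ((m l k ^ 2 : ℝ) : ℂ) * f k) 2 μ) :
    MemLp (fun k => ((m l k ^ 2 : ℝ) : ℂ) * C f k) 2 μ := by
  refine memLp_mul_of_tendsto (b := fun j k => ((1 / (j + 1) : ℝ)⁻¹ *
    Real.sin ((1 / (j + 1)) * m l k)) ^ 2) ((hs.meas_m l).pow_const 2) (fun j => ?_)
    (fun j k => ?_) (fun k => ?_) hf (fun j => ?_)
  · exact ((Real.measurable_sin.comp ((hs.meas_m l).const_mul _)).const_mul _).pow_const 2
  · have ht : (0 : ℝ) < 1 / (j + 1) := by positivity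
    set t : ℝ := 1 / (j + 1)
    rw [abs_of_nonneg (sq_nonneg _), abs_of_nonneg (sq_nonneg _), sq_le_sq, abs_mul,
      abs_of_pos (inv_pos.2 ht), inv_mul_le_iff₀ ht]
    refine Real.abs_sin_le_abs.trans (le_of_eq ?_)
    rw [abs_mul, abs_of_pos ht]
  · have hd : HasDerivAt (fun t : ℝ => Real.sin (t * m l k)) (m l k) 0 := by
      have h1 : HasDerivAt (fun t : ℝ => t * m l k) (1 * m l k) 0 :=
        (hasDerivAt_id (0 : ℝ)).mul_const (m l k)
      simpa using h1.sin
    have := (hd.tendsto_slope_zero.comp tendsto_one_div_nat_ne).pow 2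
    refine this.congr fun j => ?_
    simp
  · have ht : (0 : ℝ) < 1 / (j + 1) := by positivity
    set t : ℝ := 1 / (j + 1) with htd
    obtain ⟨e, he, heC⟩ := hs.exists_exp_mul hC le_rfl (EuclideanSpace.single l (2 * t)) f
    obtain ⟨e', he', heC'⟩ := hs.exists_exp_mul hC le_rfl (EuclideanSpace.single l (-(2 * t))) f
    have hx : ∀ (s : ℝ) k, (-(0 * ω k : ℝ) +
        I * (∑ i, m i k * (EuclideanSpace.single l s : EuclideanSpace ℝ (Fin ν)) i : ℝ) : ℂ)
        = ((m l k * s : ℝ) : ℂ) * I := by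
      intro s k
      rw [Finset.sum_eq_single l]
      · simp [mul_comm]
      · intro i _ hi
        simp [hi]
      · simp
    simp only [hx] at he heC he' heC'
    have hid : ∀ k (z : ℂ), ((((t⁻¹ * Real.sin (t * m l k)) ^ 2 : ℝ)) : ℂ) * z =
        ((((2 * t) ^ 2)⁻¹ : ℝ) : ℂ) * ((2 : ℂ) * z - (exp (((m l k * (2 * t) : ℝ) : ℂ) * I) * z +
          exp (((m l k * (-(2 * t)) : ℝ) : ℂ) * I) * z)) := by
      intro k z
      have h1 : exp (((m l k * (2 * t) : ℝ) : ℂ) * I) + exp (((m l k * (-(2 * t)) : ℝ) : ℂ) * I) =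
          2 * Complex.cos (2 * (t * m l k)) := by
        rw [two_cos]
        push_cast
        congr 2 <;> ring_nf
      have h2 : Complex.cos (2 * (t * m l k)) = 1 - 2 * Complex.sin (t * m l k) ^ 2 := by
        rw [cos_two_mul, Complex.sin_sq]
        ring
      rw [← add_mul, h1, h2]
      push_cast
      have : (t : ℂ) ≠ 0 := by exact_mod_cast ht.ne'
      field_simp
      ring
    refine ⟨((((2 * t) ^ 2)⁻¹ : ℝ) : ℂ) • ((2 : ℂ) • f - (e + e')),
      ((((2 * t) ^ 2)⁻¹ : ℝ) : ℂ) • ((2 : ℂ) • C f - (C e + C e')), ?_, ?_, ?_⟩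
    · filter_upwards [Lp.coeFn_smul ((((2 * t) ^ 2)⁻¹ : ℝ) : ℂ) ((2 : ℂ) • f - (e + e')),
        Lp.coeFn_sub ((2 : ℂ) • f) (e + e'), Lp.coeFn_smul (2 : ℂ) f, Lp.coeFn_add e e', he, he']
        with k h1 h2 h3 h4 h5 h6
      rw [h1, Pi.smul_apply, h2, Pi.sub_apply, h3, Pi.smul_apply, h4, Pi.add_apply, h5, h6, hid]
      simp only [smul_eq_mul]
    · filter_upwards [Lp.coeFn_smul ((((2 * t) ^ 2)⁻¹ : ℝ) : ℂ) ((2 : ℂ) • C f - (C e + C e')),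
        Lp.coeFn_sub ((2 : ℂ) • C f) (C e + C e'), Lp.coeFn_smul (2 : ℂ) (C f),
        Lp.coeFn_add (C e) (C e'), heC, heC'] with k h1 h2 h3 h4 h5 h6
      rw [h1, Pi.smul_apply, h2, Pi.sub_apply, h3, Pi.smul_apply, h4, Pi.add_apply, h5, h6, hid]
      simp only [smul_eq_mul]
    · have h2 : (2 : ℂ) • C f = C ((2 : ℂ) • f) := by
        rw [map_smulₛₗ]
        congr 1
        exact (map_ofNat (starRingEnd ℂ) 2).symm
      rw [h2, ← map_add, ← map_sub, norm_smul, norm_smul, C.norm_map]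

/-! ### The real subspace of `𝔡` -/

theorem InD.add {f g : OneBoson μ} (hf : InD μ ω m f) (hg : InD μ ω m g) :
    InD μ ω m (f + g : OneBoson μ) := by
  refine MemLp.ae_eq ?_ (MemLp.add hf hg)
  filter_upwards [Lp.coeFn_add f g] with k hk
  rw [hk, Pi.add_apply, Pi.add_apply, mul_add]

theorem InD.smul (c : ℂ) {f : OneBoson μ} (hf : InD μ ω m f) : InD μ ω m (c • f : OneBoson μ) := by
  refine MemLp.ae_eq ?_ (MemLp.const_mul hf c)
  filter_upwards [Lp.coeFn_smul c f] with k hk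
  rw [hk, Pi.smul_apply, smul_eq_mul]
  ring

theorem InD.sub {f g : OneBoson μ} (hf : InD μ ω m f) (hg : InD μ ω m g) :
    InD μ ω m (f - g : OneBoson μ) := by
  have := hf.add (hg.smul (-1))
  rwa [neg_one_smul, ← sub_eq_add_neg] at this

theorem inD_zero : InD μ ω m (0 : OneBoson μ) := by
  refine MemLp.ae_eq ?_ (MemLp.zero (ε := ℂ))
  filter_upwards [Lp.coeFn_zero ℂ 2 μ] with k hk
  rw [hk]
  simp

theorem mem_dC_sum {ι : Type*} (s : Finset ι) {h : ι → OneBoson μ}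
    (hh : ∀ j ∈ s, h j ∈ dC ω m C) : ∑ j ∈ s, h j ∈ dC ω m C := by
  classical
  induction s using Finset.induction_on with
  | empty => exact ⟨by rw [Finset.sum_empty]; exact inD_zero, by simp⟩
  | insert a s ha ih =>
    obtain ⟨h1, h2⟩ := hh a (Finset.mem_insert_self a s)
    obtain ⟨h3, h4⟩ := ih fun j hj => hh j (Finset.mem_insert_of_mem hj)
    rw [Finset.sum_insert ha]
    exact ⟨InD.add h1 h3, by rw [map_add, h2, h4]⟩

theorem mem_dC_smul (t : ℝ) {h : OneBoson μ} (hh : h ∈ dC ω m C) : (t : ℂ) • h ∈ dC ω m C :=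
  ⟨InD.smul _ hh.1, by rw [map_smulₛₗ, conj_ofReal, hh.2]⟩

theorem PosSymbols.inD_conj (hs : PosSymbols ω m) (hC : CommutesExp ω m C) {f : OneBoson μ}
    (hf : InD μ ω m f) : InD μ ω m (C f) := by
  have hcomp : ∀ {κ : M → ℝ}, Measurable κ → (∀ k, |κ k| ≤ 2 * totalSymbol ω m k) →
      MemLp (fun k => (κ k : ℂ) * f k) 2 μ := by
    intro κ hκ hle
    refine MemLp.of_le_mul (c := 2) hf
      ((measurable_ofReal.comp hκ).aestronglyMeasurable.mul (Lp.aestronglyMeasurable f))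
      (Eventually.of_forall fun k => ?_)
    rw [norm_mul, norm_mul, norm_real, norm_real, Real.norm_of_nonneg (hs.totalSymbol_pos k).le,
      ← mul_assoc]
    exact mul_le_mul_of_nonneg_right (hle k) (norm_nonneg _)
  have hsum : ∀ k, 0 ≤ ∑ l, m l k ^ 2 := fun k => Finset.sum_nonneg fun _ _ => sq_nonneg _
  have h1 := hs.memLp_omega_mul hC (hcomp hs.meas_omega fun k => by
    rw [abs_of_pos (hs.pos k), totalSymbol]
    linarith [hsum k, hs.pos k])
  have h2 := fun l => hs.memLp_m_sq_mul hC l (hcomp ((hs.meas_m l).pow_const 2) fun k => by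
    have := Finset.single_le_sum (f := fun l => m l k ^ 2) (fun _ _ => sq_nonneg _)
      (Finset.mem_univ l)
    rw [abs_of_nonneg (sq_nonneg _), totalSymbol]
    linarith [hs.pos k])
  have h3 := h1.add ((memLp_finsetSum Finset.univ fun l _ => h2 l).const_mul (1 / 2 : ℂ))
  refine h3.ae_eq (Eventually.of_forall fun k => ?_)
  simp only [Pi.add_apply, totalSymbol]
  push_cast
  rw [add_mul, mul_assoc, Finset.sum_mul]

/-- The real and imaginary parts are `(f + Cf)/2` and `(f - Cf)/(2i)`; they stay in `𝔡` because `C`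
preserves it. -/
theorem PosSymbols.exists_dC (hs : PosSymbols ω m) (hC : CommutesExp ω m C)
    (hinv : ∀ f, C (C f) = f) {f : OneBoson μ} (hf : InD μ ω m f) :
    ∃ u ∈ dC ω m C, ∃ v ∈ dC ω m C, f = u + I • v := by
  have hCf := hs.inD_conj hC hf
  have h2 : (starRingEnd ℂ) (1 / 2 : ℂ) = 1 / 2 := by
    rw [show (1 / 2 : ℂ) = ((1 / 2 : ℝ) : ℂ) by norm_num, conj_ofReal]
  refine ⟨(1 / 2 : ℂ) • (f + C f), ⟨(hf.add hCf).smul _, ?_⟩,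
    (-(1 / 2) * I : ℂ) • (f - C f), ⟨(hf.sub hCf).smul _, ?_⟩, ?_⟩
  · rw [map_smulₛₗ, map_add, hinv, h2, add_comm]
  · rw [map_smulₛₗ, map_sub, hinv, map_mul, map_neg, h2, conj_I]
    module
  · rw [smul_smul]
    have : I * (-(1 / 2) * I) = (1 / 2 : ℂ) := by
      linear_combination (-(1 / 2) : ℂ) * I_mul_I
    rw [this]
    module

end Conjugation

end FiberHam

end
noncomputable section

namespace FiberHam

section AbstractDensity

variable {E : Type*} [NormedAddCommGroup E] [InnerProductSpace ℂ E] [CompleteSpace E]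

/-- Graph density of a subspace from the density of its image under `A + 1`. -/
theorem exists_near_of_orthogonal {A : E →ₗ.[ℂ] E} {S : Submodule ℂ E} (hS : S ≤ A.domain)
    (horth : ∀ φ, (∀ χ ∈ S, inner ℂ φ (ev A χ + χ) = 0) → φ = 0)
    (hA : ∀ χ ∈ A.domain, ‖χ‖ ≤ ‖ev A χ + χ‖ ∧ ‖ev A χ‖ ≤ ‖ev A χ + χ‖) {ψ : E}
    (hψ : ψ ∈ A.domain) {ε : ℝ} (hε : 0 < ε) :
    ∃ χ ∈ S, ‖ψ - χ‖ < ε ∧ ‖ev A (ψ - χ)‖ < ε := by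
  have hdense : (LinearMap.range (evL A hS + S.subtype)).topologicalClosure = ⊤ := by
    rw [Submodule.topologicalClosure_eq_top_iff, Submodule.eq_bot_iff]
    exact fun φ hφ => horth φ fun χ hχ => (Submodule.mem_orthogonal' _ _).1 hφ _ ⟨⟨χ, hχ⟩, rfl⟩
  have hcl : ev A ψ + ψ ∈ closure (LinearMap.range (evL A hS + S.subtype) : Set E) := by
    rw [← Submodule.topologicalClosure_coe, hdense]
    trivial
  obtain ⟨_, ⟨χ, rfl⟩, hχ⟩ := Metric.mem_closure_iff.1 hcl ε hε
  have e1 : ev A (ψ - χ) + (ψ - χ) = ev A ψ + ψ - (evL A hS + S.subtype) χ := by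
    rw [ev_map_sub _ hψ (hS χ.2), LinearMap.add_apply, evL_apply, Submodule.subtype_apply]
    abel
  obtain ⟨h1, h2⟩ := hA _ (Submodule.sub_mem _ hψ (hS χ.2))
  rw [e1] at h1 h2
  rw [dist_eq_norm] at hχ
  exact ⟨χ, χ.2, h1.trans_lt hχ, h2.trans_lt hχ⟩

end AbstractDensity

section CoreDensity

variable {M : Type*} [MeasurableSpace M] {μ : Measure M} [SigmaFinite μ] {ν L : ℕ}
  {ω : M → ℝ} {m : Fin ν → M → ℝ} {C : OneBoson μ →ₛₗᵢ[starRingEnd ℂ] OneBoson μ}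

open Filter Topology
open scoped ENNReal

/-! ### Vectors orthogonal to `(M + 1) 𝒞[𝔡_C]` -/

theorem wave_opMsc_add {ψ : Fock μ}
    (hψ : ψ ∈ (opM μ ω m).domain) (n : ℕ) :
    (ev (opMsc μ ω m 1 0) ψ + ψ).wave n =ᵐ[prodMeas μ n]
      fun k => ((1 + symMa ω m 1 0 n k : ℝ) : ℂ) * ψ.wave n k := by
  filter_upwards [wave_add (ev (opMsc μ ω m 1 0) ψ) ψ n, wave_opMsc (a := 1) (ξ := 0) hψ n]
    with k h1 h2
  rw [h1, h2]
  push_cast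
  ring

theorem PosSymbols.hasSum_pairing (hs : PosSymbols ω m) (φ : Fock μ) {h : OneBoson μ}
    (hh : InD μ ω m h) :
    HasSum (fun n => (((Real.sqrt (n.factorial))⁻¹ : ℂ) * I ^ n) *
      pairing ω m φ (fun _ : Fin n => h))
      (inner ℂ φ (ev (opMsc μ ω m 1 0) (expVec h) + expVec h)) := by
  have h1 := hasSum_inner_wave φ (ev (opMsc μ ω m 1 0) (expVec h) + expVec h)
  convert h1 using 2 with n
  rw [pairing, ← integral_const_mul]
  refine integral_congr_ae ?_
  filter_upwards [wave_opMsc_add (hs.expVec_mem hh) n, wave_expVec h n] with k h2 h3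
  rw [h2, h3]
  ring

/-- For real `t` the vector `th` remains in `𝔡_C`, and the inner product with `(M + 1)ζ(th)` is a
power series in `t`. Its vanishing for all `t` kills each sector separately. -/
theorem PosSymbols.pairing_diag_eq_zero (hs : PosSymbols ω m) {φ : Fock μ}
    (hφ : ∀ h ∈ dC ω m C, inner ℂ φ (ev (opMsc μ ω m 1 0) (expVec h) + expVec h) = 0)
    {h : OneBoson μ} (hh : h ∈ dC ω m C) (n : ℕ) : pairing ω m φ (fun _ : Fin n => h) = 0 := by
  have h1 := coeff_eq_zero_of_hasSum (a := fun n => (((Real.sqrt (n.factorial))⁻¹ : ℂ) * I ^ n) *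
      pairing ω m φ (fun _ : Fin n => h)) (fun t => ?_) n
  · refine (mul_eq_zero.1 h1).resolve_left (mul_ne_zero (inv_ne_zero ?_) (pow_ne_zero n I_ne_zero))
    exact ofReal_ne_zero.2 (Real.sqrt_ne_zero'.2 (by positivity))
  · have ht := mem_dC_smul t hh
    have h2 := hs.hasSum_pairing φ ht.1
    rw [hφ _ ht] at h2
    convert h2 using 2 with n
    rw [pairing_smul φ (fun _ => (t : ℂ)) (fun _ => h), Finset.prod_const, Finset.card_univ,
      Fintype.card_fin]
    ring

/-- Polarization settles real arguments. Writing `h_i = u_i + i v_i` and expanding over all choices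
of a real or an imaginary part reduces the complex case to them. -/
theorem PosSymbols.pairing_eq_zero_of_inD (hs : PosSymbols ω m) (hC : CommutesExp ω m C)
    (hinv : ∀ f, C (C f) = f) {φ : Fock μ}
    (hφ : ∀ h ∈ dC ω m C, inner ℂ φ (ev (opMsc μ ω m 1 0) (expVec h) + expVec h) = 0)
    {n : ℕ} {h : Fin n → OneBoson μ} (hh : ∀ i, InD μ ω m (h i)) : pairing ω m φ h = 0 := by
  have hreal : ∀ {h : Fin n → OneBoson μ}, (∀ i, h i ∈ dC ω m C) → pairing ω m φ h = 0 :=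
    fun {h} hh => hs.pairing_eq_zero φ (fun i => (hh i).1) fun s =>
      hs.pairing_diag_eq_zero hφ (mem_dC_sum s fun j _ => hh j) n
  choose u hu v hv huv using fun i => hs.exists_dC hC hinv (hh i)
  let c : Bool → ℂ := fun b => if b then 1 else I
  let d : Fin n → Bool → OneBoson μ := fun i b => if b then u i else v i
  have hd : ∀ i b, d i b ∈ dC ω m C := by
    intro i b
    cases b
    · exact hv i
    · exact hu i
  have e1 : h = fun i => ∑ b ∈ Finset.univ, c b • d i b := by
    funext i
    rw [huv i]
    simp [c, d]
  rw [e1, hs.pairing_sum φ Finset.univ fun i b => InD.smul (c b) (hd i b).1]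
  refine Finset.sum_eq_zero fun p _ => ?_
  rw [pairing_smul φ (fun i => c (p i)) (fun i => d i (p i)), hreal fun i => hd i (p i), mul_zero]

/-- The sets of finite measure on which `ω + ½ m²` is bounded. -/
def goodSet (μ : Measure M) [SigmaFinite μ] (ω : M → ℝ) (m : Fin ν → M → ℝ) (r : ℕ) : Set M :=
  spanningSets μ r ∩ {k | totalSymbol ω m k ≤ r}

theorem PosSymbols.measurableSet_goodSet (hs : PosSymbols ω m) (r : ℕ) :
    MeasurableSet (goodSet μ ω m r) :=
  (measurableSet_spanningSets μ r).inter
    (measurableSet_le hs.measurable_totalSymbol measurable_const)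

theorem goodSet_mono {r s : ℕ} (h : r ≤ s) : goodSet μ ω m r ⊆ goodSet μ ω m s :=
  fun _ hk => ⟨monotone_spanningSets μ h hk.1,
    (show totalSymbol ω m _ ≤ r from hk.2).trans (by exact_mod_cast h)⟩

theorem exists_mem_goodSet (k : M) : ∃ r, k ∈ goodSet μ ω m r := by
  obtain ⟨r, hr⟩ := Set.mem_iUnion.1 (iUnion_spanningSets μ ▸ Set.mem_univ k)
  obtain ⟨s, hs⟩ := exists_nat_ge (totalSymbol ω m k)
  refine ⟨max r s, monotone_spanningSets μ (le_max_left r s) hr, hs.trans ?_⟩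
  exact_mod_cast le_max_right r s

theorem measure_ne_top_of_subset_goodSet {r : ℕ} {A : Set M} (h : A ⊆ goodSet μ ω m r) :
    μ A ≠ ⊤ :=
  ne_top_of_le_ne_top (measure_spanningSets_lt_top μ r).ne
    (measure_mono (h.trans Set.inter_subset_left))

theorem PosSymbols.inD_indicator (hs : PosSymbols ω m) {r : ℕ} {A : Set M} (hA : MeasurableSet A)
    (h : A ⊆ goodSet μ ω m r) :
    InD μ ω m (indicatorConstLp 2 hA (measure_ne_top_of_subset_goodSet h) (1 : ℂ)) := by
  refine MemLp.of_le_mul (c := r)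
    (Lp.memLp (indicatorConstLp 2 hA (measure_ne_top_of_subset_goodSet h) (1 : ℂ)))
    ((measurable_ofReal.comp hs.measurable_totalSymbol).aestronglyMeasurable.mul
      (Lp.aestronglyMeasurable _)) ?_
  filter_upwards [indicatorConstLp_coeFn (p := 2) (hs := hA)
    (hμs := measure_ne_top_of_subset_goodSet h) (c := (1 : ℂ))] with k hk
  rw [norm_mul, hk, norm_real, Real.norm_of_nonneg (hs.totalSymbol_pos k).le]
  by_cases hkA : k ∈ A
  · exact mul_le_mul_of_nonneg_right (h hkA).2 (norm_nonneg _)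
  · simp [hkA]

theorem prod_indicator_ae {n : ℕ} {A : Fin n → Set M} (hA : ∀ i, MeasurableSet (A i))
    (hμ : ∀ i, μ (A i) ≠ ⊤) : ∀ᵐ k ∂prodMeas μ n,
      ∏ i, indicatorConstLp 2 (hA i) (hμ i) (1 : ℂ) (k i) =
        (Set.univ.pi A).indicator (fun _ => (1 : ℂ)) k := by
  classical
  have h1 : ∀ᵐ k ∂prodMeas μ n, ∀ i, indicatorConstLp 2 (hA i) (hμ i) (1 : ℂ) (k i) =
      (A i).indicator (fun _ => 1) (k i) := ae_all_iff.2 fun i => by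
    filter_upwards [ae_coord (indicatorConstLp_coeFn (p := 2) (hs := hA i) (hμs := hμ i)
      (c := (1 : ℂ))) n] with k hk using hk i
  filter_upwards [h1] with k hk
  rw [Finset.prod_congr rfl fun i _ => hk i]
  by_cases h : k ∈ Set.univ.pi A
  · rw [Set.indicator_of_mem h]
    exact Finset.prod_eq_one fun i _ => Set.indicator_of_mem (h i (Set.mem_univ i)) _
  · rw [Set.indicator_of_notMem h]
    simp only [Set.mem_pi, Set.mem_univ, true_imp_iff, not_forall] at h
    obtain ⟨i, hi⟩ := h
    exact Finset.prod_eq_zero (Finset.mem_univ i) (Set.indicator_of_notMem hi _)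

/-- A function integrable on `Mⁿ` whose integrals over all boxes vanish is zero. -/
theorem ae_eq_zero_of_forall_box {n : ℕ} {ρ : Measure (Fin n → M)} {f : (Fin n → M) → ℂ}
    (hf : Integrable f ρ)
    (h : ∀ A : Fin n → Set M, (∀ i, MeasurableSet (A i)) → ∫ k in Set.univ.pi A, f k ∂ρ = 0) :
    f =ᵐ[ρ] 0 := by
  refine hf.ae_eq_zero_of_forall_setIntegral_eq_zero fun s hs _ => ?_
  have huniv : ∫ k, f k ∂ρ = 0 := by
    have := h (fun _ => Set.univ) fun _ => MeasurableSet.univ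
    rwa [Set.pi_univ, Measure.restrict_univ] at this
  refine MeasurableSpace.induction_on_inter (C := fun s _ => ∫ k in s, f k ∂ρ = 0)
    generateFrom_pi.symm isPiSystem_pi ?_ ?_ ?_ ?_ s hs
  · simp
  · rintro t ⟨A, hA, rfl⟩
    exact h A fun i => hA i (Set.mem_univ i)
  · intro t ht h0
    have := integral_add_compl ht hf
    rw [h0, zero_add, huniv] at this
    exact this
  · intro A hd hA h0
    rw [integral_iUnion hA hd hf.integrableOn]
    simp [h0]

/-- Indicators of sets where the measure is finite and `ω + ½m²` is bounded belong to `𝔡`, so all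
box integrals of `conj(φ_n)(1 + symbol)` vanish there. The factor `1 + symbol` is at least `1` and
can be divided out. -/
theorem PosSymbols.eq_zero_of_pairing (hs : PosSymbols ω m) {φ : Fock μ}
    (hφ : ∀ (n : ℕ) (h : Fin n → OneBoson μ), (∀ i, InD μ ω m (h i)) → pairing ω m φ h = 0) :
    φ = 0 := by
  refine wave_ext fun n => ?_
  set f : (Fin n → M) → ℂ := fun k =>
    (starRingEnd ℂ) (φ.wave n k) * ((1 + symMa ω m 1 0 n k : ℝ) : ℂ) with hf
  have hbox : ∀ (r : ℕ) (A : Fin n → Set M), (∀ i, MeasurableSet (A i)) →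
      (∀ i, A i ⊆ goodSet μ ω m r) →
      IntegrableOn f (Set.univ.pi A) (prodMeas μ n) ∧
        ∫ k in Set.univ.pi A, f k ∂prodMeas μ n = 0 := by
    intro r A hA hAr
    have hbm : MeasurableSet (Set.univ.pi A) := MeasurableSet.univ_pi hA
    have h1 := prod_indicator_ae hA fun i => measure_ne_top_of_subset_goodSet (hAr i)
    have h2 := hs.integrable_pairing φ fun i => hs.inD_indicator (hA i) (hAr i)
    have h3 := hφ n _ fun i => hs.inD_indicator (hA i) (hAr i)
    have h4 : (fun k => (starRingEnd ℂ) (φ.wave n k) * ((1 + symMa ω m 1 0 n k : ℝ) : ℂ) *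
        ∏ i, indicatorConstLp 2 (hA i) (measure_ne_top_of_subset_goodSet (hAr i)) (1 : ℂ) (k i))
        =ᵐ[prodMeas μ n] (Set.univ.pi A).indicator f := by
      filter_upwards [h1] with k hk
      rw [hk]
      by_cases hkA : k ∈ Set.univ.pi A
      · rw [Set.indicator_of_mem hkA, Set.indicator_of_mem hkA, mul_one]
      · rw [Set.indicator_of_notMem hkA, Set.indicator_of_notMem hkA, mul_zero]
    refine ⟨(integrable_indicator_iff hbm).1 (h2.congr h4), ?_⟩
    rw [← integral_indicator hbm, ← integral_congr_ae h4]
    exact h3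
  have hr : ∀ r : ℕ, ∀ᵐ k ∂prodMeas μ n,
      k ∈ Set.univ.pi (fun _ : Fin n => goodSet μ ω m r) → f k = 0 := by
    intro r
    have hgm := hs.measurableSet_goodSet (μ := μ) r
    have hbm : MeasurableSet (Set.univ.pi fun _ : Fin n => goodSet μ ω m r) :=
      MeasurableSet.univ_pi fun _ => hgm
    refine (ae_restrict_iff' hbm).1 ?_
    refine ae_eq_zero_of_forall_box (hbox r _ (fun _ => hgm) fun _ => subset_rfl).1 fun A hA => ?_
    rw [Measure.restrict_restrict (MeasurableSet.univ_pi hA), ← Set.pi_inter_distrib]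
    exact (hbox r _ (fun i => (hA i).inter hgm) fun i => Set.inter_subset_right).2
  filter_upwards [ae_all_iff.2 hr, wave_zero (μ := μ) n] with k hk h0
  choose r hrk using fun i => exists_mem_goodSet (μ := μ) (ω := ω) (m := m) (k i)
  have h1 := hk (Finset.univ.sup r) fun i _ =>
    goodSet_mono (Finset.le_sup (Finset.mem_univ i)) (hrk i)
  rw [h0]
  have h2 : ((1 + symMa ω m 1 0 n k : ℝ) : ℂ) ≠ 0 := by
    have := hs.symMa_nonneg n k
    exact ofReal_ne_zero.2 (by positivity)
  exact (map_eq_zero _).1 ((mul_eq_zero.1 h1).resolve_right h2)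

/-! ### The core -/

theorem PosSymbols.expSpan_le (hs : PosSymbols ω m) :
    expSpan (dC ω m C) ≤ (opM μ ω m).domain := by
  refine Submodule.span_le.2 ?_
  rintro _ ⟨h, hh, rfl⟩
  exact hs.expVec_mem hh.1

/-- `M` has a nonnegative symbol, so both `1` and `M` are pointwise below `1 + M`; approximation of
`(M + 1)ψ` is therefore approximation of `ψ` in graph norm. -/
theorem PosSymbols.norm_le_opMsc_add (hs : PosSymbols ω m) {ψ : Fock μ}
    (hψ : ψ ∈ (opM μ ω m).domain) :
    ‖ψ‖ ≤ ‖ev (opMsc μ ω m 1 0) ψ + ψ‖ ∧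
      ‖ev (opMsc μ ω m 1 0) ψ‖ ≤ ‖ev (opMsc μ ω m 1 0) ψ + ψ‖ := by
  have key : ∀ {w : ∀ n, (Fin n → M) → ℝ} {η : Fock μ},
      (∀ n, η.wave n =ᵐ[prodMeas μ n] fun k => (w n k : ℂ) * ψ.wave n k) →
      (∀ n k, 0 ≤ w n k ∧ w n k ≤ 1 + symMa ω m 1 0 n k) →
      ‖η‖ ≤ ‖ev (opMsc μ ω m 1 0) ψ + ψ‖ := by
    intro w η hη hw
    have h1 := wn_le_of_wave_eq (w := fun n k => w n k ^ 2)
      (fun n => (hs.measurable_symMa 1 0 n).const_add 1) (wave_opMsc_add hψ) zero_le_one le_rfl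
      (fun n k => by
        rw [one_pow, one_mul, zero_pow two_ne_zero, add_zero]
        exact pow_le_pow_left₀ (hw n k).1 (hw n k).2 2)
    have h2 := ofReal_norm_sq_of_wave_eq hη
    simp only [norm_real, Real.norm_eq_abs, sq_abs] at h2
    rw [wn, ← h2, ENNReal.toReal_ofReal (sq_nonneg _), Real.sqrt_sq (norm_nonneg _)] at h1
    linarith
  refine ⟨key (w := fun _ _ => 1) (fun n => by simp) fun n k => ⟨zero_le_one, ?_⟩,
    key (wave_opMsc hψ) fun n k => ⟨hs.symMa_nonneg n k, by linarith⟩⟩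
  linarith [hs.symMa_nonneg n k]

theorem PosSymbols.exists_expSpan (hs : PosSymbols ω m) (hC : CommutesExp ω m C)
    (hinv : ∀ f, C (C f) = f) {ψ : Fock μ} (hψ : ψ ∈ (opM μ ω m).domain) {ε : ℝ} (hε : 0 < ε) :
    ∃ χ ∈ expSpan (dC ω m C), ‖ψ - χ‖ < ε ∧ ‖ev (opMsc μ ω m 1 0) (ψ - χ)‖ < ε := by
  have hd := opMsc_domain (μ := μ) (ω := ω) (m := m) 1 0
  refine exists_near_of_orthogonal (A := opMsc μ ω m 1 0) (S := expSpan (dC ω m C))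
    (by rw [hd]; exact hs.expSpan_le) (fun φ hφ => ?_) (fun χ hχ => ?_) (by rwa [hd]) hε
  · refine hs.eq_zero_of_pairing fun n h hh => hs.pairing_eq_zero_of_inD hC hinv (fun h hh => ?_) hh
    exact hφ _ (Submodule.subset_span ⟨h, hh, rfl⟩)
  · rw [hd] at hχ
    exact hs.norm_le_opMsc_add hχ

theorem PosSymbols.hasCore_opMa (hs : PosSymbols ω m) (hC : CommutesExp ω m C)
    (hinv : ∀ f, C (C f) = f) :
    (opMa μ L ω m 1 0).HasCore (tensorDomain L (expSpan (dC ω m C))) := by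
  have hle : tensorDomain L (expSpan (dC ω m C)) ≤ (opMa μ L ω m 1 0).domain := by
    rw [opMa_domain]
    exact fun Ψ hΨ i => hs.expSpan_le (hΨ i)
  refine (hasCore_iff (hs.isSelfAdjoint_opMa le_rfl 0).isClosed hle).2 fun Ψ hΨ ε hε => ?_
  rw [opMa_domain] at hΨ
  -- The fiber norm is at most the sum of the `L` component norms; `L + 1` keeps the quotient
  -- meaningful and the bound strict, also for `L = 0`.
  have hδ : 0 < ε / (L + 1) := by positivity
  choose χ hχ h1 h2 using fun i => hs.exists_expSpan hC hinv (hΨ i) hδ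
  have hX : (WithLp.toLp 2 χ : FiberSpace μ L) ∈ tensorDomain L (expSpan (dC ω m C)) := hχ
  have hlt : ∀ Φ : FiberSpace μ L, (∀ i, ‖Φ i‖ < ε / (L + 1)) → ‖Φ‖ < ε := by
    intro Φ hΦ
    refine (norm_fiber_le Φ).trans_lt ?_
    refine (Finset.sum_le_sum fun i _ => (hΦ i).le).trans_lt ?_
    rw [Finset.sum_const, Finset.card_univ, Fintype.card_fin, nsmul_eq_mul, mul_div_assoc',
      div_lt_iff₀ (by positivity)]
    nlinarith
  refine ⟨WithLp.toLp 2 χ, hX, hlt _ h1, hlt _ fun i => ?_⟩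
  have hX' := hle hX
  rw [opMa_domain] at hX'
  rw [ev_opMa (Submodule.sub_mem _ hΨ hX')]
  exact h2 i

end CoreDensity

end FiberHam

end
noncomputable section

namespace FiberHam

section Reduction

variable {M : Type*} [MeasurableSpace M] {μ : Measure M} [SigmaFinite μ] {ν S L : ℕ}
  {ω ω' : M → ℝ} {m : Fin ν → M → ℝ}
  {G : EuclideanSpace ℝ (Fin ν) → Fin ν → OneBoson μ}
  {F : EuclideanSpace ℝ (Fin ν) → Fin S → OneBoson μ}
  {C : OneBoson μ →ₛₗᵢ[starRingEnd ℂ] OneBoson μ}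

/-! ### Dependence on the almost everywhere class of `ω` -/

/-- Second quantization sees only the almost everywhere class of `ω`. Hence `ω` may be replaced by a
version positive everywhere, for which the symbol inequalities hold at every point. -/
theorem dGamma_congr (h : ω =ᵐ[μ] ω') : dGamma μ ω = dGamma μ ω' := by
  have : (dGammaGraph ω : Submodule ℂ (Fock μ × Fock μ)) = dGammaGraph ω' := by
    ext p
    refine forall_congr' fun n => ?_
    have e : (fun k : Fin n → M => ((∑ i, ω (k i) : ℝ) : ℂ) * p.1.wave n k) =ᵐ[prodMeas μ n]
        fun k => ((∑ i, ω' (k i) : ℝ) : ℂ) * p.1.wave n k := by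
      filter_upwards [ae_coord h n] with k hk
      rw [Finset.sum_congr rfl fun i _ => hk i]
    exact ⟨fun h1 => h1.trans e, fun h1 => h1.trans e.symm⟩
  rw [dGamma, dGamma, this]

theorem opM_congr (h : ω =ᵐ[μ] ω') : opM μ ω m = opM μ ω' m := by
  rw [opM, opM, dGamma_congr h]

theorem domHat_congr (h : ω =ᵐ[μ] ω') : domHat μ L ω m = domHat μ L ω' m := by
  rw [domHat, domHat, opM_congr h]

theorem opMa_congr (h : ω =ᵐ[μ] ω') (a : ℝ) (ξ : EuclideanSpace ℝ (Fin ν)) :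
    opMa μ L ω m a ξ = opMa μ L ω' m a ξ := by
  rw [opMa, opMa, dGamma_congr h]

theorem fiberHam_congr (h : ω =ᵐ[μ] ω') (σ : Fin S → Matrix (Fin L) (Fin L) ℂ)
    (V : EuclideanSpace ℝ (Fin ν) → ℝ) (ξ x : EuclideanSpace ℝ (Fin ν)) :
    fiberHam ω m G F σ V ξ x = fiberHam ω' m G F σ V ξ x := by
  rw [fiberHam, fiberHam, scalarHam, scalarHam, dGamma_congr h, opM_congr h, domHat_congr h]

theorem dC_congr (h : ω =ᵐ[μ] ω') : dC ω m C = dC ω' m C := by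
  have : ∀ f : OneBoson μ, (fun k => (totalSymbol ω m k : ℂ) * f k) =ᵐ[μ]
      fun k => (totalSymbol ω' m k : ℂ) * f k := by
    intro f
    filter_upwards [h] with k hk
    rw [totalSymbol, totalSymbol, hk]
  ext f
  exact and_congr_left fun _ => ⟨fun h1 => h1.ae_eq (this f), fun h1 => h1.ae_eq (this f).symm⟩

/-- A version of `ω` that is positive everywhere. -/
def posVersion (ω : M → ℝ) (k : M) : ℝ := if 0 < ω k then ω k else 1

theorem Hyp.ae_eq_posVersion (hyp : Hyp μ ω m G F C) : ω =ᵐ[μ] posVersion ω := by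
  filter_upwards [hyp.omega_pos] with k hk
  rw [posVersion, if_pos hk]

theorem Hyp.posSymbols (hyp : Hyp μ ω m G F C) : PosSymbols (posVersion ω) m where
  pos k := by
    rw [posVersion]
    split_ifs with h
    · exact h
    · exact one_pos
  meas_omega := Measurable.ite (measurableSet_lt measurable_const hyp.measurable_omega)
    hyp.measurable_omega measurable_const
  meas_m := hyp.measurable_m

theorem Hyp.commutesExp (hyp : Hyp μ ω m G F C) : CommutesExp (posVersion ω) m C := by
  intro t x ht f g hg
  have h := hyp.ae_eq_posVersion
  have h1 := hyp.C_comm t x ht f g (by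
    filter_upwards [hg, h] with k h1 h2
    rw [h1, h2])
  filter_upwards [h1, h] with k h1 h2
  rw [h1, h2]

/-! ### The form factors -/

theorem InK.congr {f g : M → ℂ} (hf : InK μ ω m f) (h : f =ᵐ[μ] g) : InK μ ω m g := by
  have : ∫⁻ x, ENNReal.ofReal (((ω x)⁻¹ + totalSymbol ω m x ^ 2) * ‖g x‖ ^ 2) ∂μ =
      ∫⁻ x, ENNReal.ofReal (((ω x)⁻¹ + totalSymbol ω m x ^ 2) * ‖f x‖ ^ 2) ∂μ :=
    lintegral_congr_ae (by filter_upwards [h] with k hk; rw [hk])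
  rw [InK, this]
  exact hf

theorem PosSymbols.inK_of_lp (hs : PosSymbols ω m) (g : Lp ℂ 2 (kMeasure μ ω m)) :
    InK μ ω m g := by
  have h1 := (ofReal_norm_sq_Lp g).trans (lintegral_withDensity_eq_lintegral_mul_non_measurable μ
    ((hs.meas_omega.inv.add (hs.measurable_totalSymbol.pow_const 2)).ennreal_ofReal)
    (Filter.Eventually.of_forall fun _ => ENNReal.ofReal_lt_top)
    fun x => ENNReal.ofReal (‖g x‖ ^ 2))
  have h2 : ∀ x, ENNReal.ofReal (((ω x)⁻¹ + totalSymbol ω m x ^ 2) * ‖g x‖ ^ 2) =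
      ENNReal.ofReal ((ω x)⁻¹ + totalSymbol ω m x ^ 2) * ENNReal.ofReal (‖g x‖ ^ 2) := fun x => by
    have := hs.pos x
    exact ENNReal.ofReal_mul (by positivity)
  simp only [InK, h2]
  exact ne_of_eq_of_ne h1.symm ENNReal.ofReal_ne_top

theorem Hyp.inK (hyp : Hyp μ ω m G F C) {f : EuclideanSpace ℝ (Fin ν) → M → ℂ}
    (hf : ContBddInK μ ω m f) (x : EuclideanSpace ℝ (Fin ν)) : InK μ (posVersion ω) m (f x) := by
  have hk : kMeasure μ ω m = kMeasure μ (posVersion ω) m := withDensity_congr_ae (by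
    filter_upwards [hyp.ae_eq_posVersion] with k hk
    rw [totalSymbol, totalSymbol, hk])
  rw [ContBddInK, hk] at hf
  obtain ⟨g, hg⟩ := hf
  exact (hyp.posSymbols.inK_of_lp (g x)).congr (hg x)

theorem InK.sum (hs : PosSymbols ω m) {ι : Type*} (s : Finset ι) {f : ι → OneBoson μ}
    (hf : ∀ i ∈ s, InK μ ω m (f i)) : InK μ ω m (∑ i ∈ s, f i : OneBoson μ) := by
  refine InK.congr ?_ (coeFn_sum s f).symm
  have hw : ∀ k, 0 < (ω k)⁻¹ + totalSymbol ω m k ^ 2 := fun k => by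
    have := hs.pos k
    positivity
  have h1 : ∀ i ∈ s, ∫⁻ k, ENNReal.ofReal (((ω k)⁻¹ + totalSymbol ω m k ^ 2) * ‖f i k‖ ^ 2) ∂μ
      ≠ ⊤ := hf
  refine ne_top_of_le_ne_top (b := ∫⁻ k, ∑ i ∈ s, ENNReal.ofReal (s.card : ℝ) *
    ENNReal.ofReal (((ω k)⁻¹ + totalSymbol ω m k ^ 2) * ‖f i k‖ ^ 2) ∂μ) ?_
    (lintegral_mono fun k => ?_)
  · have hm : ∀ i, AEMeasurable (fun k => ENNReal.ofReal
        (((ω k)⁻¹ + totalSymbol ω m k ^ 2) * ‖f i k‖ ^ 2)) μ := fun i =>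
      ((hs.meas_omega.inv.add (hs.measurable_totalSymbol.pow_const 2)).aemeasurable.mul
        ((Lp.aestronglyMeasurable (f i)).norm.aemeasurable.pow_const 2)).ennreal_ofReal
    rw [lintegral_finsetSum' s fun i _ => (hm i).const_mul _]
    refine ENNReal.sum_ne_top.2 fun i hi => ?_
    rw [lintegral_const_mul' _ _ ENNReal.ofReal_ne_top]
    exact ENNReal.mul_ne_top ENNReal.ofReal_ne_top (h1 i hi)
  · simp only [← ENNReal.ofReal_mul (Nat.cast_nonneg s.card)]
    rw [← ENNReal.ofReal_sum_of_nonneg fun i _ => by have := hw k; positivity]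
    refine ENNReal.ofReal_le_ofReal ?_
    have h2 : ‖∑ i ∈ s, f i k‖ ^ 2 ≤ s.card * ∑ i ∈ s, ‖f i k‖ ^ 2 :=
      (pow_le_pow_left₀ (norm_nonneg _) (norm_sum_le _ _) 2).trans sq_sum_le_card_mul_sum_sq
    refine (mul_le_mul_of_nonneg_left h2 (hw k).le).trans (le_of_eq ?_)
    rw [Finset.mul_sum, Finset.mul_sum]
    exact Finset.sum_congr rfl fun i _ => by ring

theorem Hyp.formFactors (hyp : Hyp μ ω m G F C) (x : EuclideanSpace ℝ (Fin ν)) :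
    FormFactors μ (posVersion ω) m G F x := by
  have hs := hyp.posSymbols
  have him := hyp.inK hyp.k_imG x
  -- The density of `𝔨` is at least `1`, so `𝔨 ⊂ L²`; without this, `toL2` would return its default
  -- value `0`.
  have hmem : MemLp (imDot m (G x)) 2 μ := by
    refine memLp_two_of_lintegral ?_ ?_
    · refine AEStronglyMeasurable.const_mul (Finset.aestronglyMeasurable_fun_sum _ fun l _ => ?_) I
      exact (measurable_ofReal.comp (hyp.measurable_m l)).aestronglyMeasurable.mul
        (Lp.aestronglyMeasurable (G x l))
    · refine ne_top_of_le_ne_top him (lintegral_mono fun k => ENNReal.ofReal_le_ofReal ?_)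
      exact le_mul_of_one_le_left (sq_nonneg _) (hs.weight_bounds k).1
  have heq : toL2 μ (imDot m (G x)) =ᵐ[μ] imDot m (G x) := by
    rw [toL2, dif_pos hmem]
    exact hmem.coeFn_toLp
  exact
    { symbols := hs
      inK_G := fun l => hyp.inK (hyp.k_G l) x
      inK_div := InK.sum hs _ fun l _ => hyp.inK (hyp.k_partialG l l) x
      inK_F := fun j => hyp.inK (hyp.k_F j) x
      inK_imDot := him.congr heq.symm
      imDot_eq := heq }

end Reduction

end FiberHam

end
-- Assembly of the proposition
theorem mainTheorem11 {M : Type*} [MeasurableSpace M] [MeasurableSpace.CountablyGenerated M]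
    (μ : MeasureTheory.Measure M) [MeasureTheory.SigmaFinite μ] {ν S L : ℕ}
    (ω : M → ℝ) (m : Fin ν → M → ℝ)
    (G : EuclideanSpace ℝ (Fin ν) → Fin ν → FiberHam.OneBoson μ)
    (F : EuclideanSpace ℝ (Fin ν) → Fin S → FiberHam.OneBoson μ)
    (C : FiberHam.OneBoson μ →ₛₗᵢ[starRingEnd ℂ] FiberHam.OneBoson μ)
    (hyp : FiberHam.Hyp μ ω m G F C)
    (σ : Fin S → Matrix (Fin L) (Fin L) ℂ) (hσ : ∀ j, (σ j).IsHermitian)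
    (hσ' : ∀ j, ‖Matrix.toEuclideanCLM (𝕜 := ℂ) (σ j)‖ ≤ 1)
    (ξ x : EuclideanSpace ℝ (Fin ν)) :
    -- `Ĥ⁰(ξ,x)` is well-defined and closed on `D̂`, and `D̂` is the domain of `M_a(η)`
    (FiberHam.fiberHam ω m G F σ 0 ξ x).domain = FiberHam.domHat μ L ω m ∧
    (∀ a : ℝ, 1 ≤ a → ∀ η, (FiberHam.opMa μ L ω m a η).domain = FiberHam.domHat μ L ω m) ∧
    (FiberHam.fiberHam ω m G F σ 0 ξ x).IsClosed ∧
    -- relative bounds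
    (∀ ε : ℝ, 0 < ε → ∃ a : ℝ, 1 ≤ a ∧ ∃ c : ℝ, ∀ ψ
      (h : ψ ∈ (FiberHam.fiberHam ω m G F σ 0 ξ x).domain)
      (h₁ : ψ ∈ (FiberHam.opMa μ L ω m 1 ξ).domain) (hₐ : ψ ∈ (FiberHam.opMa μ L ω m a ξ).domain),
      ‖FiberHam.fiberHam ω m G F σ 0 ξ x ⟨ψ, h⟩ - FiberHam.opMa μ L ω m 1 ξ ⟨ψ, h₁⟩‖
        ≤ ε * ‖FiberHam.opMa μ L ω m a ξ ⟨ψ, hₐ⟩‖ + c * ‖ψ‖) ∧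
    (∃ c : ℝ, ∀ ψ (h : ψ ∈ (FiberHam.fiberHam ω m G F σ 0 ξ x).domain)
      (h₁ : ψ ∈ (FiberHam.opMa μ L ω m 1 ξ).domain),
      ‖FiberHam.fiberHam ω m G F σ 0 ξ x ⟨ψ, h⟩‖
        ≤ c * (‖FiberHam.opMa μ L ω m 1 ξ ⟨ψ, h₁⟩‖ + ‖ψ‖)) ∧
    -- cores
    (FiberHam.opMa μ L ω m 1 0).HasCore
      (FiberHam.tensorDomain L (FiberHam.expSpan (FiberHam.dC ω m C))) ∧
    (FiberHam.fiberHam ω m G F σ 0 ξ x).HasCore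
      (FiberHam.tensorDomain L (FiberHam.expSpan (FiberHam.dC ω m C))) ∧
    (∀ D : Submodule ℂ (FiberHam.FiberSpace μ L), (FiberHam.opMa μ L ω m 1 0).HasCore D →
      (FiberHam.fiberHam ω m G F σ 0 ξ x).HasCore D) ∧
    -- self-adjointness
    (FiberHam.divG G x = 0 → IsSelfAdjoint (FiberHam.fiberHam ω m G F σ 0 ξ x)) := by
  -- All operators are rewritten in terms of `posVersion ω`, to which the estimates apply.
  have hae := hyp.ae_eq_posVersion
  have hf := hyp.formFactors x
  have hs := hyp.posSymbols
  have hH := FiberHam.fiberHam_congr (m := m) (G := G) (F := F) hae σ 0 ξ x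
  have hM := FiberHam.opMa_congr (L := L) (m := m) hae
  have hD := FiberHam.domHat_congr (L := L) (m := m) hae
  have hdom : (FiberHam.fiberHam ω m G F σ 0 ξ x).domain = FiberHam.domHat μ L ω m := by
    rw [hH, hD, hf.fiberHam_domain]
  have hcore : (FiberHam.opMa μ L ω m 1 0).HasCore
      (FiberHam.tensorDomain L (FiberHam.expSpan (FiberHam.dC ω m C))) := by
    rw [hM, FiberHam.dC_congr hae]
    exact hs.hasCore_opMa hyp.commutesExp hyp.C_invol
  have hcores : ∀ D : Submodule ℂ (FiberHam.FiberSpace μ L),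
      (FiberHam.opMa μ L ω m 1 0).HasCore D →
      (FiberHam.fiberHam ω m G F σ 0 ξ x).HasCore D := by
    intro D h
    rw [hM] at h
    rw [hH]
    exact hf.hasCore_fiberHam h
  refine ⟨hdom, fun a _ η => FiberHam.opMa_domain a η, ?_, fun ε hε => ?_, ?_, hcore,
    hcores _ hcore, hcores, fun hdiv => ?_⟩
  · rw [hH]
    exact hf.isClosed_fiberHam
  · obtain ⟨a, ha, c, -, h⟩ := hf.relative_bound σ ξ hε
    refine ⟨a, ha, c, fun ψ h₀ h₁ hₐ => ?_⟩
    rw [← FiberHam.ev_of_mem _ h₀, ← FiberHam.ev_of_mem _ h₁, ← FiberHam.ev_of_mem _ hₐ, hH, hM, hM]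
    exact h ψ (by rwa [← hD, ← hdom])
  · obtain ⟨c, -, h⟩ := hf.norm_fiberHam_le σ ξ
    refine ⟨c, fun ψ h₀ h₁ => ?_⟩
    rw [← FiberHam.ev_of_mem _ h₀, ← FiberHam.ev_of_mem _ h₁, hH, hM]
    exact h ψ (by rwa [← hD, ← hdom])
  · rw [hH]
    exact hf.isSelfAdjoint_fiberHam hσ hdiv
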